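/- \textbf{Setting.} Let $p=(p_k)_{0\le k\le\infty}$ be a probability law on $\{0,1,2,\dots\}\cup\{\infty\}$, $f(s)=\sum_{k<\infty}p_ks^k$ (so $f(1)=1-p_\infty$), and let $f_n$ be the $n$-fold iterate of $f$. Let $(Z_n)$ be the Galton--Watson process with offspring law $p$, in which $\infty$ is absorbing; let $P_n(i,j)$ be its $n$-step transition probabilities, and put $T_0=\inf\{n:Z_n=0\}$, $T_1=\inf\{n:Z_n=\infty\}$, $T=T_0\wedge T_1$. Let $q$ be the smallest root of $f(x)=x$ in $[0,1]$ and $\gamma=f'(q)$ (a left derivative if $q=1$). The law $p$ is regular if $p_\infty=0$ and subcritical if $E Z_1<1$ when $Z_0=1$ (where $EZ_1=\infty$ if $p_\infty>0$). It is a \emph{theta-branching} law if, for some $\theta\in[-1,1]$, one of the following holds: (U) $\theta\in(0,1]$, $a\ge1$, $c>0$, $f(s)=1-[a(1-s)^{-\theta}+c]^{-1/\theta}$ for $0\le s<1$; set $A=1$ and, if $a>1$, write $c=(a-1)d$ with $d>0$; (P) $\theta\in(-1,0)\cup(0,1]$, $a\in(0,1)$, either $A=1$ and $q\in[0,1)$,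 or $A>1$ and $q\in[0,1]$, and $f(s)=A-[a(A-s)^{-\theta}+(1-a)(A-q)^{-\theta}]^{-1/\theta}$ for $0\le s<A$; (L) $\theta=0$, $a,A,q$ as in (P), and $f(s)=A-(A-q)^{1-a}(A-s)^a$ for $0\le s<A$; (D) $\theta=-1$, $a\in(0,1)$, $q\in[0,1]$, $f(s)=as+(1-a)q$ for $s\ge0$. In (P), (L), (D) the parameter $q$ is indeed the smallest root and $\gamma=a$; in (U), $q=1$ and $\gamma=a^{-1/\theta}$. \textbf{1. The $Q$-process.} For every theta-branching law and $Z_0=i\ge1$, $P_i(T>n)=f_n(1)^i-f_n(0)^i$. If $q>0$, the numbers $$Q_n(i,j)=\frac{j\,q^{j-i}P_n(i,j)}{\gamma^n i},\qquad i,j\ge1,$$ are the $n$-step transition probabilities of a Markov chain on $\{1,2,\dots\}$ (the $Q$-process), with $$\sum_{j\ge1}Q_n(i,j)s^j=s\,\frac{f_n'(sq)}{f_n'(q)}\Big(\frac{f_n(sq)}{q}\Big)^{i-1},\qquad 0\le s\le1.$$ Moreover, for all $n$ and $j_1,\dots,j_n\ge1$, as $k\to\infty$, $$P_i(Z_1=j_1,\dots,Z_n=j_n\mid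 n+k<T<\infty)\to P_i(Z_1=j_1,\dots,Z_n=j_n)\,\frac{j_nq^{j_n}}{\gamma^niq^i}=Q_1(i,j_1)Q_1(j_1,j_2)\cdots Q_1(j_{n-1},j_n),$$ and the same limit holds given $T>n+k$ if $p_\infty>0$ or $q=1$. All conditioning events have positive probability. \textbf{2. The function $Q$.} Put $$Q(s)=\begin{cases}(A-s)^{-\theta}-(A-q)^{-\theta}&\text{in (P)},\\ \log\frac{A-s}{A-q}&\text{in (L)},\\ q-s&\text{in (D)},\\ [(1-s)^{-\theta}+d]^{-1/\theta},\quad Q(1)=0&\text{in (U) with }a>1,\end{cases}$$ and $D=[0,A)$ in (P), (L), $D=[0,\infty)$ in (D), $D=[0,1]$ in (U). Then $f(D)\subset D$ (in (U), for $a>1$), $Q(f(s))=\gamma Q(s)$ on $D$, $Q(q)=0$, and $C:=Q'(q)$ is finite and non-zero: $C=\theta(A-q)^{-\theta-1}$, $-(A-q)^{-1}$, $-1$, $-1$, respectively (one-sided within $[0,1]$ if $q\in\{0,1\}$). The function $Q/C$ is on $[0,1)$ the only $R$ with $R(f(s))=\gamma R(s)$ for $s\in[0,1)$, $R(q)=0$,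 $R'(q)=1$. Further $Q(s)/C=\sum_{j\ge0}\nu_js^j$ on $D$ with $\nu_j\ge0$ for $j\ge1$, and $$\gamma^{-n}P_n(i,j)\to i\,q^{i-1}\nu_j,\qquad i,j\ge1.$$ If $q>0$, then $Q_n(i,j)\to jq^{j-1}\nu_j$, which is a stationary probability distribution of the $Q$-process, with $\sum_{j\ge1}jq^{j-1}\nu_js^j=sQ'(sq)/C$ for $0\le s\le1$. In the critical case, (U) with $a=1$ (so $q=\gamma=1$), the solution is trivial: if $R(f(s))=R(s)$ on $[0,1)$, $R(1)=0$ and $R$ is left-continuous at $1$, then $R\equiv0$ on $[0,1]$; and $P_n(i,j)\to0$ for all $i,j\ge1$. \textbf{3. The $x\log x$ condition.} Every subcritical theta-branching law satisfies $\sum_{k\ge2}p_kk\log k<\infty$. \textbf{4. Conditional limits.} Let $Z_0=1$. In (P), (L), (D), and (U) with $a>1$, for $j\ge1$ and $0\le s\le1$ (all conditioning events have positive probability): (a) if $q>0$, then $P(Z_n=j\mid n<T_0<\infty)\to b_j$ with $\sum_{j\ge1}b_js^j=1-\dfrac{Q(sq)}{Q(0)}$; (b) if $q=1$ or $p_\infty>0$,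 then $P(Z_n=j\mid T>n)\to b_j$ with $\sum_{j\ge1}b_js^j=\dfrac{Q(s)-Q(0)}{Q(1)-Q(0)}$ (which equals $1-Q(s)/Q(0)$ if $q=1$); (c) if $q<1$ and $p_\infty=0$, then $P(Z_n=j\mid T>n)\to0$. In the critical case, (U) with $a=1$, for $j\ge1$, $P(Z_n=j\mid T_0=n+1)\to w_j$, where for $0\le s\le1$ $$\sum_{j\ge1}w_js^j=\lim_{n\to\infty}\frac{f_n(sp_0)-f_n(0)}{f_n(p_0)-f_n(0)}=\frac{[1-s(1-[1+c]^{-1/\theta})]^{-\theta}-1}{c}.$$ -/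

import Mathlib

open MeasureTheory ProbabilityTheory Filter Set
open scoped Topology ENNReal

namespace ThetaBranching

noncomputable section

/-! Galton-Watson processes in which a particle may have infinitely many children.
The offspring law is a probability law on `ℕ∞`; `p ⊤` is the explosion probability of a particle. -/

/-- The law of the sum of `n` independent copies of an offspring number with law `p`. -/
def sumLaw (p : PMF ℕ∞) : ℕ → PMF ℕ∞
  | 0 => PMF.pure 0
  | n + 1 => (sumLaw p n).bind fun x => p.map fun y => x + y

/-- One generation: from a finite size `x` the next size is a sum of `x` independent offspring
numbers; infinity is absorbing. -/
def step (p : PMF ℕ∞) (x : ℕ∞) : PMF ℕ∞ :=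
  if x = ⊤ then PMF.pure ⊤ else sumLaw p x.toNat

/-- The law of the size of generation `n` when generation `0` has size `x`. -/
def nStep (p : PMF ℕ∞) : ℕ → ℕ∞ → PMF ℕ∞
  | 0, x => PMF.pure x
  | n + 1, x => (nStep p n x).bind (step p)

/-- The `n`-step transition probability `P_n(i,j)` between finite states. -/
def transProb (p : PMF ℕ∞) (n i j : ℕ) : ℝ := (nStep p n (i : ℕ∞) (j : ℕ∞)).toReal

/-- `p_k`, for finite `k`. -/
def offProb (p : PMF ℕ∞) (k : ℕ) : ℝ := (p (k : ℕ∞)).toReal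

/-- The generating function `f(s) = ∑_{k<∞} p_k s^k`, with `f(1) = 1 - p_∞`. -/
def pgf (p : PMF ℕ∞) (s : ℝ) : ℝ := ∑' k : ℕ, offProb p k * s ^ k

/-- The `n`-fold iteration `f_n` of `f`. -/
def iter (p : PMF ℕ∞) (n : ℕ) : ℝ → ℝ := (pgf p)^[n]

/-- `q`, the smallest root of `f(x) = x` in `[0,1]`. -/
def extRoot (p : PMF ℕ∞) : ℝ := sInf {x : ℝ | x ∈ Icc (0 : ℝ) 1 ∧ pgf p x = x}

/-- `γ = f'(q)` (a left derivative if `q = 1`). -/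
def gam (p : PMF ℕ∞) : ℝ := derivWithin (pgf p) (Icc 0 1) (extRoot p)

/-- The mean offspring number `m = E Z_1`, infinite as soon as `p_∞ > 0`. -/
def meanOffspring (p : PMF ℕ∞) : ℝ≥0∞ := ∑' x : ℕ∞, (x : ℝ≥0∞) * p x

/-- `Z` is a Galton-Watson process with offspring law `p` and `Z_0 = i`: the time-homogeneous
Markov chain with one-step transition probabilities `step p`, started at `i`. -/
structure IsGaltonWatson {Ω : Type*} [MeasurableSpace Ω] (P : Measure Ω) (p : PMF ℕ∞) (i : ℕ)
    (Z : ℕ → Ω → ℕ∞) : Prop where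
  measurable : ∀ n, Measurable (Z n)
  law : ∀ (n : ℕ) (x : ℕ → ℕ∞),
    P {ω | ∀ k ≤ n, Z k ω = x k} =
      (if x 0 = (i : ℕ∞) then 1 else 0) * ∏ k ∈ Finset.range n, step p (x k) (x (k + 1))

/-- The extinction time `T_0 = inf {n : Z_n = 0}`. -/
def extinctionTime {Ω : Type*} (Z : ℕ → Ω → ℕ∞) (ω : Ω) : ℕ∞ :=
  ⨅ n ∈ {n : ℕ | Z n ω = 0}, (n : ℕ∞)

/-- The explosion time `T_1 = inf {n : Z_n = ∞}`. -/
def explosionTime {Ω : Type*} (Z : ℕ → Ω → ℕ∞) (ω : Ω) : ℕ∞ :=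
  ⨅ n ∈ {n : ℕ | Z n ω = ⊤}, (n : ℕ∞)

/-- The absorption time `T = min T_0 T_1`. -/
def absorptionTime {Ω : Type*} (Z : ℕ → Ω → ℕ∞) (ω : Ω) : ℕ∞ :=
  min (extinctionTime Z ω) (explosionTime Z ω)

/-! The families `G_θ`. -/

/-- `f(s) = 1 - [a(1-s)^{-θ} + c]^{-1/θ}` with `θ ∈ (0,1]`, `a ≥ 1`, `c > 0`:
subcritical when `a > 1`, critical when `a = 1`. -/
structure IsUpper (p : PMF ℕ∞) (θ a c : ℝ) : Prop where
  theta_mem : θ ∈ Ioc (0 : ℝ) 1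
  one_le_a : 1 ≤ a
  c_pos : 0 < c
  gen : ∀ s ∈ Ico (0 : ℝ) 1,
    HasSum (fun k : ℕ => offProb p k * s ^ k) (1 - (a * (1 - s) ^ (-θ) + c) ^ (-1 / θ))

/-- The conditions on `a, A, q` in `IsPower` and `IsLog`. -/
def Admissible (A q a : ℝ) : Prop :=
  a ∈ Ioo (0 : ℝ) 1 ∧ ((A = 1 ∧ q ∈ Ico (0 : ℝ) 1) ∨ (1 < A ∧ q ∈ Icc (0 : ℝ) 1))

/-- `f(s) = A - [a(A-s)^{-θ} + (1-a)(A-q)^{-θ}]^{-1/θ}` with `θ ∈ (-1,0) ∪ (0,1]`. -/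
structure IsPower (p : PMF ℕ∞) (θ A q a : ℝ) : Prop where
  theta_mem : θ ∈ Ioo (-1 : ℝ) 0 ∪ Ioc (0 : ℝ) 1
  adm : Admissible A q a
  gen : ∀ s ∈ Ico (0 : ℝ) A,
    HasSum (fun k : ℕ => offProb p k * s ^ k)
      (A - (a * (A - s) ^ (-θ) + (1 - a) * (A - q) ^ (-θ)) ^ (-1 / θ))

/-- `f(s) = A - (A-q)^{1-a} (A-s)^a`, the family `G_0`. -/
structure IsLog (p : PMF ℕ∞) (A q a : ℝ) : Prop where
  adm : Admissible A q a
  gen : ∀ s ∈ Ico (0 : ℝ) A,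
    HasSum (fun k : ℕ => offProb p k * s ^ k) (A - (A - q) ^ (1 - a) * (A - s) ^ a)

/-- `f(s) = a s + (1-a) q`, the family `G_{-1}`. -/
structure IsLinear (p : PMF ℕ∞) (q a : ℝ) : Prop where
  a_mem : a ∈ Ioo (0 : ℝ) 1
  q_mem : q ∈ Icc (0 : ℝ) 1
  gen : ∀ s ∈ Ici (0 : ℝ),
    HasSum (fun k : ℕ => offProb p k * s ^ k) (a * s + (1 - a) * q)

/-- The generating function of `p` belongs to `G_θ`. -/
def InG (p : PMF ℕ∞) (θ : ℝ) : Prop :=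
  (∃ a c, IsUpper p θ a c) ∨ (∃ A q a, IsPower p θ A q a) ∨
    (θ = 0 ∧ ∃ A q a, IsLog p A q a) ∨ (θ = -1 ∧ ∃ q a, IsLinear p q a)

/-! The `Q`-process. -/

/-- The transition probabilities `Q_n(i,j) = j q^{j-i} P_n(i,j) / (γ^n i)`. -/
def qTrans (p : PMF ℕ∞) (n i j : ℕ) : ℝ :=
  (j : ℝ) * extRoot p ^ ((j : ℤ) - (i : ℤ)) * transProb p n i j / (gam p ^ n * (i : ℝ))

/-- The `Q_n(i,j)`, `i,j ≥ 1`, are the transition probabilities of a Markov chain on `{1,2,…}` with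
`∑_j Q_n(i,j) s^j = s (f_n'(sq) / f_n'(q)) (f_n(sq)/q)^{i-1}`. -/
def QChain (p : PMF ℕ∞) : Prop :=
  (∀ n i j, 1 ≤ i → 0 ≤ qTrans p n i j) ∧
  (∀ n i, 1 ≤ i → HasSum (fun j => qTrans p n i j) 1) ∧
  (∀ m n i j, 1 ≤ i →
    HasSum (fun k => qTrans p m i k * qTrans p n k j) (qTrans p (m + n) i j)) ∧
  (∀ n i, 1 ≤ i → ∀ s ∈ Icc (0 : ℝ) 1,
    HasSum (fun j => qTrans p n i j * s ^ j)
      (s * (derivWithin (iter p n) (Icc 0 1) (s * extRoot p) /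
          derivWithin (iter p n) (Icc 0 1) (extRoot p)) *
        (iter p n (s * extRoot p) / extRoot p) ^ (i - 1)))

/-- As `k → ∞`, the law of `(Z_1,…,Z_n)` given `n + k < T < ∞` converges to that of the Markov chain
with transition probabilities `Q_1(i,j)`; when `q = 1` or `p_∞ > 0` (then `T < ∞` almost surely)
the condition may be written `T > n + k`. -/
def QLimit {Ω : Type*} [MeasurableSpace Ω] (P : Measure Ω) (p : PMF ℕ∞) : Prop :=
  ∀ (i : ℕ) (Z : ℕ → Ω → ℕ∞), 1 ≤ i → IsGaltonWatson P p i Z →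
    (∀ n : ℕ, P {ω | (n : ℕ∞) < absorptionTime Z ω ∧ absorptionTime Z ω < ⊤} ≠ 0) ∧
    ∀ (n : ℕ) (j : ℕ → ℕ), j 0 = i → (∀ k, 1 ≤ j k) →
      P.real {ω | ∀ k ∈ Finset.Icc 1 n, Z k ω = (j k : ℕ∞)} *
          ((j n : ℝ) * extRoot p ^ j n / (gam p ^ n * (i : ℝ) * extRoot p ^ i)) =
        ∏ k ∈ Finset.range n, qTrans p 1 (j k) (j (k + 1)) ∧
      Tendsto
        (fun k : ℕ =>
          (cond P {ω | ((n + k : ℕ) : ℕ∞) < absorptionTime Z ω ∧ absorptionTime Z ω < ⊤}).real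
            {ω | ∀ l ∈ Finset.Icc 1 n, Z l ω = (j l : ℕ∞)})
        atTop
        (𝓝 (P.real {ω | ∀ k ∈ Finset.Icc 1 n, Z k ω = (j k : ℕ∞)} *
          ((j n : ℝ) * extRoot p ^ j n / (gam p ^ n * (i : ℝ) * extRoot p ^ i)))) ∧
      (extRoot p = 1 ∨ p ⊤ ≠ 0 →
        Tendsto
          (fun k : ℕ =>
            (cond P {ω | ((n + k : ℕ) : ℕ∞) < absorptionTime Z ω}).real
              {ω | ∀ l ∈ Finset.Icc 1 n, Z l ω = (j l : ℕ∞)})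
          atTop
          (𝓝 (P.real {ω | ∀ k ∈ Finset.Icc 1 n, Z k ω = (j k : ℕ∞)} *
            ((j n : ℝ) * extRoot p ^ j n / (gam p ^ n * (i : ℝ) * extRoot p ^ i)))))

/-- `Q`, with `Q'(q) = C ≠ 0`, solves `Q(f(s)) = γ Q(s)` on `D` with `Q(q) = 0`; and `Q / C` is the
only solution on `[0,1)` whose derivative at `q` is `1`. -/
def SolvesQ (p : PMF ℕ∞) (D : Set ℝ) (Q : ℝ → ℝ) (C : ℝ) : Prop :=
  (∀ s ∈ D, pgf p s ∈ D ∧ Q (pgf p s) = gam p * Q s) ∧ Q (extRoot p) = 0 ∧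
  C ≠ 0 ∧ HasDerivWithinAt Q C (Icc 0 1) (extRoot p) ∧
  ∀ R : ℝ → ℝ, (∀ s ∈ Ico (0 : ℝ) 1, R (pgf p s) = gam p * R s) → R (extRoot p) = 0 →
    HasDerivWithinAt R 1 (Icc 0 1) (extRoot p) → ∀ s ∈ Ico (0 : ℝ) 1, R s = Q s / C

/-- With `Q(s)/C = ∑_{j≥0} ν_j s^j`, one has `γ^{-n} P_n(i,j) → i q^{i-1} ν_j` for `i,j ≥ 1`;
and if `q > 0` then `Q_n(i,j) → j q^{j-1} ν_j`, a stationary probability distribution of the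
`Q`-process, with generating function `s Q'(sq)/C`. -/
def TransLimit (p : PMF ℕ∞) (D : Set ℝ) (Q : ℝ → ℝ) (C : ℝ) : Prop :=
  ∃ ν : ℕ → ℝ, (∀ j, 1 ≤ j → 0 ≤ ν j) ∧
    (∀ s ∈ D, HasSum (fun j => ν j * s ^ j) (Q s / C)) ∧
    (∀ i j, 1 ≤ i → 1 ≤ j →
      Tendsto (fun n => transProb p n i j / gam p ^ n) atTop
        (𝓝 ((i : ℝ) * extRoot p ^ (i - 1) * ν j))) ∧
    (0 < extRoot p →
      (∀ i j, 1 ≤ i →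
        Tendsto (fun n => qTrans p n i j) atTop (𝓝 ((j : ℝ) * extRoot p ^ (j - 1) * ν j))) ∧
      HasSum (fun j : ℕ => (j : ℝ) * extRoot p ^ (j - 1) * ν j) 1 ∧
      (∀ n j, HasSum (fun i : ℕ => (i : ℝ) * extRoot p ^ (i - 1) * ν i * qTrans p n i j)
        ((j : ℝ) * extRoot p ^ (j - 1) * ν j)) ∧
      ∀ s ∈ Icc (0 : ℝ) 1,
        HasSum (fun j : ℕ => (j : ℝ) * extRoot p ^ (j - 1) * ν j * s ^ j)
          (s * derivWithin Q (Icc 0 1) (s * extRoot p) / C))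

/-- For `Z_0 = 1` and events `E Z n` of positive probability, `P(Z_n = j | E Z n) → b_j` for `j ≥ 1`,
where `∑_{j≥1} b_j s^j = g(s)` for `s ∈ [0,1]`. -/
def CondLimit {Ω : Type*} [MeasurableSpace Ω] (P : Measure Ω) (p : PMF ℕ∞)
    (E : (ℕ → Ω → ℕ∞) → ℕ → Set Ω) (g : ℝ → ℝ) : Prop :=
  ∃ b : ℕ → ℝ, b 0 = 0 ∧ (∀ j, 0 ≤ b j) ∧
    (∀ s ∈ Icc (0 : ℝ) 1, HasSum (fun j => b j * s ^ j) (g s)) ∧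
    ∀ Z : ℕ → Ω → ℕ∞, IsGaltonWatson P p 1 Z →
      (∀ n, P (E Z n) ≠ 0) ∧
      ∀ j : ℕ, 1 ≤ j →
        Tendsto (fun n : ℕ => (cond P (E Z n)).real {ω | Z n ω = (j : ℕ∞)}) atTop (𝓝 (b j))

/-- The limits of `Z_n` given non-absorption, `Z_0 = 1`, in terms of `Q`:
given `n < T_0 < ∞` (if `q > 0`); given `T > n` if `q = 1` or `p_∞ > 0`; and given `T > n` in the
remaining, regular supercritical, case, where all the limits vanish. -/
def YaglomLimits {Ω : Type*} [MeasurableSpace Ω] (P : Measure Ω) (p : PMF ℕ∞) (Q : ℝ → ℝ) : Prop :=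
  (0 < extRoot p →
    CondLimit P p (fun Z n => {ω | (n : ℕ∞) < extinctionTime Z ω ∧ extinctionTime Z ω < ⊤})
      (fun s => 1 - Q (s * extRoot p) / Q 0)) ∧
  (extRoot p = 1 ∨ p ⊤ ≠ 0 →
    CondLimit P p (fun Z n => {ω | (n : ℕ∞) < absorptionTime Z ω})
      (fun s => (Q s - Q 0) / (Q 1 - Q 0))) ∧
  (extRoot p < 1 ∧ p ⊤ = 0 →
    CondLimit P p (fun Z n => {ω | (n : ℕ∞) < absorptionTime Z ω}) (fun _ => 0))

/-- All the assertions about a non-critical law with parameters `q`, `γ` and solution `Q` on `D`. -/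
def NonCriticalFacts {Ω : Type*} [MeasurableSpace Ω] (P : Measure Ω) (p : PMF ℕ∞) (q γ : ℝ)
    (D : Set ℝ) (Q : ℝ → ℝ) (C : ℝ) : Prop :=
  extRoot p = q ∧ gam p = γ ∧ SolvesQ p D Q C ∧ TransLimit p D Q C ∧ YaglomLimits P p Q

end

end ThetaBranching

namespace ThetaBranching

/-! ### Power series with nonnegative coefficients -/

/-! Everything rests on one fact: in each non-critical family the generating function f becomes
linear in a suitable coordinate. There are Q and a left inverse G with Q(f(s)) = γQ(s) on D and 0 <
γ < 1, so that f_n(s) = G(γ^n Q(s)). As G(0) = q and G'(0) = 1/C, it follows that f_n(s) → q and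
(f_n(s) - q)/γ^n → Q(s)/C. `Linearizes` records exactly what is needed for this. All non-critical
assertions are derived once from it, and each family only has to supply Q, G and D
(`linearizes_power`, `IsLog.linearizes`, `IsLinear.linearizes`, `IsUpper.linearizes`).

Analysis passes to probability through ∑_j P_n(i,j) s^j = f_n(s)^i (`Invariant.hasSum_transProb`).
Dropping the term j = 0 and dividing by γ^n gives nonnegative coefficients whose generating
functions converge to i q^{i-1} (Q(s) - Q(0))/C. The continuity theorem `exists_limit_coeff` turns
this into limits of the coefficients (`Linearizes.exists_coeff`). Stationarity comes from summing
the limiting coefficients against P_n and using the functional equation once more. Uniqueness of Q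
comes from following R along the orbit f_n(s), which runs into q, where R has derivative 1.

The Q-process is the Doob transform of P_n by h(j) = j q^j, and its generating functions are
derivatives of f_n(y)^i at y = sq. For conditioned processes the Markov property factors each
probability into that of a finite path and a survival probability of the form y_k^j - f_k(0)^j.
Quotients of the latter are computed to first order in a scale δ_k (`tendsto_pow_sub_div`,
`qLimit`).

In the critical family the coordinate (1-s)^{-θ} is translated by c, so 1 - f_n(s) is explicit and
is expanded in powers of 1/(nc). The x log x condition is immediate if f converges beyond 1. For the
families with A = q = 1 it follows from a geometric bound on f'(1) - (1 - f(1-u))/u at u = 2^{-n}.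

The end point 1 needs care throughout. It has to lie in D when q = 1 or explosion is possible, and
there Abel's theorem and one-sided derivatives replace interior arguments. -/

lemma _root_.HasSum.of_eq {ι : Type*} {f g : ι → ℝ} {a b : ℝ} (h : HasSum f a)
    (hfg : ∀ i, g i = f i) (hab : b = a) : HasSum g b := by
  rw [hab, funext hfg]; exact h

/-- The constant coefficient is special throughout: P_n(i,0) tends to q^i and is not of order γ^n,
and ν_0 may be negative. It is therefore split off wherever nonnegativity matters. -/
lemma hasSum_update_zero {c : ℕ → ℝ} {s L : ℝ} :
    HasSum (fun j => (if j = 0 then 0 else c j) * s ^ j) (L - c 0) ↔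
      HasSum (fun j => c j * s ^ j) L := by
  have h0 : HasSum (fun j : ℕ => if j = 0 then c 0 else 0) (c 0) := hasSum_ite_eq 0 (c 0)
  constructor
  · intro h
    refine (h.add h0).of_eq (fun j => ?_) (by ring)
    · rcases eq_or_ne j 0 with rfl | hj <;> simp [*]
  · intro h
    refine (h.sub h0).of_eq (fun j => ?_) rfl
    rcases eq_or_ne j 0 with rfl | hj <;> simp [*]

/-- Abel's theorem for nonnegative coefficients, with its converse. -/
lemma hasSum_of_tendsto_left {c : ℕ → ℝ} (hc : ∀ j, 0 ≤ c j) {F : ℝ → ℝ} {s L : ℝ} (hs : 0 < s)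
    (hF : ∀ x ∈ Ico 0 s, HasSum (fun j => c j * x ^ j) (F x))
    (hL : Tendsto F (𝓝[<] s) (𝓝 L)) : HasSum (fun j => c j * s ^ j) L := by
  have hev : ∀ᶠ x in 𝓝[<] s, x ∈ Ico 0 s := Ico_mem_nhdsLT hs
  have hnn : ∀ j, 0 ≤ c j * s ^ j := fun j => mul_nonneg (hc j) (pow_nonneg hs.le j)
  have hfin : ∀ J : Finset ℕ, ∑ j ∈ J, c j * s ^ j ≤ L := by
    intro J
    have h1 : Tendsto (fun x : ℝ => ∑ j ∈ J, c j * x ^ j) (𝓝[<] s)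
        (𝓝 (∑ j ∈ J, c j * s ^ j)) := by
      apply Tendsto.mono_left _ nhdsWithin_le_nhds
      exact Continuous.tendsto (by fun_prop) s
    refine le_of_tendsto_of_tendsto h1 hL ?_
    filter_upwards [hev] with x hx
    exact sum_le_hasSum J (fun j _ => mul_nonneg (hc j) (pow_nonneg hx.1 j)) (hF x hx)
  have hsum : Summable fun j => c j * s ^ j := summable_of_sum_le hnn hfin
  have hle : L ≤ ∑' j, c j * s ^ j := by
    refine le_of_tendsto hL ?_
    filter_upwards [hev] with x hx
    refine hasSum_le (fun j => ?_) (hF x hx) hsum.hasSum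
    exact mul_le_mul_of_nonneg_left (pow_le_pow_left₀ hx.1 hx.2.le j) (hc j)
  have hge : ∑' j, c j * s ^ j ≤ L := hsum.tsum_le_of_sum_le hfin
  rw [le_antisymm hle hge]
  exact hsum.hasSum

/-- Each c_j r^j is at most the whole sum M, so the derivative series is dominated by a multiple of
(j+1)(x/r)^j. -/
lemma summable_deriv {c : ℕ → ℝ} (hc : ∀ j, 0 ≤ c j) {x r : ℝ} (hx : 0 ≤ x) (hxr : x < r)
    (h : Summable fun j => c j * r ^ j) : Summable fun j => c j * ((j : ℝ) * x ^ (j - 1)) := by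
  have hr : 0 < r := hx.trans_lt hxr
  rw [← summable_nat_add_iff 1]
  set M := ∑' j, c j * r ^ j
  have hM : ∀ j, c j * r ^ j ≤ M := fun j =>
    h.le_tsum j (fun i _ => mul_nonneg (hc i) (pow_nonneg hr.le i))
  have hq : ‖x / r‖ < 1 := by
    rw [Real.norm_of_nonneg (by positivity), div_lt_one hr]
    exact hxr
  have hg : Summable fun j : ℕ => M / r * ((j : ℝ) * (x / r) ^ j + (x / r) ^ j) := by
    apply Summable.mul_left
    refine Summable.add ?_ (summable_geometric_of_norm_lt_one hq)
    simpa using summable_pow_mul_geometric_of_norm_lt_one 1 hq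
  refine Summable.of_nonneg_of_le (fun j => ?_) (fun j => ?_) hg
  · have := hc (j + 1); positivity
  · simp only [Nat.add_sub_cancel, Nat.cast_add, Nat.cast_one]
    have h1 : c (j + 1) ≤ M / r ^ (j + 1) := by
      rw [le_div_iff₀ (by positivity)]; exact hM _
    calc c (j + 1) * (((j : ℝ) + 1) * x ^ j) ≤ M / r ^ (j + 1) * (((j : ℝ) + 1) * x ^ j) := by
          gcongr
      _ = _ := by rw [div_pow, pow_succ]; field_simp

lemma hasDerivWithinAt_of_hasSum {c : ℕ → ℝ} (hc : ∀ j, 0 ≤ c j) {F : ℝ → ℝ}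
    (hF : ∀ x ∈ Ico (0 : ℝ) 1, HasSum (fun j => c j * x ^ j) (F x)) {x : ℝ}
    (hx : x ∈ Ico (0 : ℝ) 1) :
    HasDerivWithinAt F (∑' j, c j * ((j : ℝ) * x ^ (j - 1))) (Icc 0 1) x := by
  obtain ⟨r, hxr, hr1⟩ := exists_between hx.2
  obtain ⟨r', hrr, hr'1⟩ := exists_between hr1
  have hr0 : 0 < r := hx.1.trans_lt hxr
  have hd := hasDerivAt_tsum_of_isPreconnected (g := fun j (y : ℝ) => c j * y ^ j)
    (g' := fun j (y : ℝ) => c j * ((j : ℝ) * y ^ (j - 1))) (t := Ioo (-r) r) (y₀ := 0) (y := x)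
    -- Two radii are used: the derivative series is dominated by its value at r, which is finite
    -- because the series itself converges at r' > r.
    (summable_deriv hc hr0.le hrr (hF r' ⟨by linarith, hr'1⟩).summable) isOpen_Ioo
    isPreconnected_Ioo (fun j y _ => (hasDerivAt_pow j y).const_mul (c j))
    (fun j y hy => by
      rw [norm_mul, norm_mul, norm_pow, Real.norm_of_nonneg (hc j), Real.norm_natCast]
      have : ‖y‖ ≤ r := abs_le.2 ⟨hy.1.le, hy.2.le⟩
      have := hc j
      gcongr)
    ⟨by linarith, hr0⟩ (hF 0 (by simp)).summable ⟨by linarith [hx.1], hxr⟩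
  refine hd.hasDerivWithinAt.congr_of_eventuallyEq ?_ (hF x hx).tsum_eq.symm
  have : Iio (1 : ℝ) ∈ 𝓝 x := Iio_mem_nhds hx.2
  filter_upwards [self_mem_nhdsWithin, mem_nhdsWithin_of_mem_nhds this] with y hy hy1
  exact (hF y ⟨hy.1, hy1⟩).tsum_eq.symm

lemma geom_slope (x : ℝ) (j : ℕ) : 1 - x ^ j = (∑ i ∈ Finset.range j, x ^ i) * (1 - x) := by
  rw [geom_sum_mul_neg]

/-- The sum of the derivatives at the end point `1` is the one-sided derivative there. -/
lemma hasSum_deriv_one {c : ℕ → ℝ} (hc : ∀ j, 0 ≤ c j) {F : ℝ → ℝ} {L : ℝ}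
    (hF : ∀ x ∈ Icc (0 : ℝ) 1, HasSum (fun j => c j * x ^ j) (F x))
    (hL : HasDerivWithinAt F L (Icc 0 1) 1) : HasSum (fun j => c j * (j : ℝ)) L := by
  have hne : ∀ᶠ x in 𝓝[<] (1 : ℝ), x ∈ Ico (0 : ℝ) 1 := Ico_mem_nhdsLT one_pos
  have hsl : Tendsto (slope F 1) (𝓝[<] 1) (𝓝 L) := by
    have := hasDerivWithinAt_iff_tendsto_slope.1 hL
    refine this.mono_left (nhdsWithin_le_iff.2 ?_)
    filter_upwards [hne] with x hx
    exact ⟨⟨hx.1, hx.2.le⟩, hx.2.ne⟩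
  -- The difference quotient at 1 is a series whose terms c_j(1 + x + … + x^{j-1}) are at most c_j j
  -- and tend to c_j j. Both inequalities between L and the sum follow by monotone convergence.
  have hterm : ∀ x ∈ Ico (0 : ℝ) 1,
      HasSum (fun j => c j * ∑ i ∈ Finset.range j, x ^ i) (slope F 1 x) := by
    intro x hx
    have h1 : (1 - x) ≠ 0 := by linarith [hx.2]
    have := ((hF 1 (by simp)).sub (hF x ⟨hx.1, hx.2.le⟩)).mul_right (1 - x)⁻¹
    refine this.of_eq (fun j => ?_) ?_
    · have := geom_slope x j
      rw [one_pow, ← mul_sub, this]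
      field_simp
    · rw [slope_def_field, ← neg_div_neg_eq, neg_sub, neg_sub, div_eq_mul_inv]
  have hfin : ∀ J : Finset ℕ, ∑ j ∈ J, c j * (j : ℝ) ≤ L := by
    intro J
    have h1 : Tendsto (fun x : ℝ => ∑ j ∈ J, c j * ∑ i ∈ Finset.range j, x ^ i) (𝓝[<] 1)
        (𝓝 (∑ j ∈ J, c j * (j : ℝ))) := by
      apply Tendsto.mono_left _ nhdsWithin_le_nhds
      have : Continuous (fun x : ℝ => ∑ j ∈ J, c j * ∑ i ∈ Finset.range j, x ^ i) := by fun_prop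
      simpa using this.tendsto 1
    refine le_of_tendsto_of_tendsto h1 hsl ?_
    filter_upwards [hne] with x hx
    refine sum_le_hasSum J (fun j _ => mul_nonneg (hc j) ?_) (hterm x hx)
    exact Finset.sum_nonneg fun i _ => pow_nonneg hx.1 i
  have hsum : Summable fun j => c j * (j : ℝ) :=
    summable_of_sum_le (fun j => mul_nonneg (hc j) (Nat.cast_nonneg j)) hfin
  have hle : L ≤ ∑' j, c j * (j : ℝ) := by
    refine le_of_tendsto hsl ?_
    filter_upwards [hne] with x hx
    refine hasSum_le (fun j => mul_le_mul_of_nonneg_left ?_ (hc j)) (hterm x hx) hsum.hasSum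
    calc ∑ i ∈ Finset.range j, x ^ i ≤ ∑ i ∈ Finset.range j, (1 : ℝ) :=
          Finset.sum_le_sum fun i _ => pow_le_one₀ hx.1 hx.2.le
      _ = j := by simp
  rw [le_antisymm hle (hsum.tsum_le_of_sum_le hfin)]
  exact hsum.hasSum

/-- Termwise differentiation on `[0,1]`; at `1` the sum function has to be differentiable. The
constant coefficient may have any sign. -/
lemma hasSum_deriv {c : ℕ → ℝ} (hc : ∀ j, 1 ≤ j → 0 ≤ c j) {F : ℝ → ℝ}
    (hF : ∀ x ∈ Ico (0 : ℝ) 1, HasSum (fun j => c j * x ^ j) (F x)) {x : ℝ}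
    (hx : x ∈ Icc (0 : ℝ) 1)
    (h1 : x = 1 → HasSum c (F 1) ∧ DifferentiableWithinAt ℝ F (Icc 0 1) 1) :
    HasSum (fun j => c j * ((j : ℝ) * x ^ (j - 1))) (derivWithin F (Icc 0 1) x) := by
  set d : ℕ → ℝ := fun j => if j = 0 then 0 else c j with hd
  have hdn : ∀ j, 0 ≤ d j := by
    intro j
    rcases Nat.eq_zero_or_pos j with h | h
    · simp [hd, h]
    · simpa [hd, h.ne'] using hc j h
  have hdc : (fun j : ℕ => c j * ((j : ℝ) * x ^ (j - 1))) =
      fun j => d j * ((j : ℝ) * x ^ (j - 1)) := by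
    funext j
    rcases Nat.eq_zero_or_pos j with h | h
    · simp [h]
    · simp [hd, h.ne']
  rw [hdc]
  have hFd : ∀ x ∈ Ico (0 : ℝ) 1, HasSum (fun j => d j * x ^ j) (F x - c 0) := fun x hx =>
    hasSum_update_zero.2 (hF x hx)
  have hdw : derivWithin F (Icc 0 1) x = derivWithin (fun y => F y - c 0) (Icc 0 1) x := by
    rw [derivWithin_sub_const]
  have huniq : UniqueDiffWithinAt ℝ (Icc (0 : ℝ) 1) x := uniqueDiffOn_Icc one_pos x hx
  rw [hdw]
  rcases hx.2.lt_or_eq with hlt | rfl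
  · obtain ⟨r, hxr, hr1⟩ := exists_between hlt
    rw [(hasDerivWithinAt_of_hasSum hdn hFd ⟨hx.1, hlt⟩).derivWithin huniq]
    exact (summable_deriv hdn hx.1 hxr (hFd r ⟨hx.1.trans hxr.le, hr1⟩).summable).hasSum
  · obtain ⟨hs, hdiff⟩ := h1 rfl
    have hF1 : ∀ x ∈ Icc (0 : ℝ) 1, HasSum (fun j => d j * x ^ j) (F x - c 0) := by
      intro x hx
      rcases hx.2.lt_or_eq with hlt | rfl
      · exact hFd x ⟨hx.1, hlt⟩
      · exact hasSum_update_zero.2 (by simpa using hs)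
    simpa using hasSum_deriv_one hdn hF1 (hdiff.sub_const (c 0)).hasDerivWithinAt

/-! ### Convergence of coefficients from convergence of generating functions -/

/-- For j ≥ 1 one has s^j ≤ (s/r) r^j. Near s = 0 the constant coefficient is thus controlled by the
sum, with an error linear in s. -/
lemma hasSum_le_add_mul {c : ℕ → ℝ} (hc : ∀ j, 0 ≤ c j) {s r S R : ℝ} (hs : 0 ≤ s) (hsr : s ≤ r)
    (hr : 0 < r) (hS : HasSum (fun j => c j * s ^ j) S) (hR : HasSum (fun j => c j * r ^ j) R) :
    c 0 ≤ S ∧ S ≤ c 0 + s / r * R := by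
  constructor
  · have := le_hasSum hS 0 fun j _ => mul_nonneg (hc j) (pow_nonneg hs j)
    simpa using this
  · refine hasSum_le (fun j => ?_) hS ((hasSum_ite_eq 0 (c 0)).add (hR.mul_left (s / r)))
    rcases j with _ | j
    · simp only [pow_zero, mul_one, if_true]
      have := hc 0
      have : 0 ≤ s / r * c 0 := by positivity
      linarith
    · have h1 : s ^ j ≤ r ^ j := pow_le_pow_left₀ hs hsr j
      have h2 : s / r * (c (j + 1) * r ^ (j + 1)) = c (j + 1) * s * r ^ j := by
        rw [pow_succ]; field_simp
      simp only [Nat.add_eq_zero_iff, one_ne_zero, and_false, if_false, zero_add]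
      rw [h2, pow_succ']
      have h3 := hc (j + 1)
      calc c (j + 1) * (s * s ^ j) = c (j + 1) * s * s ^ j := by ring
        _ ≤ _ := by gcongr

/-- For small s the value F_n(s) lies within 2sM of the constant coefficient, uniformly in large n.
Convergence at that single s makes the coefficients Cauchy. -/
lemma exists_tendsto_coeff_zero {a : ℕ → ℕ → ℝ} (ha : ∀ n j, 0 ≤ a n j) {F : ℕ → ℝ → ℝ}
    {G : ℝ → ℝ} (hF : ∀ n, ∀ s ∈ Ioo (0 : ℝ) 1, HasSum (fun j => a n j * s ^ j) (F n s))
    (hG : ∀ s ∈ Ioo (0 : ℝ) 1, Tendsto (fun n => F n s) atTop (𝓝 (G s))) :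
    ∃ b, Tendsto (fun n => a n 0) atTop (𝓝 b) := by
  apply cauchySeq_tendsto_of_complete
  have hhalf : (1 / 2 : ℝ) ∈ Ioo (0 : ℝ) 1 := by norm_num
  set M := |G (1 / 2)| + 1 with hM
  have hM0 : 0 < M := by positivity
  have hev : ∀ᶠ n in atTop, F n (1 / 2) < M :=
    (hG _ hhalf).eventually_lt_const (by linarith [le_abs_self (G (1 / 2))])
  rw [Metric.cauchySeq_iff]
  intro ε hε
  -- Chosen so that the error 2sM is at most ε/4.
  set s := min (1 / 2) (ε / (8 * M)) with hs
  have hs0 : 0 < s := lt_min (by norm_num) (by positivity)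
  have hs2 : s ≤ 1 / 2 := min_le_left _ _
  have hsM : s * M ≤ ε / 8 := by
    calc s * M ≤ ε / (8 * M) * M := by gcongr; exact min_le_right _ _
      _ = ε / 8 := by field_simp
  have hsI : s ∈ Ioo (0 : ℝ) 1 := ⟨hs0, by linarith⟩
  obtain ⟨N, hN⟩ := eventually_atTop.1
    (hev.and (Metric.tendsto_nhds.1 (hG s hsI) (ε / 4) (by positivity)))
  refine ⟨N, fun m hm n hn => ?_⟩
  obtain ⟨hm1, hm2⟩ := hN m hm
  obtain ⟨hn1, hn2⟩ := hN n hn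
  obtain ⟨m3, m4⟩ := hasSum_le_add_mul (ha m) hs0.le hs2 (by norm_num) (hF m s hsI)
    (hF m _ hhalf)
  obtain ⟨n3, n4⟩ := hasSum_le_add_mul (ha n) hs0.le hs2 (by norm_num) (hF n s hsI)
    (hF n _ hhalf)
  rw [Real.dist_eq, abs_lt] at *
  have em : s / (1 / 2) * F m (1 / 2) ≤ ε / 4 := by nlinarith
  have en : s / (1 / 2) * F n (1 / 2) ≤ ε / 4 := by nlinarith
  constructor <;> linarith

/-- Subtracting the convergent constant coefficient and dividing by s shifts the series by one
place, which preserves all hypotheses. -/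
lemma exists_tendsto_coeff (j : ℕ) : ∀ {a : ℕ → ℕ → ℝ} {F : ℕ → ℝ → ℝ} {G : ℝ → ℝ},
    (∀ n j, 0 ≤ a n j) → (∀ n, ∀ s ∈ Ioo (0 : ℝ) 1, HasSum (fun j => a n j * s ^ j) (F n s)) →
    (∀ s ∈ Ioo (0 : ℝ) 1, Tendsto (fun n => F n s) atTop (𝓝 (G s))) →
    ∃ b, Tendsto (fun n => a n j) atTop (𝓝 b) := by
  induction j with
  | zero => exact fun ha hF hG => exists_tendsto_coeff_zero ha hF hG
  | succ j ih =>
    intro a F G ha hF hG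
    obtain ⟨b, hb⟩ := exists_tendsto_coeff_zero ha hF hG
    refine ih (a := fun n k => a n (k + 1)) (F := fun n s => (F n s - a n 0) / s)
      (G := fun s => (G s - b) / s) (fun n k => ha n (k + 1)) (fun n s hs => ?_)
      (fun s hs => ((hG s hs).sub hb).div_const s)
    have h := (hasSum_nat_add_iff' 1).2 (hF n s hs)
    simp only [Finset.range_one, Finset.sum_singleton, pow_zero, mul_one] at h
    refine (h.div_const s).of_eq (fun k => ?_) rfl
    have := hs.1.ne'
    rw [pow_succ]
    field_simp

/-- Boundedness of the sums at a larger radius r bounds the terms at s by a geometric series, so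
dominated convergence applies. -/
lemma hasSum_of_tendsto_coeff {a : ℕ → ℕ → ℝ} (ha : ∀ n j, 0 ≤ a n j) {b : ℕ → ℝ}
    (hb : ∀ j, Tendsto (fun n => a n j) atTop (𝓝 (b j))) {s r : ℝ} (hs : 0 ≤ s) (hsr : s < r)
    {S R : ℕ → ℝ} {S' R' : ℝ} (hS : ∀ n, HasSum (fun j => a n j * s ^ j) (S n))
    (hR : ∀ n, HasSum (fun j => a n j * r ^ j) (R n))
    (hS' : Tendsto S atTop (𝓝 S')) (hR' : Tendsto R atTop (𝓝 R')) :
    HasSum (fun j => b j * s ^ j) S' := by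
  have hr : 0 < r := hs.trans_lt hsr
  have hq : ‖s / r‖ < 1 := by
    rw [Real.norm_of_nonneg (by positivity), div_lt_one hr]
    exact hsr
  have hbound : Summable fun j : ℕ => (R' + 1) * (s / r) ^ j :=
    (summable_geometric_of_norm_lt_one hq).mul_left _
  have hdom : ∀ᶠ n in atTop, ∀ j, ‖a n j * s ^ j‖ ≤ (R' + 1) * (s / r) ^ j := by
    filter_upwards [hR'.eventually_lt_const (lt_add_one R')] with n hn j
    rw [Real.norm_of_nonneg (mul_nonneg (ha n j) (pow_nonneg hs j)), div_pow]
    have h1 : a n j * r ^ j ≤ R' + 1 :=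
      (le_hasSum (hR n) j fun i _ => mul_nonneg (ha n i) (pow_nonneg hr.le i)).trans hn.le
    calc a n j * s ^ j = a n j * r ^ j * (s ^ j / r ^ j) := by field_simp
      _ ≤ _ := by gcongr
  have ht := tendsto_tsum_of_dominated_convergence hbound
    (fun j => (hb j).mul_const (s ^ j)) hdom
  simp only [fun n => (hS n).tsum_eq] at ht
  rw [tendsto_nhds_unique hS' ht]
  refine (Summable.of_norm_bounded hbound fun j => ?_).hasSum
  exact le_of_tendsto ((hb j).mul_const (s ^ j)).norm (hdom.mono fun n hn => hn j)

/-- The continuity theorem for generating functions. -/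
lemma exists_limit_coeff {D : Set ℝ} (hD : Ico (0 : ℝ) 1 ⊆ D) (hD0 : ∀ s ∈ D, 0 ≤ s)
    (hDc : ∀ s ∈ D, Icc 0 s ⊆ D) {a : ℕ → ℕ → ℝ} (ha : ∀ n j, 0 ≤ a n j) {F : ℕ → ℝ → ℝ}
    {G : ℝ → ℝ} (hF : ∀ n, ∀ s ∈ D, HasSum (fun j => a n j * s ^ j) (F n s))
    (hG : ∀ s ∈ D, Tendsto (fun n => F n s) atTop (𝓝 (G s))) (hGc : ContinuousOn G D) :
    ∃ b : ℕ → ℝ, (∀ j, 0 ≤ b j) ∧ (∀ j, Tendsto (fun n => a n j) atTop (𝓝 (b j))) ∧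
      ∀ s ∈ D, HasSum (fun j => b j * s ^ j) (G s) := by
  have hIoo : ∀ s ∈ Ioo (0 : ℝ) 1, s ∈ D := fun s hs => hD ⟨hs.1.le, hs.2⟩
  choose b hb using fun j => exists_tendsto_coeff j ha (fun n s hs => hF n s (hIoo s hs))
    (fun s hs => hG s (hIoo s hs))
  have hb0 : ∀ j, 0 ≤ b j := fun j => ge_of_tendsto' (hb j) fun n => ha n j
  have hlt : ∀ s r, 0 ≤ s → s < r → r ∈ D → HasSum (fun j => b j * s ^ j) (G s) := by
    intro s r hs hsr hr
    have hsD : s ∈ D := hDc r hr ⟨hs, hsr.le⟩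
    exact hasSum_of_tendsto_coeff ha hb hs hsr (fun n => hF n s hsD) (fun n => hF n r hr)
      (hG s hsD) (hG r hr)
  refine ⟨b, hb0, hb, fun s hs => ?_⟩
  rcases (hD0 s hs).eq_or_lt with rfl | hpos
  · exact hlt 0 (1 / 2) le_rfl (by norm_num) (hIoo _ (by norm_num))
  -- No radius beyond s need lie in D, so s is reached from the left by Abel's theorem and the
  -- continuity of G.
  · refine hasSum_of_tendsto_left hb0 hpos (fun x hx => hlt x s hx.1 hx.2 hs) ?_
    refine (hGc s hs).tendsto.mono_left (nhdsWithin_le_iff.2 ?_)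
    filter_upwards [Ico_mem_nhdsLT hpos] with x hx
    exact hDc s hs ⟨hx.1, hx.2.le⟩

/-- Interleave the two series into a sequence that alternates between them. Its generating functions
are constant, so its coefficients converge, and the even and odd subsequences must have the same
limit. -/
lemma coeff_unique {a b : ℕ → ℝ} (ha : ∀ j, 0 ≤ a j) (hb : ∀ j, 0 ≤ b j) {F : ℝ → ℝ}
    (hA : ∀ s ∈ Ioo (0 : ℝ) 1, HasSum (fun j => a j * s ^ j) (F s))
    (hB : ∀ s ∈ Ioo (0 : ℝ) 1, HasSum (fun j => b j * s ^ j) (F s)) (j : ℕ) : a j = b j := by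
  obtain ⟨c, hc⟩ := exists_tendsto_coeff j (a := fun n => if Even n then a else b)
    (F := fun _ => F) (G := F) (fun n j => by split_ifs <;> simp [ha, hb])
    (fun n s hs => by split_ifs <;> simp [hA s hs, hB s hs])
    (fun s _ => tendsto_const_nhds)
  have h1 := hc.comp (tendsto_id.const_mul_atTop' (two_pos : (0 : ℕ) < 2))
  have h2 := hc.comp ((tendsto_add_atTop_nat 1).comp
    (tendsto_id.const_mul_atTop' (two_pos : (0 : ℕ) < 2)))
  have e1 : (fun _ : ℕ => a j) = (fun n => (if Even n then a else b) j) ∘ fun n : ℕ => 2 * id n := by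
    funext n; simp
  have e2 : (fun _ : ℕ => b j) = (fun n => (if Even n then a else b) j) ∘
      ((fun n => n + 1) ∘ fun n : ℕ => 2 * id n) := by
    funext n
    have : ¬ Even (2 * n + 1) := by simp
    simp [this]
  rw [← e1] at h1
  rw [← e2] at h2
  rw [tendsto_nhds_unique h1 tendsto_const_nhds |>.symm,
    tendsto_nhds_unique h2 tendsto_const_nhds |>.symm]

/-! ### Generating functions of the transition probabilities -/

/-- `s ^ x`, extended by `0` to `x = ∞`. -/
noncomputable def powTop (s : ℝ≥0∞) (x : ℕ∞) : ℝ≥0∞ := if x = ⊤ then 0 else s ^ x.toNat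

/-- The generating function of a law on `ℕ∞`, without convergence conditions. -/
noncomputable def egf (μ : PMF ℕ∞) (s : ℝ≥0∞) : ℝ≥0∞ := ∑' x, μ x * powTop s x

@[simp] lemma powTop_natCast (s : ℝ≥0∞) (k : ℕ) : powTop s (k : ℕ∞) = s ^ k := by
  simp [powTop]

@[simp] lemma powTop_top (s : ℝ≥0∞) : powTop s ⊤ = 0 := by simp [powTop]

@[simp] lemma powTop_zero (s : ℝ≥0∞) : powTop s 0 = 1 := by simp [powTop]

/-- The convention s^∞ = 0, even at s = 1, keeps the power multiplicative on `ℕ∞`. It also makes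
f(1) = 1 - p_∞ and lets the absorbing state ∞ contribute nothing. -/
lemma powTop_add (s : ℝ≥0∞) (x y : ℕ∞) : powTop s (x + y) = powTop s x * powTop s y := by
  induction x using ENat.recTopCoe with
  | top => simp
  | coe m =>
    induction y using ENat.recTopCoe with
    | top => simp
    | coe n =>
      have h := powTop_natCast s (m + n)
      rw [Nat.cast_add] at h
      rw [h, pow_add, powTop_natCast, powTop_natCast]

lemma tsum_enat {f : ℕ∞ → ℝ≥0∞} (h : f ⊤ = 0) : ∑' x, f x = ∑' k : ℕ, f k := by
  refine (Function.Injective.tsum_eq Nat.cast_injective fun x hx => ?_).symm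
  induction x using ENat.recTopCoe with
  | top => exact absurd h hx
  | coe m => exact ⟨m, rfl⟩

lemma tsum_enat_add_top (f : ℕ∞ → ℝ≥0∞) : ∑' x, f x = f ⊤ + ∑' k : ℕ, f k := by
  rw [ENNReal.tsum_eq_add_tsum_ite ⊤, tsum_enat (by simp)]
  simp

lemma egf_eq (μ : PMF ℕ∞) (s : ℝ≥0∞) : egf μ s = ∑' k : ℕ, μ k * s ^ k := by
  rw [egf, tsum_enat (by simp)]
  simp

lemma egf_pure (x : ℕ∞) (s : ℝ≥0∞) : egf (PMF.pure x) s = powTop s x := by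
  rw [egf, tsum_eq_single x]
  · simp
  · intro y hy
    simp [hy]

lemma egf_bind (μ : PMF ℕ∞) (f : ℕ∞ → PMF ℕ∞) (s : ℝ≥0∞) :
    egf (μ.bind f) s = ∑' x, μ x * egf (f x) s := by
  simp only [egf, PMF.bind_apply, ← ENNReal.tsum_mul_right, ← ENNReal.tsum_mul_left]
  rw [ENNReal.tsum_comm]
  simp only [mul_assoc]

lemma egf_sumLaw (p : PMF ℕ∞) (s : ℝ≥0∞) (n : ℕ) : egf (sumLaw p n) s = egf p s ^ n := by
  induction n with
  | zero => simp [sumLaw, egf_pure]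
  | succ n ih =>
    have h : ∀ x, egf (p.map fun y => x + y) s = powTop s x * egf p s := by
      intro x
      rw [← PMF.bind_pure_comp, egf_bind]
      simp only [Function.comp_def, egf_pure, powTop_add]
      rw [egf, ← ENNReal.tsum_mul_left]
      exact tsum_congr fun y => by ring
    rw [sumLaw, egf_bind]
    simp only [h, ← mul_assoc]
    rw [ENNReal.tsum_mul_right, ← egf, ih, pow_succ]

lemma egf_step (p : PMF ℕ∞) (s : ℝ≥0∞) (x : ℕ∞) : egf (step p x) s = powTop (egf p s) x := by
  rw [step]
  split_ifs with h
  · simp [h, egf_pure]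
  · rw [egf_sumLaw, powTop, if_neg h]

lemma egf_nStep (p : PMF ℕ∞) (n : ℕ) (x : ℕ∞) (s : ℝ≥0∞) :
    egf (nStep p n x) s = powTop ((egf p)^[n] s) x := by
  induction n generalizing s with
  | zero => simp [nStep, egf_pure]
  | succ n ih =>
    rw [nStep, egf_bind]
    simp only [egf_step]
    rw [← egf, ih, Function.iterate_succ_apply]

lemma nStep_one (p : PMF ℕ∞) (x : ℕ∞) : nStep p 1 x = step p x := by
  simp [nStep, PMF.pure_bind]

lemma nStep_add (p : PMF ℕ∞) (m n : ℕ) (x : ℕ∞) :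
    nStep p (m + n) x = (nStep p m x).bind (nStep p n) := by
  induction n with
  | zero =>
    have : nStep p 0 = PMF.pure := rfl
    simp [this, PMF.bind_pure]
  | succ n ih =>
    rw [← Nat.add_assoc, nStep, ih, PMF.bind_bind]
    rfl

lemma nStep_top (p : PMF ℕ∞) (n : ℕ) : nStep p n ⊤ = PMF.pure ⊤ := by
  induction n with
  | zero => rfl
  | succ n ih => simp [nStep, ih, PMF.pure_bind, step]

lemma nStep_zero (p : PMF ℕ∞) (n : ℕ) : nStep p n 0 = PMF.pure 0 := by
  induction n with
  | zero => rfl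
  | succ n ih => simp [nStep, ih, PMF.pure_bind, step, sumLaw]

/-- `D` is a set of nonnegative arguments, mapped to itself by `f`, where `f` converges. -/
def Invariant (p : PMF ℕ∞) (D : Set ℝ) : Prop :=
  ∀ s ∈ D, 0 ≤ s ∧ Summable (fun k : ℕ => offProb p k * s ^ k) ∧ pgf p s ∈ D

lemma offProb_nonneg (p : PMF ℕ∞) (k : ℕ) : 0 ≤ offProb p k := ENNReal.toReal_nonneg

lemma transProb_nonneg (p : PMF ℕ∞) (n i j : ℕ) : 0 ≤ transProb p n i j := ENNReal.toReal_nonneg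

lemma ofReal_offProb (p : PMF ℕ∞) (k : ℕ) : ENNReal.ofReal (offProb p k) = p k :=
  ENNReal.ofReal_toReal (p.apply_ne_top _)

lemma ofReal_transProb (p : PMF ℕ∞) (n i j : ℕ) :
    ENNReal.ofReal (transProb p n i j) = nStep p n i j :=
  ENNReal.ofReal_toReal (PMF.apply_ne_top _ _)

/-- Rearrangements of sums are done in `ℝ≥0∞`, where they need no convergence, and are brought back
to the reals here. -/
lemma hasSum_of_tsum_ofReal {ι : Type*} {f : ι → ℝ} (hf : ∀ k, 0 ≤ f k) {L : ℝ} (hL : 0 ≤ L)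
    (h : ∑' k, ENNReal.ofReal (f k) = ENNReal.ofReal L) : HasSum f L := by
  have hne : ∑' k, ENNReal.ofReal (f k) ≠ ⊤ := by rw [h]; exact ENNReal.ofReal_ne_top
  have h1 := ENNReal.hasSum_toReal hne
  rw [← ENNReal.tsum_toReal_eq fun k => ENNReal.ofReal_ne_top, h, ENNReal.toReal_ofReal hL] at h1
  simpa [ENNReal.toReal_ofReal, hf] using h1

lemma tsum_offProb_add_top (p : PMF ℕ∞) :
    HasSum (offProb p) (1 - (p ⊤).toReal) := by
  have h := p.tsum_coe
  rw [tsum_enat_add_top] at h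
  have htop : p ⊤ ≠ ⊤ := p.apply_ne_top _
  have hle : p ⊤ ≤ 1 := p.coe_le_one _
  have h2 : ∑' k : ℕ, p k = 1 - p ⊤ := ENNReal.eq_sub_of_add_eq' (by simp) (by rw [add_comm]; exact h)
  refine hasSum_of_tsum_ofReal (offProb_nonneg p) ?_ ?_
  · have := ENNReal.toReal_mono ENNReal.one_ne_top hle
    simpa using this
  · simp only [ofReal_offProb]
    rw [h2, ENNReal.ofReal_sub _ ENNReal.toReal_nonneg, ENNReal.ofReal_toReal htop,
      ENNReal.ofReal_one]

lemma pgf_one (p : PMF ℕ∞) : pgf p 1 = 1 - (p ⊤).toReal := by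
  simp only [pgf, one_pow, mul_one]
  exact (tsum_offProb_add_top p).tsum_eq

lemma pgf_nonneg (p : PMF ℕ∞) {s : ℝ} (hs : 0 ≤ s) : 0 ≤ pgf p s :=
  tsum_nonneg fun k => mul_nonneg (offProb_nonneg p k) (pow_nonneg hs k)

lemma hasSum_pgf (p : PMF ℕ∞) {s : ℝ} (hs : s ∈ Icc (0 : ℝ) 1) :
    HasSum (fun k : ℕ => offProb p k * s ^ k) (pgf p s) := by
  refine (Summable.of_nonneg_of_le (fun k => ?_) (fun k => ?_) (tsum_offProb_add_top p).summable).hasSum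
  · exact mul_nonneg (offProb_nonneg p k) (pow_nonneg hs.1 k)
  · exact mul_le_of_le_one_right (offProb_nonneg p k) (pow_le_one₀ hs.1 hs.2)

lemma pgf_mem_Icc (p : PMF ℕ∞) {s : ℝ} (hs : s ∈ Icc (0 : ℝ) 1) : pgf p s ∈ Icc (0 : ℝ) 1 := by
  refine ⟨pgf_nonneg p hs.1, ?_⟩
  have h : pgf p s ≤ 1 - (p ⊤).toReal := by
    refine hasSum_le (fun k => ?_) (hasSum_pgf p hs) (tsum_offProb_add_top p)
    exact mul_le_of_le_one_right (offProb_nonneg p k) (pow_le_one₀ hs.1 hs.2)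
  linarith [ENNReal.toReal_nonneg (a := p ⊤)]

lemma invariant_Icc (p : PMF ℕ∞) : Invariant p (Icc 0 1) := fun _ hs =>
  ⟨hs.1, (hasSum_pgf p hs).summable, pgf_mem_Icc p hs⟩

lemma egf_ofReal (p : PMF ℕ∞) {s : ℝ} (hs : 0 ≤ s)
    (hsum : Summable fun k : ℕ => offProb p k * s ^ k) :
    egf p (ENNReal.ofReal s) = ENNReal.ofReal (pgf p s) := by
  rw [egf_eq, pgf, ENNReal.ofReal_tsum_of_nonneg
    (fun k => mul_nonneg (offProb_nonneg p k) (pow_nonneg hs k)) hsum]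
  refine tsum_congr fun k => ?_
  rw [ENNReal.ofReal_mul (offProb_nonneg p k), ofReal_offProb, ENNReal.ofReal_pow hs]

lemma iter_succ (p : PMF ℕ∞) (n : ℕ) (s : ℝ) : iter p (n + 1) s = iter p n (pgf p s) := rfl

lemma iter_succ' (p : PMF ℕ∞) (n : ℕ) (s : ℝ) : iter p (n + 1) s = pgf p (iter p n s) :=
  Function.iterate_succ_apply' _ _ _

lemma iter_zero (p : PMF ℕ∞) (s : ℝ) : iter p 0 s = s := rfl

lemma iter_add (p : PMF ℕ∞) (m n : ℕ) (s : ℝ) : iter p (m + n) s = iter p m (iter p n s) :=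
  Function.iterate_add_apply _ _ _ _

lemma Invariant.iter_mem {p : PMF ℕ∞} {D : Set ℝ} (h : Invariant p D) (n : ℕ) {s : ℝ}
    (hs : s ∈ D) : iter p n s ∈ D := by
  induction n with
  | zero => exact hs
  | succ n ih => rw [iter_succ']; exact (h _ ih).2.2

lemma Invariant.egf_iterate {p : PMF ℕ∞} {D : Set ℝ} (h : Invariant p D) (n : ℕ) {s : ℝ}
    (hs : s ∈ D) : (egf p)^[n] (ENNReal.ofReal s) = ENNReal.ofReal (iter p n s) := by
  induction n with
  | zero => rfl
  | succ n ih =>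
    have := h _ (h.iter_mem n hs)
    rw [Function.iterate_succ_apply', ih, egf_ofReal p this.1 this.2.1, iter_succ']

/-- `∑_j P_n(i,j) s^j = f_n(s)^i`. -/
lemma Invariant.hasSum_transProb {p : PMF ℕ∞} {D : Set ℝ} (h : Invariant p D) (n i : ℕ) {s : ℝ}
    (hs : s ∈ D) : HasSum (fun j => transProb p n i j * s ^ j) (iter p n s ^ i) := by
  have hs0 := (h s hs).1
  have hn0 := (h _ (h.iter_mem n hs)).1
  refine hasSum_of_tsum_ofReal
    (fun j => mul_nonneg (transProb_nonneg p n i j) (pow_nonneg hs0 j)) (pow_nonneg hn0 i) ?_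
  rw [ENNReal.ofReal_pow hn0, ← h.egf_iterate n hs, ← powTop_natCast, ← egf_nStep, egf_eq]
  refine tsum_congr fun j => ?_
  rw [ENNReal.ofReal_mul (transProb_nonneg p n i j), ofReal_transProb, ENNReal.ofReal_pow hs0]

lemma hasSum_transProb (p : PMF ℕ∞) (n i : ℕ) {s : ℝ} (hs : s ∈ Icc (0 : ℝ) 1) :
    HasSum (fun j => transProb p n i j * s ^ j) (iter p n s ^ i) :=
  (invariant_Icc p).hasSum_transProb n i hs

lemma iter_mem_Icc (p : PMF ℕ∞) (n : ℕ) {s : ℝ} (hs : s ∈ Icc (0 : ℝ) 1) :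
    iter p n s ∈ Icc (0 : ℝ) 1 := (invariant_Icc p).iter_mem n hs

lemma transProb_zero_right (p : PMF ℕ∞) (n i : ℕ) : transProb p n i 0 = iter p n 0 ^ i := by
  have h := hasSum_transProb p n i (s := 0) (by simp)
  refine h.unique ((hasSum_ite_eq 0 (transProb p n i 0)).of_eq (fun j => ?_) rfl) |>.symm
  rcases eq_or_ne j 0 with rfl | hj <;> simp [*]

lemma transProb_zero_left (p : PMF ℕ∞) (n j : ℕ) :
    transProb p n 0 j = if j = 0 then 1 else 0 := by
  simp only [transProb, Nat.cast_zero, nStep_zero, PMF.pure_apply]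
  split_ifs <;> simp_all

/-- The Chapman-Kolmogorov equation. -/
lemma hasSum_transProb_mul (p : PMF ℕ∞) (m n i j : ℕ) :
    HasSum (fun k => transProb p m i k * transProb p n k j) (transProb p (m + n) i j) := by
  refine hasSum_of_tsum_ofReal
    (fun k => mul_nonneg (transProb_nonneg p m i k) (transProb_nonneg p n k j))
    (transProb_nonneg _ _ _ _) ?_
  rw [ofReal_transProb, nStep_add, PMF.bind_apply, tsum_enat]
  · refine tsum_congr fun k => ?_
    rw [ENNReal.ofReal_mul (transProb_nonneg p m i k), ofReal_transProb, ofReal_transProb]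
  · simp [nStep_top]

lemma pgf_zero (p : PMF ℕ∞) : pgf p 0 = offProb p 0 := by
  rw [pgf, tsum_eq_single 0]
  · simp
  · intro k hk; simp [hk]

lemma pgf_mono (p : PMF ℕ∞) {s t : ℝ} (hs : 0 ≤ s) (hst : s ≤ t) (ht : t ≤ 1) :
    pgf p s ≤ pgf p t := by
  refine hasSum_le (fun k => ?_) (hasSum_pgf p ⟨hs, hst.trans ht⟩) (hasSum_pgf p ⟨hs.trans hst, ht⟩)
  exact mul_le_mul_of_nonneg_left (pow_le_pow_left₀ hs hst k) (offProb_nonneg p k)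

lemma iter_mono (p : PMF ℕ∞) (n : ℕ) {s t : ℝ} (hs : 0 ≤ s) (hst : s ≤ t) (ht : t ≤ 1) :
    iter p n s ≤ iter p n t := by
  induction n with
  | zero => exact hst
  | succ n ih =>
    rw [iter_succ', iter_succ']
    exact pgf_mono p (iter_mem_Icc p n ⟨hs, hst.trans ht⟩).1 ih
      (iter_mem_Icc p n ⟨hs.trans hst, ht⟩).2

/-! ### Hitting times of a path -/

section Hitting

variable {Ω : Type*} (Z : ℕ → Ω → ℕ∞) (y : ℕ∞) (ω : Ω)

/-- The first time at which the path is in `y`. -/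
noncomputable def hittingTime : ℕ∞ := ⨅ n ∈ {n : ℕ | Z n ω = y}, (n : ℕ∞)

variable {Z y ω}

lemma lt_hittingTime_iff {n : ℕ} : (n : ℕ∞) < hittingTime Z y ω ↔ ∀ m ≤ n, Z m ω ≠ y := by
  rw [← ENat.add_one_le_iff (ENat.natCast_ne_top n), hittingTime, le_iInf₂_iff]
  constructor
  · intro h m hm hy
    have := h m hy
    norm_cast at this
    omega
  · intro h m hy
    have : ¬ m ≤ n := fun hm => h m hm hy
    norm_cast
    omega

lemma stays {m : ℕ} (h : ∀ k, Z k ω = y → Z (k + 1) ω = y) (hm : Z m ω = y) {n : ℕ}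
    (hmn : m ≤ n) : Z n ω = y := by
  induction n, hmn using Nat.le_induction with
  | base => exact hm
  | succ n _ ih => exact h n ih

/-- For an absorbing state the event depends on the single coordinate at time n, which is what makes
survival probabilities computable from transition probabilities. -/
lemma lt_hittingTime_iff_of_absorbing (h : ∀ k, Z k ω = y → Z (k + 1) ω = y) {n : ℕ} :
    (n : ℕ∞) < hittingTime Z y ω ↔ Z n ω ≠ y := by
  rw [lt_hittingTime_iff]
  exact ⟨fun h1 => h1 n le_rfl, fun h1 m hm hy => h1 (stays h hy hm)⟩

lemma hittingTime_eq_succ_iff (h : ∀ k, Z k ω = y → Z (k + 1) ω = y) {n : ℕ} :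
    hittingTime Z y ω = ((n + 1 : ℕ) : ℕ∞) ↔ Z n ω ≠ y ∧ Z (n + 1) ω = y := by
  rw [le_antisymm_iff, ← not_lt, lt_hittingTime_iff_of_absorbing h, not_not, Nat.cast_succ,
    ENat.add_one_le_iff (ENat.natCast_ne_top n), lt_hittingTime_iff_of_absorbing h, and_comm]

lemma lt_absorptionTime_iff (h0 : ∀ k, Z k ω = 0 → Z (k + 1) ω = 0)
    (h1 : ∀ k, Z k ω = ⊤ → Z (k + 1) ω = ⊤) (n : ℕ) :
    (n : ℕ∞) < absorptionTime Z ω ↔ Z n ω ≠ 0 ∧ Z n ω ≠ ⊤ := by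
  rw [absorptionTime, lt_min_iff]
  exact and_congr (lt_hittingTime_iff_of_absorbing h0) (lt_hittingTime_iff_of_absorbing h1)

/-- The event that the path agrees with `x` up to time `n`. -/
def pathEvent (Z : ℕ → Ω → ℕ∞) (n : ℕ) (x : ℕ → ℕ∞) : Set Ω := {ω | ∀ k ≤ n, Z k ω = x k}

lemma pathEvent_update (n : ℕ) (x : ℕ → ℕ∞) (y : ℕ∞) :
    pathEvent Z (n + 1) (Function.update x (n + 1) y) =
      pathEvent Z n x ∩ {ω | Z (n + 1) ω = y} := by
  ext ω
  simp only [pathEvent, mem_ofPred_eq, mem_inter_iff]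
  constructor
  · intro h
    refine ⟨fun k hk => ?_, by simpa using h (n + 1) le_rfl⟩
    have := h k (by omega)
    rwa [Function.update_of_ne (by omega)] at this
  · rintro ⟨h1, h2⟩ k hk
    rcases hk.lt_or_eq with h | rfl
    · rw [Function.update_of_ne (by omega)]
      exact h1 k (by omega)
    · simpa using h2

end Hitting

/-! ### Galton-Watson processes -/

section GaltonWatson

variable {Ω : Type*} [MeasurableSpace Ω] {P : Measure Ω} {p : PMF ℕ∞} {i : ℕ} {Z : ℕ → Ω → ℕ∞}

lemma measurableSet_lt_hittingTime (hZ : ∀ n, Measurable (Z n)) (y : ℕ∞) (n : ℕ) :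
    MeasurableSet {ω | (n : ℕ∞) < hittingTime Z y ω} := by
  simp only [lt_hittingTime_iff, ofPred_forall]
  exact MeasurableSet.iInter fun m => MeasurableSet.iInter fun _ =>
    (hZ m (measurableSet_singleton y)).compl

lemma measurableSet_eq (hZ : ∀ n, Measurable (Z n)) (n : ℕ) (y : ℕ∞) :
    MeasurableSet {ω | Z n ω = y} := hZ n (measurableSet_singleton y)

lemma measurableSet_pathEvent (hZ : ∀ n, Measurable (Z n)) (n : ℕ) (x : ℕ → ℕ∞) :
    MeasurableSet (pathEvent Z n x) := by
  simp only [pathEvent, ofPred_forall]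
  exact MeasurableSet.iInter fun m => MeasurableSet.iInter fun _ => measurableSet_eq hZ m _

lemma measure_eq_tsum_inter (hZ : ∀ n, Measurable (Z n)) (k : ℕ) {S : Set Ω}
    (hS : MeasurableSet S) : P S = ∑' y, P (S ∩ {ω | Z k ω = y}) := by
  rw [← measure_iUnion]
  · congr 1
    ext ω
    simp
  · intro y y' hne
    refine Set.disjoint_left.2 fun ω h h' => hne ?_
    exact h.2.symm.trans h'.2
  · exact fun y => hS.inter (measurableSet_eq hZ k y)

namespace IsGaltonWatson

variable (hZ : IsGaltonWatson P p i Z)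
include hZ

lemma measure_pathEvent_update (n : ℕ) (x : ℕ → ℕ∞) (y : ℕ∞) :
    P (pathEvent Z (n + 1) (Function.update x (n + 1) y)) =
      P (pathEvent Z n x) * step p (x n) y := by
  rw [pathEvent, hZ.law, pathEvent, hZ.law, Finset.prod_range_succ, ← mul_assoc]
  congr 1
  · congr 1
    refine Finset.prod_congr rfl fun k hk => ?_
    have := Finset.mem_range.1 hk
    rw [Function.update_of_ne (by omega), Function.update_of_ne (by omega)]
  · simp

/-- Splitting over the value at time n + 1 prolongs the prescribed path by one state. The induction
on m therefore has to hold for all n and x, and its sum is a Chapman-Kolmogorov sum with the first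
step separated. -/
lemma markov (m : ℕ) (y : ℕ∞) : ∀ (n : ℕ) (x : ℕ → ℕ∞),
    P (pathEvent Z n x ∩ {ω | Z (n + m) ω = y}) =
      P (pathEvent Z n x) * nStep p m (x n) y := by
  induction m with
  | zero =>
    intro n x
    simp only [nStep, PMF.pure_apply, Nat.add_zero]
    split_ifs with h
    · rw [mul_one]
      congr 1
      refine inter_eq_left.2 fun ω hω => ?_
      rw [mem_ofPred_eq, h]
      exact hω n le_rfl
    · rw [mul_zero, ← measure_empty (μ := P)]
      congr 1
      refine eq_empty_of_forall_notMem fun ω hω => h ?_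
      exact hω.2.symm.trans (hω.1 n le_rfl)
  | succ m ih =>
    intro n x
    rw [measure_eq_tsum_inter hZ.measurable (n + 1)
      ((measurableSet_pathEvent hZ.measurable n x).inter (measurableSet_eq hZ.measurable _ y)),
      Nat.add_comm m 1, nStep_add, PMF.bind_apply, ← ENNReal.tsum_mul_left]
    refine tsum_congr fun y' => ?_
    have h := ih (n + 1) (Function.update x (n + 1) y')
    rw [hZ.measure_pathEvent_update, pathEvent_update, Function.update_self] at h
    rw [inter_right_comm, nStep_one, ← mul_assoc, ← h, Nat.add_assoc]

/-- The same induction, started from the one-time Markov property. -/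
lemma markov_two (m l : ℕ) (y z : ℕ∞) : ∀ (n : ℕ) (x : ℕ → ℕ∞),
    P (pathEvent Z n x ∩ {ω | Z (n + m) ω = y ∧ Z (n + m + l) ω = z}) =
      P (pathEvent Z n x) * (nStep p m (x n) y * nStep p l y z) := by
  induction m with
  | zero =>
    intro n x
    simp only [nStep, PMF.pure_apply, Nat.add_zero]
    split_ifs with h
    · rw [one_mul, h, ← hZ.markov]
      congr 1
      ext ω
      simp only [mem_inter_iff, mem_ofPred_eq, and_congr_right_iff, and_iff_right_iff_imp]
      exact fun hω _ => hω n le_rfl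
    · rw [zero_mul, mul_zero, ← measure_empty (μ := P)]
      congr 1
      refine eq_empty_of_forall_notMem fun ω hω => h ?_
      exact hω.2.1.symm.trans (hω.1 n le_rfl)
  | succ m ih =>
    intro n x
    have hm : MeasurableSet {ω | Z (n + (m + 1)) ω = y ∧ Z (n + (m + 1) + l) ω = z} :=
      (measurableSet_eq hZ.measurable _ y).inter (measurableSet_eq hZ.measurable _ z)
    rw [measure_eq_tsum_inter hZ.measurable (n + 1)
      ((measurableSet_pathEvent hZ.measurable n x).inter hm),
      Nat.add_comm m 1, nStep_add, PMF.bind_apply, ← ENNReal.tsum_mul_right,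
      ← ENNReal.tsum_mul_left]
    refine tsum_congr fun y' => ?_
    have h := ih (n + 1) (Function.update x (n + 1) y')
    rw [hZ.measure_pathEvent_update, pathEvent_update, Function.update_self] at h
    rw [inter_right_comm, nStep_one, mul_assoc, ← mul_assoc, ← h, ← Nat.add_assoc, Nat.add_assoc n 1 m]

lemma measure_start : P (pathEvent Z 0 fun _ => (i : ℕ∞)) = 1 := by
  rw [pathEvent, hZ.law]
  simp

lemma measurableSet_lt_absorptionTime (n : ℕ) :
    MeasurableSet {ω | (n : ℕ∞) < absorptionTime Z ω} := by
  simp only [absorptionTime, lt_min_iff]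
  exact (measurableSet_lt_hittingTime hZ.measurable 0 n).inter
    (measurableSet_lt_hittingTime hZ.measurable ⊤ n)

variable [IsProbabilityMeasure P]

lemma ae_start : ∀ᵐ ω ∂P, Z 0 ω = i := by
  have h := hZ.measure_start
  rw [← prob_compl_eq_zero_iff (measurableSet_pathEvent hZ.measurable 0 _)] at h
  filter_upwards [compl_mem_ae_iff.2 h] with ω hω
  simpa [pathEvent] using hω

lemma measure_start_inter (S : Set Ω) : P (pathEvent Z 0 (fun _ => (i : ℕ∞)) ∩ S) = P S := by
  refine measure_congr ?_
  filter_upwards [hZ.ae_start] with ω hω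
  apply propext
  change (ω ∈ pathEvent Z 0 (fun _ => (i : ℕ∞)) ∧ ω ∈ S) ↔ ω ∈ S
  rw [and_iff_right_iff_imp]
  intro _ k hk
  rw [Nat.le_zero.1 hk, hω]

lemma measure_eq (n : ℕ) (y : ℕ∞) : P {ω | Z n ω = y} = nStep p n i y := by
  have h := hZ.markov n y 0 fun _ => i
  rwa [hZ.measure_start_inter, hZ.measure_start, one_mul, Nat.zero_add] at h

lemma measure_two (n l : ℕ) (y z : ℕ∞) :
    P {ω | Z n ω = y ∧ Z (n + l) ω = z} = nStep p n i y * nStep p l y z := by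
  have h := hZ.markov_two n l y z 0 fun _ => i
  rwa [hZ.measure_start_inter, hZ.measure_start, one_mul, Nat.zero_add] at h

lemma ae_absorbing {y : ℕ∞} (hy : step p y = PMF.pure y) :
    ∀ᵐ ω ∂P, ∀ k, Z k ω = y → Z (k + 1) ω = y := by
  rw [ae_all_iff]
  intro k
  have h : ∀ᵐ ω ∂P, ∀ z, z ≠ y → ¬ (Z k ω = y ∧ Z (k + 1) ω = z) := by
    rw [ae_all_iff]
    intro z
    by_cases hz : z = y
    · simp [hz]
    · have h0 := hZ.measure_two k 1 y z
      rw [nStep_one, hy, PMF.pure_apply, if_neg hz, mul_zero] at h0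
      filter_upwards [compl_mem_ae_iff.2 h0] with ω hω _
      exact hω
  filter_upwards [h] with ω hω h1
  by_contra h2
  exact hω _ h2 ⟨h1, rfl⟩

lemma ae_zero_absorbing : ∀ᵐ ω ∂P, ∀ k, Z k ω = 0 → Z (k + 1) ω = 0 :=
  hZ.ae_absorbing (by simp [step, sumLaw])

lemma ae_top_absorbing : ∀ᵐ ω ∂P, ∀ k, Z k ω = ⊤ → Z (k + 1) ω = ⊤ :=
  hZ.ae_absorbing (by simp [step])

/-- The probability of following a path and not being absorbed during the next `k` steps. -/
lemma measureReal_path_survival (n k j : ℕ) (x : ℕ → ℕ∞) (hx : x n = j) :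
    P.real (pathEvent Z n x ∩ {ω | ((n + k : ℕ) : ℕ∞) < absorptionTime Z ω}) =
      P.real (pathEvent Z n x) * (iter p k 1 ^ j - iter p k 0 ^ j) := by
  set B := pathEvent Z n x with hB
  have hBm : MeasurableSet B := measurableSet_pathEvent hZ.measurable n x
  have hmt : MeasurableSet {ω | Z (n + k) ω = ⊤} := measurableSet_eq hZ.measurable _ _
  have hm0 : MeasurableSet {ω | Z (n + k) ω = 0} := measurableSet_eq hZ.measurable _ _
  have hfin : P.real (B ∩ {ω | Z (n + k) ω ≠ ⊤}) = P.real B * iter p k 1 ^ j := by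
    have h1 : P (B ∩ {ω | Z (n + k) ω ≠ ⊤}) = P B * ∑' y : ℕ, nStep p k j y := by
      have hm : MeasurableSet (B ∩ {ω | Z (n + k) ω ≠ ⊤}) := hBm.inter hmt.compl
      rw [measure_eq_tsum_inter hZ.measurable (n + k) hm, tsum_enat,
        ← ENNReal.tsum_mul_left]
      · refine tsum_congr fun y => ?_
        rw [← hx, ← hZ.markov]
        congr 1
        ext ω
        change ((ω ∈ B ∧ Z (n + k) ω ≠ ⊤) ∧ Z (n + k) ω = y) ↔ (ω ∈ B ∧ Z (n + k) ω = y)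
        have : Z (n + k) ω = y → Z (n + k) ω ≠ ⊤ := fun h => h ▸ ENat.natCast_ne_top y
        tauto
      · rw [← measure_empty (μ := P)]
        congr 1
        ext ω
        simp +contextual
    have h2 := hasSum_transProb p k j (s := 1) (by simp)
    simp only [one_pow, mul_one] at h2
    rw [measureReal_def, h1, ENNReal.toReal_mul, ← measureReal_def,
      ENNReal.tsum_toReal_eq fun y => PMF.apply_ne_top _ _]
    congr 1
    exact h2.tsum_eq
  have hzero : P.real (B ∩ {ω | Z (n + k) ω = 0}) = P.real B * iter p k 0 ^ j := by
    rw [measureReal_def, hB, hZ.markov, ENNReal.toReal_mul, ← measureReal_def, hx,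
      ← transProb_zero_right]
    rfl
  -- Both 0 and ∞ are absorbing, so survival up to time n + k means that the value then is neither;
  -- f_k(1)^j and f_k(0)^j account for the two exclusions.
  have hcongr : P.real (B ∩ {ω | ((n + k : ℕ) : ℕ∞) < absorptionTime Z ω}) =
      P.real ((B ∩ {ω | Z (n + k) ω ≠ ⊤}) \ (B ∩ {ω | Z (n + k) ω = 0})) := by
    refine measureReal_congr ?_
    filter_upwards [hZ.ae_zero_absorbing, hZ.ae_top_absorbing] with ω h0 h1
    apply propext
    change (ω ∈ B ∧ ((n + k : ℕ) : ℕ∞) < absorptionTime Z ω) ↔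
      ((ω ∈ B ∧ Z (n + k) ω ≠ ⊤) ∧ ¬ (ω ∈ B ∧ Z (n + k) ω = 0))
    rw [lt_absorptionTime_iff h0 h1]
    tauto
  rw [hcongr, measureReal_sdiff _ (hBm.inter hm0), hfin, hzero, mul_sub]
  intro ω hω
  refine ⟨hω.1, ?_⟩
  have : Z (n + k) ω = 0 := hω.2
  simp [this]

lemma measureReal_survival (n : ℕ) :
    P.real {ω | (n : ℕ∞) < absorptionTime Z ω} = iter p n 1 ^ i - iter p n 0 ^ i := by
  have h := hZ.measureReal_path_survival 0 n i (fun _ => i) rfl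
  rwa [measureReal_def, hZ.measure_start_inter, measureReal_def, hZ.measure_start,
    ENNReal.toReal_one, one_mul, ← measureReal_def, Nat.zero_add] at h

/-- The same, with absorption at a finite time; `q` and `r` are the limits of `f_k(0)`, `f_k(1)`. -/
lemma measureReal_path_absorbed {q r : ℝ} (hq : Tendsto (fun k => iter p k 0) atTop (𝓝 q))
    (hr : Tendsto (fun k => iter p k 1) atTop (𝓝 r)) (n k j : ℕ) (x : ℕ → ℕ∞) (hx : x n = j) :
    P.real (pathEvent Z n x ∩
        {ω | ((n + k : ℕ) : ℕ∞) < absorptionTime Z ω ∧ absorptionTime Z ω < ⊤}) =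
      P.real (pathEvent Z n x) * (iter p k 1 ^ j - iter p k 0 ^ j - (r ^ j - q ^ j)) := by
  set B := pathEvent Z n x with hB
  have hBm : MeasurableSet B := measurableSet_pathEvent hZ.measurable n x
  have hTm := hZ.measurableSet_lt_absorptionTime
  -- The event T = ∞ is the decreasing limit of the survival events, which gives its probability as
  -- the limit r^j - q^j to be subtracted.
  have hI : (⋂ k : ℕ, B ∩ {ω | ((n + k : ℕ) : ℕ∞) < absorptionTime Z ω}) =
      B ∩ {ω | absorptionTime Z ω = ⊤} := by
    ext ω
    simp only [mem_iInter, mem_inter_iff, mem_ofPred_eq]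
    constructor
    · intro h
      refine ⟨(h 0).1, ENat.eq_top_iff_forall_gt.2 fun m => ?_⟩
      refine lt_of_le_of_lt ?_ (h m).2
      exact_mod_cast Nat.le_add_left m n
    · rintro ⟨h1, h2⟩ k
      refine ⟨h1, ?_⟩
      rw [h2]
      exact ENat.natCast_lt_top _
  have hlim : P.real (B ∩ {ω | absorptionTime Z ω = ⊤}) = P.real B * (r ^ j - q ^ j) := by
    have h1 := tendsto_measure_iInter_atTop (μ := P)
      (s := fun k : ℕ => B ∩ {ω | ((n + k : ℕ) : ℕ∞) < absorptionTime Z ω})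
      (fun k => (hBm.inter (hTm _)).nullMeasurableSet)
      (fun k l hkl ω hω => ⟨hω.1, lt_of_le_of_lt
        (Nat.cast_le.2 (Nat.add_le_add_left hkl n)) (show _ < absorptionTime Z ω from hω.2)⟩) ⟨0, measure_ne_top _ _⟩
    rw [hI] at h1
    have h2 := (ENNReal.tendsto_toReal (measure_ne_top _ _)).comp h1
    have h3 : Tendsto (fun k => P.real B * (iter p k 1 ^ j - iter p k 0 ^ j)) atTop
        (𝓝 (P.real B * (r ^ j - q ^ j))) := ((hr.pow j).sub (hq.pow j)).const_mul _
    refine tendsto_nhds_unique h2 (h3.congr fun k => ?_)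
    rw [← hZ.measureReal_path_survival n k j x hx]
    rfl
  have hdiff : B ∩ {ω | ((n + k : ℕ) : ℕ∞) < absorptionTime Z ω ∧ absorptionTime Z ω < ⊤} =
      (B ∩ {ω | ((n + k : ℕ) : ℕ∞) < absorptionTime Z ω}) \
        (B ∩ {ω | absorptionTime Z ω = ⊤}) := by
    ext ω
    simp only [mem_inter_iff, mem_ofPred_eq, Set.mem_sdiff, lt_top_iff_ne_top]
    tauto
  rw [hdiff, measureReal_sdiff, hZ.measureReal_path_survival n k j x hx, hlim]
  · ring
  · rw [← hI]
    exact iInter_subset _ k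
  · rw [← hI]
    exact MeasurableSet.iInter fun k => hBm.inter (hTm _)

lemma measureReal_absorbed {q r : ℝ} (hq : Tendsto (fun k => iter p k 0) atTop (𝓝 q))
    (hr : Tendsto (fun k => iter p k 1) atTop (𝓝 r)) (n : ℕ) :
    P.real {ω | (n : ℕ∞) < absorptionTime Z ω ∧ absorptionTime Z ω < ⊤} =
      iter p n 1 ^ i - iter p n 0 ^ i - (r ^ i - q ^ i) := by
  have h := hZ.measureReal_path_absorbed hq hr 0 n i (fun _ => i) rfl
  rwa [measureReal_def, hZ.measure_start_inter, measureReal_def, hZ.measure_start,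
    ENNReal.toReal_one, one_mul, ← measureReal_def, Nat.zero_add] at h

lemma ae_lt_extinctionTime_iff :
    ∀ᵐ ω ∂P, ∀ n : ℕ, (n : ℕ∞) < extinctionTime Z ω ↔ Z n ω ≠ 0 := by
  filter_upwards [hZ.ae_zero_absorbing] with ω h0 n
  exact lt_hittingTime_iff_of_absorbing h0

/-- Extinction as the limit of extinction by time `n + k`. -/
lemma tendsto_measureReal_extinct (S : Set Ω) (n : ℕ) :
    Tendsto (fun k => P.real (S ∩ {ω | Z (n + k) ω = 0})) atTop
      (𝓝 (P.real (S ∩ {ω | extinctionTime Z ω < ⊤}))) := by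
  have hU : (⋃ k : ℕ, S ∩ {ω | ¬ ((n + k : ℕ) : ℕ∞) < extinctionTime Z ω}) =
      S ∩ {ω | extinctionTime Z ω < ⊤} := by
    ext ω
    simp only [mem_iUnion, mem_inter_iff, mem_ofPred_eq, not_lt]
    constructor
    · rintro ⟨k, h1, h2⟩
      exact ⟨h1, h2.trans_lt (ENat.natCast_lt_top _)⟩
    · rintro ⟨h1, h2⟩
      obtain ⟨m, hm⟩ := ENat.ne_top_iff_exists.1 h2.ne
      refine ⟨m, h1, ?_⟩
      rw [← hm]
      exact_mod_cast Nat.le_add_left m n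
  have h1 := tendsto_measure_iUnion_atTop (μ := P)
    (s := fun k : ℕ => S ∩ {ω | ¬ ((n + k : ℕ) : ℕ∞) < extinctionTime Z ω})
    (fun k l hkl ω hω => ⟨hω.1, fun h => hω.2 (lt_of_le_of_lt
        (by exact_mod_cast Nat.add_le_add_left hkl n) h)⟩)
  rw [hU] at h1
  refine ((ENNReal.tendsto_toReal (measure_ne_top _ _)).comp h1).congr fun k => ?_
  refine measureReal_congr ?_
  filter_upwards [hZ.ae_lt_extinctionTime_iff] with ω hω
  apply propext
  change (ω ∈ S ∧ ¬ ((n + k : ℕ) : ℕ∞) < extinctionTime Z ω) ↔ (ω ∈ S ∧ Z (n + k) ω = 0)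
  rw [hω, not_not]

lemma measureReal_two (n l j k : ℕ) :
    P.real {ω | Z n ω = j ∧ Z (n + l) ω = k} = transProb p n i j * transProb p l j k := by
  rw [measureReal_def, hZ.measure_two, ENNReal.toReal_mul, transProb, transProb]

lemma measureReal_eq (n j : ℕ) : P.real {ω | Z n ω = j} = transProb p n i j := by
  rw [measureReal_def, hZ.measure_eq, transProb]

lemma measureReal_eq_zero (n : ℕ) : P.real {ω | Z n ω = 0} = iter p n 0 ^ i := by
  rw [← transProb_zero_right, ← hZ.measureReal_eq, Nat.cast_zero]

/-- Extinction after n but by time n + k is the difference of the events Z_{n+k} = 0 and Z_n = 0;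
then k → ∞. -/
lemma measureReal_extinct {q : ℝ} (hq : Tendsto (fun k => iter p k 0) atTop (𝓝 q)) (n : ℕ) :
    P.real {ω | (n : ℕ∞) < extinctionTime Z ω ∧ extinctionTime Z ω < ⊤} =
      q ^ i - iter p n 0 ^ i := by
  have h1 := hZ.tendsto_measureReal_extinct {ω | (n : ℕ∞) < extinctionTime Z ω} n
  refine tendsto_nhds_unique h1 ?_
  have h2 : Tendsto (fun k => iter p (n + k) 0 ^ i - iter p n 0 ^ i) atTop
      (𝓝 (q ^ i - iter p n 0 ^ i)) := by
    have := hq.comp (tendsto_add_atTop_nat n)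
    simp only [Function.comp_def, Nat.add_comm _ n] at this
    exact (this.pow i).sub_const _
  refine h2.congr fun k => ?_
  rw [← hZ.measureReal_eq_zero, ← hZ.measureReal_eq_zero]
  have h3 : P.real ({ω | (n : ℕ∞) < extinctionTime Z ω} ∩ {ω | Z (n + k) ω = 0}) =
      P.real ({ω | ¬ ((n + k : ℕ) : ℕ∞) < extinctionTime Z ω} \
        {ω | ¬ (n : ℕ∞) < extinctionTime Z ω}) := by
    refine measureReal_congr ?_
    filter_upwards [hZ.ae_lt_extinctionTime_iff] with ω hω
    apply propext
    change ((n : ℕ∞) < extinctionTime Z ω ∧ Z (n + k) ω = 0) ↔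
      (¬ ((n + k : ℕ) : ℕ∞) < extinctionTime Z ω ∧ ¬ ¬ (n : ℕ∞) < extinctionTime Z ω)
    rw [hω (n + k), not_not, not_not, and_comm]
  have hae : ∀ m : ℕ, P.real {ω | ¬ (m : ℕ∞) < extinctionTime Z ω} = P.real {ω | Z m ω = 0} := by
    intro m
    refine measureReal_congr ?_
    filter_upwards [hZ.ae_lt_extinctionTime_iff] with ω hω
    apply propext
    change (¬ (m : ℕ∞) < extinctionTime Z ω) ↔ Z m ω = 0
    rw [hω, not_not]
  rw [h3, measureReal_sdiff, hae, hae]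
  · intro ω hω h
    exact hω (lt_of_le_of_lt (by exact_mod_cast Nat.le_add_right n k) h)
  · exact (measurableSet_lt_hittingTime hZ.measurable 0 n).compl

/-- From state j at time n, extinction within k further steps has probability f_k(0)^j, which tends
to q^j. -/
lemma measureReal_extinct_inter {q : ℝ} (hq : Tendsto (fun k => iter p k 0) atTop (𝓝 q))
    (n : ℕ) {j : ℕ} (hj : 1 ≤ j) :
    P.real ({ω | (n : ℕ∞) < extinctionTime Z ω ∧ extinctionTime Z ω < ⊤} ∩ {ω | Z n ω = j}) =
      transProb p n i j * q ^ j := by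
  have h1 := hZ.tendsto_measureReal_extinct {ω | Z n ω = j} n
  have h2 : Tendsto (fun k => transProb p n i j * iter p k 0 ^ j) atTop
      (𝓝 (transProb p n i j * q ^ j)) := (hq.pow j).const_mul _
  have h3 := tendsto_nhds_unique (h2.congr fun k => ?_) h1
  · rw [h3]
    refine measureReal_congr ?_
    filter_upwards [hZ.ae_lt_extinctionTime_iff] with ω hω
    apply propext
    change (((n : ℕ∞) < extinctionTime Z ω ∧ extinctionTime Z ω < ⊤) ∧ Z n ω = j) ↔
      (Z n ω = j ∧ extinctionTime Z ω < ⊤)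
    rw [hω]
    constructor
    · tauto
    · rintro ⟨h, h'⟩
      refine ⟨⟨?_, h'⟩, h⟩
      rw [h]
      exact_mod_cast (by omega : j ≠ 0)
  · rw [← transProb_zero_right, ← hZ.measureReal_two, Nat.cast_zero]
    rfl

lemma measureReal_survival_inter (n : ℕ) {j : ℕ} (hj : 1 ≤ j) :
    P.real ({ω | (n : ℕ∞) < absorptionTime Z ω} ∩ {ω | Z n ω = j}) = transProb p n i j := by
  rw [← hZ.measureReal_eq]
  refine measureReal_congr ?_
  filter_upwards [hZ.ae_zero_absorbing, hZ.ae_top_absorbing] with ω h0 h1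
  apply propext
  change ((n : ℕ∞) < absorptionTime Z ω ∧ Z n ω = j) ↔ Z n ω = j
  rw [lt_absorptionTime_iff h0 h1, and_iff_right_iff_imp]
  intro h
  rw [h]
  exact ⟨by exact_mod_cast (by omega : j ≠ 0), ENat.natCast_ne_top j⟩

lemma measureReal_extinctionTime_eq (n : ℕ) :
    P.real {ω | extinctionTime Z ω = ((n + 1 : ℕ) : ℕ∞)} =
      iter p (n + 1) 0 ^ i - iter p n 0 ^ i := by
  rw [← hZ.measureReal_eq_zero, ← hZ.measureReal_eq_zero]
  have h1 : P.real {ω | Z n ω = 0} = P.real {ω | Z (n + 1) ω = 0 ∧ Z n ω = 0} := by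
    refine measureReal_congr ?_
    filter_upwards [hZ.ae_zero_absorbing] with ω h0
    apply propext
    change Z n ω = 0 ↔ (Z (n + 1) ω = 0 ∧ Z n ω = 0)
    exact ⟨fun h => ⟨h0 n h, h⟩, fun h => h.2⟩
  rw [h1, ← measureReal_sdiff]
  · refine measureReal_congr ?_
    filter_upwards [hZ.ae_zero_absorbing] with ω h0
    apply propext
    change extinctionTime Z ω = ((n + 1 : ℕ) : ℕ∞) ↔
      (Z (n + 1) ω = 0 ∧ ¬ (Z (n + 1) ω = 0 ∧ Z n ω = 0))
    have := hittingTime_eq_succ_iff h0 (n := n)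
    refine this.trans ?_
    tauto
  · exact fun ω hω => hω.1
  · exact (measurableSet_eq hZ.measurable _ _).inter (measurableSet_eq hZ.measurable _ _)

lemma measureReal_extinctionTime_eq_inter (n : ℕ) {j : ℕ} (hj : 1 ≤ j) :
    P.real ({ω | extinctionTime Z ω = ((n + 1 : ℕ) : ℕ∞)} ∩ {ω | Z n ω = j}) =
      transProb p n i j * offProb p 0 ^ j := by
  have h1 : offProb p 0 ^ j = transProb p 1 j 0 := by
    rw [transProb_zero_right, iter_succ', iter_zero, pgf_zero]
  rw [h1, ← hZ.measureReal_two]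
  refine measureReal_congr ?_
  filter_upwards [hZ.ae_zero_absorbing] with ω h0
  apply propext
  change (extinctionTime Z ω = ((n + 1 : ℕ) : ℕ∞) ∧ Z n ω = j) ↔
    (Z n ω = j ∧ Z (n + 1) ω = ((0 : ℕ) : ℕ∞))
  have := hittingTime_eq_succ_iff h0 (n := n)
  rw [show extinctionTime Z ω = hittingTime Z 0 ω from rfl, this, Nat.cast_zero]
  constructor
  · tauto
  · rintro ⟨h, h'⟩
    refine ⟨⟨?_, h'⟩, h⟩
    rw [h]
    exact_mod_cast (by omega : j ≠ 0)

end IsGaltonWatson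

lemma cond_real_eq_div (E : Set Ω) {A : Set Ω} (hA : MeasurableSet A) :
    (cond P E).real A = P.real (E ∩ A) / P.real E := by
  rw [measureReal_def, cond_apply' hA, ENNReal.toReal_mul, ENNReal.toReal_inv, ← measureReal_def,
    ← measureReal_def, div_eq_inv_mul]

end GaltonWatson

/-! ### The `Q`-process -/

section QChains

variable {p : PMF ℕ∞}

/-- For q > 0 this exhibits the Doob transform by h(j) = j q^j and removes the integer exponent j -
i. -/
lemma qTrans_eq (hq : 0 < extRoot p) (n i j : ℕ) :
    qTrans p n i j = j * extRoot p ^ j / (gam p ^ n * (i * extRoot p ^ i)) * transProb p n i j := by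
  rw [qTrans, zpow_sub₀ hq.ne', zpow_natCast, zpow_natCast]
  field_simp

lemma hasDerivWithinAt_iter (hfix : pgf p (extRoot p) = extRoot p)
    (hd : HasDerivWithinAt (pgf p) (gam p) (Icc 0 1) (extRoot p)) (n : ℕ) :
    HasDerivWithinAt (iter p n) (gam p ^ n) (Icc 0 1) (extRoot p) :=
  hd.iterate _ hfix (fun _ hs => pgf_mem_Icc p hs) n

lemma differentiableWithinAt_iter (n : ℕ) {x : ℝ} (hx : x ∈ Ico (0 : ℝ) 1) :
    DifferentiableWithinAt ℝ (iter p n) (Icc 0 1) x := by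
  refine (hasDerivWithinAt_of_hasSum (c := fun j => transProb p n 1 j)
    (fun j => transProb_nonneg p n 1 j) (fun y hy => ?_) hx).differentiableWithinAt
  simpa using hasSum_transProb p n 1 ⟨hy.1, hy.2.le⟩

/-- The law, the Chapman-Kolmogorov equations and the generating functions of the `Q`-process. -/
theorem qChain (hq0 : 0 < extRoot p) (hq1 : extRoot p ≤ 1) (hfix : pgf p (extRoot p) = extRoot p)
    (hγ : 0 < gam p) (hd : HasDerivWithinAt (pgf p) (gam p) (Icc 0 1) (extRoot p)) :
    QChain p := by
  set q := extRoot p with hq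
  set γ := gam p
  have hqI : q ∈ Icc (0 : ℝ) 1 := ⟨hq0.le, hq1⟩
  have hdn : ∀ n, HasDerivWithinAt (iter p n) (γ ^ n) (Icc 0 1) q := hasDerivWithinAt_iter hfix hd
  have huniq : ∀ x ∈ Icc (0 : ℝ) 1, UniqueDiffWithinAt ℝ (Icc (0 : ℝ) 1) x :=
    uniqueDiffOn_Icc one_pos
  have hgen : ∀ n i, 1 ≤ i → ∀ s ∈ Icc (0 : ℝ) 1, HasSum (fun j => qTrans p n i j * s ^ j)
      (s * (derivWithin (iter p n) (Icc 0 1) (s * q) / derivWithin (iter p n) (Icc 0 1) q) *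
        (iter p n (s * q) / q) ^ (i - 1)) := by
    intro n i hi s hs
    have hx : s * q ∈ Icc (0 : ℝ) 1 := ⟨mul_nonneg hs.1 hq0.le, mul_le_one₀ hs.2 hq0.le hq1⟩
    have hdiff : DifferentiableWithinAt ℝ (iter p n) (Icc 0 1) (s * q) := by
      rcases hx.2.lt_or_eq with h | h
      · exact differentiableWithinAt_iter n ⟨hx.1, h⟩
      -- The point sq equals 1 only if s = q = 1, and there differentiability is that of f_n at its
      -- fixed point q.
      · have hs1 : s = 1 := le_antisymm hs.2 (by nlinarith [hs.1])
        rw [hs1, one_mul]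
        exact (hdn n).differentiableWithinAt
    have h := hasSum_deriv (c := fun j => transProb p n i j) (F := fun y => iter p n y ^ i)
      (fun j _ => transProb_nonneg p n i j) (fun y hy => hasSum_transProb p n i ⟨hy.1, hy.2.le⟩)
      hx (fun h => ⟨by simpa using hasSum_transProb p n i (s := 1) (by simp),
        by rw [h] at hdiff; exact hdiff.pow i⟩)
    rw [derivWithin_fun_pow hdiff i] at h
    rw [(hdn n).derivWithin (huniq q hqI)]
    have hi' : (i : ℝ) ≠ 0 := by positivity
    have hqi : q ^ i = q ^ (i - 1) * q := by rw [← pow_succ, Nat.sub_add_cancel hi]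
    -- The generating function is the termwise derivative of f_n(y)^i at y = sq, multiplied by
    -- sq/(γ^n i q^i).
    refine (h.mul_left (s * q / (γ ^ n * (i * q ^ i)))).of_eq (fun j => ?_) ?_
    · rw [qTrans_eq hq0, ← hq]
      rcases j with _ | j
      · simp
      · rw [Nat.add_sub_cancel, mul_pow, pow_succ, pow_succ]
        ring
    · rw [hqi, div_pow]
      field_simp
  have hterm : ∀ n i j, 1 ≤ i → 0 ≤ qTrans p n i j := by
    intro n i j _
    rw [qTrans_eq hq0]
    have := transProb_nonneg p n i j
    positivity
  refine ⟨hterm, fun n i hi => ?_, fun m n i j hi => ?_, hgen⟩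
  · have hfixn : iter p n q = q := Function.iterate_fixed hfix n
    refine (hgen n i hi 1 (by simp)).of_eq (fun j => by simp) ?_
    rw [one_mul, one_mul, hfixn, div_self hq0.ne', one_pow, mul_one,
      (hdn n).derivWithin (huniq q hqI), div_self (pow_pos hγ n).ne']
  · refine ((hasSum_transProb_mul p m n i j).mul_left
      (j * q ^ j / (γ ^ (m + n) * (i * q ^ i)))).of_eq (fun k => ?_) (qTrans_eq hq0 _ _ _)
    rw [qTrans_eq hq0, qTrans_eq hq0, ← hq, show gam p = γ from rfl]
    -- At the intermediate state 0 the left side vanishes through the weight k, and the right side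
    -- because P_n(0,j) = 0 for j ≠ 0 while the factor j handles j = 0.
    rcases Nat.eq_zero_or_pos k with rfl | hk
    · rw [transProb_zero_left]
      split_ifs with hj <;> simp [*]
    · have : (k : ℝ) ≠ 0 := by positivity
      have : (i : ℝ) ≠ 0 := by positivity
      rw [pow_add]
      field_simp

/-- The weights h(j_{k+1})/h(j_k) telescope along the path. -/
lemma prod_qTrans (hq : 0 < extRoot p) {j : ℕ → ℕ} (hj : ∀ k, 1 ≤ j k) (n : ℕ) :
    ∏ k ∈ Finset.range n, qTrans p 1 (j k) (j (k + 1)) =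
      (∏ k ∈ Finset.range n, transProb p 1 (j k) (j (k + 1))) *
        (j n * extRoot p ^ j n / (gam p ^ n * j 0 * extRoot p ^ j 0)) := by
  induction n with
  | zero =>
    have : (j 0 : ℝ) ≠ 0 := by have := hj 0; positivity
    simp only [Finset.range_zero, Finset.prod_empty, pow_zero, one_mul]
    field_simp
  | succ n ih =>
    have : (j n : ℝ) ≠ 0 := by have := hj n; positivity
    have : (j 0 : ℝ) ≠ 0 := by have := hj 0; positivity
    rw [Finset.prod_range_succ, Finset.prod_range_succ, ih, qTrans_eq hq, pow_one,
      pow_succ (gam p) n]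
    field_simp

/-- If `x_k, y_k → q` and `(y_k - x_k) / δ_k → L` then `(y_k^j - x_k^j) / δ_k → j q^{j-1} L`. -/
lemma tendsto_pow_sub_div {x y δ : ℕ → ℝ} {q L : ℝ} (hx : Tendsto x atTop (𝓝 q))
    (hy : Tendsto y atTop (𝓝 q)) (hL : Tendsto (fun k => (y k - x k) / δ k) atTop (𝓝 L)) (j : ℕ) :
    Tendsto (fun k => (y k ^ j - x k ^ j) / δ k) atTop (𝓝 (j * q ^ (j - 1) * L)) := by
  have h1 : Tendsto (fun k => ∑ i ∈ Finset.range j, y k ^ i * x k ^ (j - 1 - i)) atTop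
      (𝓝 (∑ i ∈ Finset.range j, q ^ i * q ^ (j - 1 - i))) :=
    tendsto_finsetSum _ fun i _ => (hy.pow i).mul (hx.pow _)
  have h2 : ∑ i ∈ Finset.range j, q ^ i * q ^ (j - 1 - i) = j * q ^ (j - 1) := by
    rw [Finset.sum_congr rfl (g := fun _ => q ^ (j - 1)), Finset.sum_const, Finset.card_range,
      nsmul_eq_mul]
    intro i hi
    have := Finset.mem_range.1 hi
    rw [← pow_add]
    congr 1
    omega
  rw [h2] at h1
  refine (h1.mul hL).congr fun k => ?_
  rw [← mul_div_assoc, geom_sum₂_mul]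

variable {Ω : Type*} [MeasurableSpace Ω] {P : Measure Ω} {i : ℕ} {Z : ℕ → Ω → ℕ∞}

/-- The conditional limits prescribe the path from time 1 only, whereas `pathEvent` includes time 0;
the almost sure starting value bridges the two. -/
lemma IsGaltonWatson.inter_path_ae [IsProbabilityMeasure P] (hZ : IsGaltonWatson P p i Z)
    {j : ℕ → ℕ} (hj : j 0 = i) (n : ℕ) (S : Set Ω) :
    P.real (S ∩ {ω | ∀ k ∈ Finset.Icc 1 n, Z k ω = (j k : ℕ∞)}) =
      P.real (pathEvent Z n (fun k => j k) ∩ S) := by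
  refine measureReal_congr ?_
  filter_upwards [hZ.ae_start] with ω h0
  apply propext
  change (ω ∈ S ∧ ∀ k ∈ Finset.Icc 1 n, Z k ω = (j k : ℕ∞)) ↔
    ((∀ k ≤ n, Z k ω = (j k : ℕ∞)) ∧ ω ∈ S)
  rw [and_comm, and_congr_left_iff]
  intro _
  constructor
  · intro h k hk
    rcases Nat.eq_zero_or_pos k with rfl | hk0
    · rw [h0, hj]
    · exact h k (Finset.mem_Icc.2 ⟨hk0, hk⟩)
  · exact fun h k hk => h k (Finset.mem_Icc.1 hk).2

lemma IsGaltonWatson.measureReal_pathEvent (hZ : IsGaltonWatson P p i Z)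
    {j : ℕ → ℕ} (hj : j 0 = i) (n : ℕ) :
    P.real (pathEvent Z n (fun k => j k)) =
      ∏ k ∈ Finset.range n, transProb p 1 (j k) (j (k + 1)) := by
  rw [measureReal_def, pathEvent, hZ.law, hj, if_pos rfl, one_mul, ENNReal.toReal_prod]
  simp only [transProb, nStep_one]

/-- Conditional limits of finite-dimensional laws. Here `y_k^j - f_k(0)^j` is the probability that
the process started at `j` is absorbed after time `k`, at a finite time. -/
theorem qLimit [IsProbabilityMeasure P] (hq0 : 0 < extRoot p) (hγ : 0 < gam p)
    {r X : ℝ} {y δ : ℕ → ℝ} (hq : Tendsto (fun k => iter p k 0) atTop (𝓝 (extRoot p)))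
    (hr : Tendsto (fun k => iter p k 1) atTop (𝓝 r))
    (hrq : extRoot p = 1 ∨ p ⊤ ≠ 0 → r = extRoot p)
    (hy : Tendsto y atTop (𝓝 (extRoot p)))
    (hE : ∀ k j, iter p k 1 ^ j - iter p k 0 ^ j - (r ^ j - extRoot p ^ j) =
      y k ^ j - iter p k 0 ^ j)
    (hlt : ∀ k, iter p k 0 < y k) (hX : X ≠ 0) (hδ : ∀ k, δ k ≠ 0)
    (hyX : Tendsto (fun k => (y k - iter p k 0) / δ k) atTop (𝓝 X))
    (hδγ : ∀ n, Tendsto (fun k => δ (n + k) / δ k) atTop (𝓝 (gam p ^ n))) :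
    QLimit P p := by
  intro i Z hi hZ
  set q := extRoot p with hqdef
  set γ := gam p
  have hpow := tendsto_pow_sub_div hq hy hyX
  constructor
  · intro n h
    have h1 := hZ.measureReal_absorbed hq hr n
    rw [measureReal_def, h, hE] at h1
    have h2 := pow_lt_pow_left₀ (hlt n) (iter_mem_Icc p n (by simp)).1 (by omega : i ≠ 0)
    rw [ENNReal.toReal_zero] at h1
    linarith
  intro n j hj0 hj
  set B := pathEvent Z n (fun k => (j k : ℕ∞)) with hB
  have hjn : (j n : ℝ) ≠ 0 := by have := hj n; positivity
  have hi0 : (i : ℝ) ≠ 0 := by positivity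
  have hPB : P.real {ω | ∀ k ∈ Finset.Icc 1 n, Z k ω = (j k : ℕ∞)} = P.real B := by
    have := hZ.inter_path_ae hj0 n Set.univ
    rwa [Set.univ_inter, Set.inter_univ] at this
  have hAm : MeasurableSet {ω | ∀ k ∈ Finset.Icc 1 n, Z k ω = (j k : ℕ∞)} := by
    simp only [ofPred_forall]
    exact MeasurableSet.iInter fun m => MeasurableSet.iInter fun _ =>
      measurableSet_eq hZ.measurable m _
  -- With the common scale δ_k, the numerator gives j q^{j-1} X and the denominator i q^{i-1} X γ^n,
  -- where γ^n comes from δ_{n+k}/δ_k. The unknown X cancels.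
  have hlim : Tendsto (fun k => P.real B * (y k ^ j n - iter p k 0 ^ j n) /
      (y (n + k) ^ i - iter p (n + k) 0 ^ i)) atTop
      (𝓝 (P.real B * ((j n : ℝ) * q ^ j n / (γ ^ n * (i : ℝ) * q ^ i)))) := by
    have h1 : Tendsto (fun k => (y (n + k) ^ i - iter p (n + k) 0 ^ i) / δ (n + k)) atTop
        (𝓝 (i * q ^ (i - 1) * X)) := by
      have := (hpow i).comp (tendsto_add_atTop_nat n)
      simpa only [Function.comp_def, Nat.add_comm _ n] using this
    have h2 := ((hpow (j n)).const_mul (P.real B)).div (h1.mul (hδγ n)) (by positivity)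
    have hpowq : ∀ m : ℕ, 1 ≤ m → q ^ m = q ^ (m - 1) * q := fun m hm => by
      rw [← pow_succ, Nat.sub_add_cancel hm]
    have hval : P.real B * (j n * q ^ (j n - 1) * X) / (i * q ^ (i - 1) * X * γ ^ n) =
        P.real B * ((j n : ℝ) * q ^ j n / (γ ^ n * (i : ℝ) * q ^ i)) := by
      rw [hpowq _ (hj n), hpowq _ hi]
      field_simp
    rw [hval] at h2
    refine h2.congr fun k => ?_
    have d1 := hδ k
    have d2 := hδ (n + k)
    simp only [Pi.div_apply]
    rw [div_mul_div_cancel₀ d2, mul_div_assoc', div_div_div_cancel_right₀ d1]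
  rw [hPB]
  refine ⟨?_, ?_, fun hcase => ?_⟩
  · rw [prod_qTrans hq0 hj, hB, hZ.measureReal_pathEvent hj0, hj0]
  · refine hlim.congr fun k => ?_
    rw [cond_real_eq_div _ hAm, hZ.inter_path_ae hj0,
      hZ.measureReal_path_absorbed hq hr n k (j n) _ rfl, hZ.measureReal_absorbed hq hr, hE, hE]
  · have hE' : ∀ k j, iter p k 1 ^ j - iter p k 0 ^ j = y k ^ j - iter p k 0 ^ j := by
      intro k j
      rw [← hE, hrq hcase, sub_self, sub_zero]
    refine hlim.congr fun k => ?_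
    rw [cond_real_eq_div _ hAm, hZ.inter_path_ae hj0,
      hZ.measureReal_path_survival n k (j n) _ rfl, hZ.measureReal_survival, hE', hE']

end QChains

/-! ### Non-critical laws with a linearizing function -/

/-- `Q` conjugates the generating function on `D` to multiplication by `γ ∈ (0,1)`, and `G` is a
left inverse of `Q`. -/
structure Linearizes (p : PMF ℕ∞) (q γ : ℝ) (D : Set ℝ) (Q G : ℝ → ℝ) (C : ℝ) : Prop where
  q_mem : q ∈ Icc (0 : ℝ) 1
  q_mem_D : q ∈ D
  γ_mem : γ ∈ Ioo (0 : ℝ) 1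
  Ico_subset : Ico (0 : ℝ) 1 ⊆ D
  inv : Invariant p D
  Icc_subset : ∀ s ∈ D, Icc 0 s ⊆ D
  map : ∀ s ∈ D, Q (pgf p s) = γ * Q s
  Q_q : Q q = 0
  C_ne : C ≠ 0
  hasDeriv : HasDerivWithinAt Q C (Icc 0 1) q
  cont : ContinuousOn Q D
  inverse_deriv : HasDerivAt G C⁻¹ 0
  left_inverse : ∀ s ∈ D, G (Q s) = s
  one_mem : q = 1 ∨ p ⊤ ≠ 0 → (1 : ℝ) ∈ D

/-- A sum of convergent series with nonnegative terms may be summed in the other order. -/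
lemma hasSum_swap {f : ℕ → ℕ → ℝ} (hf : ∀ i j, 0 ≤ f i j) {r : ℕ → ℝ} {R : ℝ}
    (hr : ∀ i, HasSum (f i) (r i)) (hR : HasSum r R) :
    (∀ j, Summable fun i => f i j) ∧ HasSum (fun j => ∑' i, f i j) R := by
  have hs : Summable fun x : ℕ × ℕ => f x.1 x.2 := by
    refine (summable_prod_of_nonneg fun x => hf x.1 x.2).2 ⟨fun i => (hr i).summable, ?_⟩
    simpa only [fun i => (hr i).tsum_eq] using hR.summable
  have hsym : Summable fun x : ℕ × ℕ => f x.2 x.1 := hs.prod_symm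
  refine ⟨fun j => hsym.prod_factor j, ?_⟩
  have h1 : Summable fun j => ∑' i, f i j := hsym.prod
  have h2 : ∑' j, ∑' i, f i j = R := by
    rw [Summable.tsum_comm hs]
    simp only [fun i => (hr i).tsum_eq, hR.tsum_eq]
  rw [← h2]
  exact h1.hasSum

lemma transProb_tail_hasSum {p : PMF ℕ∞} {D : Set ℝ} (h : Invariant p D) (n i : ℕ) {s : ℝ}
    (hs : s ∈ D) : HasSum (fun j => (if j = 0 then 0 else transProb p n i j) * s ^ j)
      (iter p n s ^ i - iter p n 0 ^ i) := by
  rw [← transProb_zero_right]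
  exact hasSum_update_zero.2 (h.hasSum_transProb n i hs)

lemma iter_one_of_top (p : PMF ℕ∞) (htop : p ⊤ = 0) (n : ℕ) : iter p n 1 = 1 := by
  have : pgf p 1 = 1 := by rw [pgf_one, htop]; simp
  exact Function.iterate_fixed this n

namespace Linearizes

variable {p : PMF ℕ∞} {q γ : ℝ} {D : Set ℝ} {Q G : ℝ → ℝ} {C : ℝ}
  (h : Linearizes p q γ D Q G C)
include h

lemma zero_mem : (0 : ℝ) ∈ D := h.Ico_subset (by simp)

/-- If q < 1 the inclusion of [0,1) in D suffices; if q = 1 the end point itself must lie in D,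
which `one_mem` provides. -/
lemma D_nhds : D ∈ 𝓝[Icc 0 1] q := by
  rcases h.q_mem.2.lt_or_eq with hlt | heq
  · filter_upwards [self_mem_nhdsWithin, mem_nhdsWithin_of_mem_nhds (Iio_mem_nhds hlt)]
      with s hs hs1
    exact h.Ico_subset ⟨hs.1, hs1⟩
  · filter_upwards [self_mem_nhdsWithin] with s hs
    exact h.Icc_subset 1 (h.one_mem (Or.inl heq)) hs

lemma G_zero : G 0 = q := by
  rw [← h.Q_q]
  exact h.left_inverse q h.q_mem_D

lemma injOn : InjOn Q D := fun s hs t ht hst => by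
  rw [← h.left_inverse s hs, ← h.left_inverse t ht, hst]

lemma Q_iter (n : ℕ) {s : ℝ} (hs : s ∈ D) : Q (iter p n s) = γ ^ n * Q s := by
  induction n with
  | zero => simp [iter_zero]
  | succ n ih => rw [iter_succ', h.map _ (h.inv.iter_mem n hs), ih, pow_succ]; ring

/-- The closed form of the iterates, from which all non-critical limits are read off. -/
lemma iter_eq (n : ℕ) {s : ℝ} (hs : s ∈ D) : iter p n s = G (γ ^ n * Q s) := by
  rw [← h.Q_iter n hs, h.left_inverse _ (h.inv.iter_mem n hs)]

lemma tendsto_pow_mul (a : ℝ) : Tendsto (fun n => γ ^ n * a) atTop (𝓝 0) := by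
  simpa using (tendsto_pow_atTop_nhds_zero_of_lt_one h.γ_mem.1.le h.γ_mem.2).mul_const a

lemma tendsto_iter {s : ℝ} (hs : s ∈ D) : Tendsto (fun n => iter p n s) atTop (𝓝 q) := by
  have h1 := h.inverse_deriv.continuousAt.tendsto.comp (h.tendsto_pow_mul (Q s))
  rw [h.G_zero] at h1
  exact h1.congr fun n => (h.iter_eq n hs).symm

/-- This is the difference quotient of G at 0 along γ^n Q(s), multiplied by Q(s). Points with Q(s) =
0 are separate, since there the increment is zero. -/
lemma tendsto_iter_sub_div {s : ℝ} (hs : s ∈ D) :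
    Tendsto (fun n => (iter p n s - q) / γ ^ n) atTop (𝓝 (Q s / C)) := by
  rcases eq_or_ne (Q s) 0 with h0 | h0
  · have : ∀ n, iter p n s = q := fun n => by rw [h.iter_eq n hs, h0, mul_zero, h.G_zero]
    simp [this, h0]
  · have h1 := hasDerivAt_iff_tendsto_slope.1 h.inverse_deriv
    have hγ : ∀ n, γ ^ n ≠ 0 := fun n => (pow_pos h.γ_mem.1 n).ne'
    have h2 : Tendsto (fun n => γ ^ n * Q s) atTop (𝓝[≠] 0) :=
      tendsto_nhdsWithin_iff.2
        ⟨h.tendsto_pow_mul (Q s), Eventually.of_forall fun n => mul_ne_zero (hγ n) h0⟩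
    have h3 := (h1.comp h2).const_mul (Q s)
    rw [← div_eq_mul_inv] at h3
    refine h3.congr fun n => ?_
    have := hγ n
    rw [Function.comp_apply, slope_def_field, h.G_zero, ← h.iter_eq n hs, sub_zero]
    field_simp

lemma tendsto_iter_sub_iter_div {s t : ℝ} (hs : s ∈ D) (ht : t ∈ D) :
    Tendsto (fun n => (iter p n s - iter p n t) / γ ^ n) atTop (𝓝 ((Q s - Q t) / C)) := by
  rw [sub_div]
  refine ((h.tendsto_iter_sub_div hs).sub (h.tendsto_iter_sub_div ht)).congr fun n => ?_
  rw [← sub_div, sub_sub_sub_cancel_right]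

lemma pgf_q : pgf p q = q := by
  have := h.iter_eq 1 h.q_mem_D
  rwa [h.Q_q, mul_zero, h.G_zero] at this

/-- At a fixed point x < 1 the functional equation reads Q(x) = γQ(x), so Q(x) = 0 = Q(q) and
injectivity gives x = q. -/
lemma extRoot_eq : extRoot p = q := by
  refine le_antisymm (csInf_le ⟨0, fun x hx => hx.1.1⟩ ⟨h.q_mem, h.pgf_q⟩) ?_
  refine le_csInf ⟨q, h.q_mem, h.pgf_q⟩ fun x hx => ?_
  rcases hx.1.2.lt_or_eq with hlt | heq
  · have hxD : x ∈ D := h.Ico_subset ⟨hx.1.1, hlt⟩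
    have h1 := h.map x hxD
    rw [hx.2] at h1
    have h2 : Q x = Q q := by
      rw [h.Q_q]
      have : (1 - γ) * Q x = 0 := by linarith
      exact (mul_eq_zero.1 this).resolve_left (by linarith [h.γ_mem.2])
    exact (h.injOn hxD h.q_mem_D h2).ge
  · rw [heq]
    exact h.q_mem.2

/-- Near q within [0,1], f is the composition of Q, multiplication by γ and G, with derivative C · γ
· C⁻¹. -/
lemma hasDerivWithinAt_pgf : HasDerivWithinAt (pgf p) γ (Icc 0 1) q := by
  have h1 : HasDerivAt G C⁻¹ (γ * Q q) := by
    rw [h.Q_q, mul_zero]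
    exact h.inverse_deriv
  have h2 := h1.comp_hasDerivWithinAt q (h.hasDeriv.const_mul γ)
  have h3 : C⁻¹ * (γ * C) = γ := by
    have := h.C_ne
    field_simp
  rw [h3] at h2
  have heq : ∀ s ∈ D, pgf p s = G (γ * Q s) := fun s hs => by
    have := h.iter_eq 1 hs
    rwa [pow_one] at this
  refine h2.congr_of_eventuallyEq ?_ (heq q h.q_mem_D)
  filter_upwards [h.D_nhds] with s hs
  exact heq s hs

lemma gam_eq : gam p = γ := by
  rw [gam, h.extRoot_eq]
  exact h.hasDerivWithinAt_pgf.derivWithin (uniqueDiffOn_Icc one_pos q h.q_mem)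

/-- `Q` is determined by its functional equation and its derivative at `q`. -/
theorem solvesQ {D' : Set ℝ} (hD : D' ⊆ D) (hmap : ∀ s ∈ D', pgf p s ∈ D') :
    SolvesQ p D' Q C := by
  refine ⟨fun s hs => ⟨hmap s hs, ?_⟩, ?_, h.C_ne, ?_, fun R hR hRq hRd s hs => ?_⟩
  · rw [h.gam_eq, h.map s (hD hs)]
  · rw [h.extRoot_eq, h.Q_q]
  · rw [h.extRoot_eq]
    exact h.hasDeriv
  · rw [h.extRoot_eq] at hRq hRd
    rw [h.gam_eq] at hR
    have hsD := h.Ico_subset hs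
    have hmem : ∀ n, iter p n s ∈ Icc (0 : ℝ) 1 := fun n => iter_mem_Icc p n ⟨hs.1, hs.2.le⟩
    -- The equation for R is assumed on [0,1) only, so the orbit must not reach 1. If q < 1,
    -- reaching 1 would make it stay there and miss q. If q = 1, injectivity of Q forbids it.
    have hlt : ∀ x ∈ Ico (0 : ℝ) 1, pgf p x < 1 := by
      intro x hx
      refine lt_of_le_of_ne (pgf_mem_Icc p ⟨hx.1, hx.2.le⟩).2 fun h1 => ?_
      rcases h.q_mem.2.lt_or_eq with hq | hq
      · have hmono := pgf_mono p hx.1 hx.2.le le_rfl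
        rw [h1] at hmono
        have hf1 : pgf p 1 = 1 := le_antisymm (pgf_mem_Icc p (by simp)).2 hmono
        have hfx : ∀ n, iter p (n + 1) x = 1 := by
          intro n
          rw [iter_succ, h1]
          exact Function.iterate_fixed hf1 n
        have ht := (h.tendsto_iter (h.Ico_subset hx)).comp (tendsto_add_atTop_nat 1)
        have := tendsto_nhds_unique ht (tendsto_const_nhds.congr fun n => (hfx n).symm)
        linarith
      · have h1D : (1 : ℝ) ∈ D := h.one_mem (Or.inl hq)
        have hfix := h.pgf_q
        rw [hq] at hfix
        have h2 := h.map x (h.Ico_subset hx)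
        rw [h1, ← hq, h.Q_q] at h2
        have h3 : Q x = Q q := by
          rw [h.Q_q]
          exact (mul_eq_zero.1 h2.symm).resolve_left h.γ_mem.1.ne'
        have := h.injOn (h.Ico_subset hx) h.q_mem_D h3
        linarith [hx.2]
    have hIco : ∀ n, iter p n s ∈ Ico (0 : ℝ) 1 := by
      intro n
      induction n with
      | zero => exact hs
      | succ n ih =>
        rw [iter_succ']
        exact ⟨pgf_nonneg p ih.1, hlt _ ih⟩
    have hRn : ∀ n, R (iter p n s) = γ ^ n * R s := by
      intro n
      induction n with
      | zero => simp [iter_zero]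
      | succ n ih => rw [iter_succ', hR _ (hIco n), ih, pow_succ]; ring
    have hγ : ∀ n, γ ^ n ≠ 0 := fun n => (pow_pos h.γ_mem.1 n).ne'
    -- If the orbit hits q, both Q(s) and R(s) vanish; otherwise difference quotients at q may be
    -- formed along it.
    by_cases hex : ∃ n, iter p n s = q
    · obtain ⟨n, hn⟩ := hex
      have e1 := hRn n
      have e2 := h.Q_iter n hsD
      rw [hn, hRq] at e1
      rw [hn, h.Q_q] at e2
      rw [(mul_eq_zero.1 e1.symm).resolve_left (hγ n),
        (mul_eq_zero.1 e2.symm).resolve_left (hγ n), zero_div]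
    · push Not at hex
      have ht : Tendsto (fun n => iter p n s) atTop (𝓝[Icc 0 1 \ {q}] q) :=
        tendsto_nhdsWithin_iff.2 ⟨h.tendsto_iter hsD, Eventually.of_forall fun n =>
          ⟨hmem n, hex n⟩⟩
      -- R(s) = R(f_n(s))/γ^n is the product of the slope of R, which tends to 1, and (f_n(s) -
      -- q)/γ^n, which tends to Q(s)/C.
      have h1 := (hasDerivWithinAt_iff_tendsto_slope.1 hRd).comp ht
      have h2 := h1.mul (h.tendsto_iter_sub_div hsD)
      rw [one_mul] at h2
      refine tendsto_nhds_unique (tendsto_const_nhds.congr fun n => ?_) h2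
      have hne : iter p n s - q ≠ 0 := sub_ne_zero.2 (hex n)
      have := hγ n
      rw [Function.comp_apply, slope_def_field, hRq, hRn, sub_zero]
      field_simp

/-- The coefficients without their constant term, scaled by γ^{-n}, have generating functions
converging to i q^{i-1} times the limit for i = 1. Uniqueness of coefficients carries this factor
over to the limits. -/
lemma exists_coeff : ∃ b : ℕ → ℝ, (∀ j, 0 ≤ b j) ∧ b 0 = 0 ∧
    (∀ s ∈ D, HasSum (fun j => b j * s ^ j) ((Q s - Q 0) / C)) ∧
    ∀ i j, 1 ≤ j → Tendsto (fun n => transProb p n i j / γ ^ n) atTop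
      (𝓝 (i * q ^ (i - 1) * b j)) := by
  have hγ : ∀ n, 0 < γ ^ n := fun n => pow_pos h.γ_mem.1 n
  have key : ∀ i : ℕ, ∃ b : ℕ → ℝ, (∀ j, 0 ≤ b j) ∧
      (∀ j, Tendsto (fun n => (if j = 0 then 0 else transProb p n i j) / γ ^ n) atTop
        (𝓝 (b j))) ∧
      ∀ s ∈ D, HasSum (fun j => b j * s ^ j) (i * q ^ (i - 1) * ((Q s - Q 0) / C)) := by
    intro i
    refine exists_limit_coeff h.Ico_subset (fun s hs => (h.inv s hs).1) h.Icc_subset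
      (a := fun n j => (if j = 0 then 0 else transProb p n i j) / γ ^ n)
      (F := fun n s => (iter p n s ^ i - iter p n 0 ^ i) / γ ^ n)
      (G := fun s => i * q ^ (i - 1) * ((Q s - Q 0) / C)) (fun n j => ?_) (fun n s hs => ?_)
      (fun s hs => ?_) ?_
    · refine div_nonneg ?_ (hγ n).le
      split_ifs
      exacts [le_rfl, transProb_nonneg p n i j]
    · refine ((transProb_tail_hasSum h.inv n i hs).div_const (γ ^ n)).of_eq (fun j => ?_) rfl
      ring
    · exact tendsto_pow_sub_div (h.tendsto_iter h.zero_mem) (h.tendsto_iter hs)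
        (h.tendsto_iter_sub_iter_div hs h.zero_mem) i
    · exact ((h.cont.sub continuousOn_const).div_const C).const_mul _
  obtain ⟨b, hb0, hb, hbs⟩ := key 1
  have hb00 : b 0 = 0 := tendsto_nhds_unique (hb 0) (by simp)
  simp only [Nat.cast_one, Nat.sub_self, pow_zero, one_mul] at hbs
  refine ⟨b, hb0, hb00, hbs, fun i j hj => ?_⟩
  obtain ⟨c, hc0, hc, hcs⟩ := key i
  have hq0 := h.q_mem.1
  have huniq := coeff_unique (b := fun j => i * q ^ (i - 1) * b j) hc0
    (fun j => mul_nonneg (by positivity) (hb0 j))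
    (fun s hs => hcs s (h.Ico_subset ⟨hs.1.le, hs.2⟩))
    (fun s hs => ((hbs s (h.Ico_subset ⟨hs.1.le, hs.2⟩)).mul_left (i * q ^ (i - 1))).of_eq
      (fun j => by ring) rfl) j
  rw [← huniq]
  refine (hc j).congr fun n => ?_
  rw [if_neg (by omega)]

/-- The limits of the transition probabilities, and the stationary law of the `Q`-process. -/
theorem transLimit {D' : Set ℝ} (hD : D' ⊆ D) : TransLimit p D' Q C := by
  obtain ⟨b, hb0, hb00, hbs, hlim⟩ := h.exists_coeff
  set ν : ℕ → ℝ := fun j => if j = 0 then Q 0 / C else b j with hν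
  have hν1 : ∀ j, 1 ≤ j → ν j = b j := fun j hj => if_neg (by omega)
  have hνs : ∀ s ∈ D, HasSum (fun j => ν j * s ^ j) (Q s / C) := by
    intro s hs
    refine hasSum_update_zero.1 ((hbs s hs).of_eq (fun j => ?_) ?_)
    · rcases Nat.eq_zero_or_pos j with rfl | hj
      · simp [hb00]
      · rw [if_neg hj.ne', hν1 j hj]
    · simp only [hν, if_true]
      rw [sub_div]
  have hνn : ∀ j, 1 ≤ j → 0 ≤ ν j := fun j hj => (hν1 j hj).symm ▸ hb0 j
  have hγ : ∀ n, 0 < γ ^ n := fun n => pow_pos h.γ_mem.1 n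
  refine ⟨ν, hνn, fun s hs => hνs s (hD hs), fun i j hi hj => ?_, fun hq0 => ?_⟩
  · rw [h.gam_eq, h.extRoot_eq, hν1 j hj]
    exact hlim i j hj
  have hqt := qTrans_eq hq0
  rw [h.extRoot_eq] at hq0 hqt ⊢
  rw [h.gam_eq] at hqt
  have hgen : ∀ s ∈ Icc (0 : ℝ) 1, HasSum (fun j : ℕ => (j : ℝ) * q ^ (j - 1) * ν j * s ^ j)
      (s * derivWithin Q (Icc 0 1) (s * q) / C) := by
    intro s hs
    have hx : s * q ∈ Icc (0 : ℝ) 1 :=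
      ⟨mul_nonneg hs.1 hq0.le, mul_le_one₀ hs.2 hq0.le h.q_mem.2⟩
    have h1 := hasSum_deriv hνn (F := fun s => Q s / C)
      (fun x hx => hνs x (h.Ico_subset hx)) hx (fun hx1 => ?_)
    · rw [derivWithin_div_const] at h1
      refine (h1.mul_left s).of_eq (fun j => ?_) (by ring)
      rcases j with _ | j
      · simp
      · rw [Nat.add_sub_cancel, mul_pow, pow_succ s]
        ring
    · have hq1 : q = 1 := le_antisymm h.q_mem.2 (by nlinarith [hs.1, hs.2])
      refine ⟨?_, ?_⟩
      · simpa using hνs 1 (h.one_mem (Or.inl hq1))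
      · have := h.hasDeriv
        rw [hq1] at this
        exact this.differentiableWithinAt.div_const C
  refine ⟨fun i j hi => ?_, ?_, fun n j => ?_, hgen⟩
  · rcases Nat.eq_zero_or_pos j with rfl | hj
    · simp [qTrans]
    · have hi0 : (i : ℝ) ≠ 0 := by positivity
      rw [hν1 j hj]
      have h1 := (hlim i j hj).const_mul (j * q ^ j / (i * q ^ i))
      have h2 : (j : ℝ) * q ^ j / (i * q ^ i) * (i * q ^ (i - 1) * b j) =
          j * q ^ (j - 1) * b j := by
        have e1 : q ^ i = q ^ (i - 1) * q := by rw [← pow_succ, Nat.sub_add_cancel hi]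
        have e2 : q ^ j = q ^ (j - 1) * q := by rw [← pow_succ, Nat.sub_add_cancel hj]
        rw [e1, e2]
        field_simp
      rw [h2] at h1
      refine h1.congr fun n => ?_
      have := (hγ n).ne'
      rw [hqt]
      field_simp
  · have h1 := hgen 1 (by simp)
    rw [one_mul, one_mul, h.hasDeriv.derivWithin (uniqueDiffOn_Icc one_pos q h.q_mem),
      div_self h.C_ne] at h1
    exact h1.of_eq (fun j => by simp) rfl
  · rcases Nat.eq_zero_or_pos j with rfl | hj
    · simp [qTrans, hasSum_zero]
    -- The aim is the eigenvector relation ∑_i b_i P_n(i,j) = γ^n b_j for j ≥ 1. Summed in the other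
    -- order, its generating function is (Q(f_n(s)) - Q(f_n(0)))/C, and the functional equation
    -- extracts γ^n.
    have hsw : ∀ s ∈ Ioo (0 : ℝ) 1,
        (∀ j, Summable fun i => b i * (if j = 0 then 0 else transProb p n i j) * s ^ j) ∧
        HasSum (fun j => ∑' i, b i * (if j = 0 then 0 else transProb p n i j) * s ^ j)
          (γ ^ n * ((Q s - Q 0) / C)) := by
      intro s hs
      have hsD := h.Ico_subset ⟨hs.1.le, hs.2⟩
      refine hasSum_swap (fun i j => ?_) (fun i => ?_) (r := fun i =>
        b i * (iter p n s ^ i - iter p n 0 ^ i)) ?_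
      · have := hb0 i
        have := hs.1
        have := transProb_nonneg p n i j
        split_ifs <;> positivity
      · exact ((transProb_tail_hasSum h.inv n i hsD).mul_left (b i)).of_eq (fun j => by ring) rfl
      · refine ((hbs _ (h.inv.iter_mem n hsD)).sub (hbs _ (h.inv.iter_mem n h.zero_mem))).of_eq
          (fun i => by ring) ?_
        rw [h.Q_iter n hsD, h.Q_iter n h.zero_mem]
        ring
    have hsm : Summable fun i => b i * (if j = 0 then 0 else transProb p n i j) := by
      have h1 := ((hsw (1 / 2) (by norm_num)).1 j).div_const ((1 / 2 : ℝ) ^ j)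
      refine h1.congr fun i => ?_
      rw [mul_div_cancel_right₀ _ (by positivity)]
    have hmu := coeff_unique (j := j)
      (a := fun j => ∑' i, b i * (if j = 0 then 0 else transProb p n i j))
      (b := fun j => γ ^ n * b j) (F := fun s => γ ^ n * ((Q s - Q 0) / C))
      (fun j => tsum_nonneg fun i => ?_) (fun j => mul_nonneg (hγ n).le (hb0 j))
      (fun s hs => (hsw s hs).2.of_eq (fun j => ?_) rfl)
      (fun s hs => ((hbs s (h.Ico_subset ⟨hs.1.le, hs.2⟩)).mul_left (γ ^ n)).of_eq
        (fun j => by ring) rfl)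
    · have hs2 := hsm.hasSum
      rw [hmu] at hs2
      refine (hs2.mul_left (j * q ^ (j - 1) / γ ^ n)).of_eq (fun i => ?_) ?_
      · rcases Nat.eq_zero_or_pos i with rfl | hi
        · simp [hb00]
        · have hi0 : (i : ℝ) ≠ 0 := by positivity
          have := (hγ n).ne'
          have e1 : q ^ i = q ^ (i - 1) * q := by rw [← pow_succ, Nat.sub_add_cancel hi]
          have e2 : q ^ j = q ^ (j - 1) * q := by rw [← pow_succ, Nat.sub_add_cancel hj]
          rw [hν1 i hi, if_neg hj.ne', hqt, e1, e2]
          field_simp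
      · have := (hγ n).ne'
        rw [hν1 j hj]
        field_simp
    · have := hb0 i
      have := transProb_nonneg p n i j
      split_ifs <;> positivity
    · rw [tsum_mul_right]

theorem qChain (hq : 0 < extRoot p) : QChain p := by
  refine ThetaBranching.qChain hq ?_ ?_ ?_ ?_
  · rw [h.extRoot_eq]; exact h.q_mem.2
  · rw [h.extRoot_eq]; exact h.pgf_q
  · rw [h.gam_eq]; exact h.γ_mem.1
  · rw [h.gam_eq, h.extRoot_eq]; exact h.hasDerivWithinAt_pgf

lemma Q_zero_ne (hq : 0 < q) : Q 0 ≠ 0 := by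
  intro h0
  have := h.left_inverse 0 h.zero_mem
  rw [h0, h.G_zero] at this
  exact hq.ne' this

lemma iter_zero_lt_q (hq : 0 < q) (n : ℕ) : iter p n 0 < q := by
  refine lt_of_le_of_ne ?_ fun heq => ?_
  · have := iter_mono p n le_rfl h.q_mem.1 h.q_mem.2
    rwa [show iter p n q = q from Function.iterate_fixed h.pgf_q n] at this
  · have h1 := h.Q_iter n h.zero_mem
    rw [heq, h.Q_q] at h1
    exact h.Q_zero_ne hq ((mul_eq_zero.1 h1.symm).resolve_left (pow_pos h.γ_mem.1 n).ne')

lemma Q_one_ne (h1 : (1 : ℝ) ∈ D) : Q 1 - Q 0 ≠ 0 := by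
  intro he
  exact one_ne_zero (h.injOn h1 h.zero_mem (sub_eq_zero.1 he))

lemma iter_zero_lt_iter_one (h1 : (1 : ℝ) ∈ D) (n : ℕ) : iter p n 0 < iter p n 1 := by
  refine lt_of_le_of_ne (iter_mono p n le_rfl zero_le_one le_rfl) fun heq => ?_
  have e0 := h.Q_iter n h.zero_mem
  rw [heq, h.Q_iter n h1] at e0
  exact h.Q_one_ne h1 (sub_eq_zero.2 (mul_left_cancel₀ (pow_pos h.γ_mem.1 n).ne' e0))

/-! ### Conditional limit laws in the non-critical case. -/

variable {Ω : Type*} [MeasurableSpace Ω] (P : Measure Ω)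

/-- A common scheme: given Z_n = j, the conditioning event has probability κ^j, with κ = q for later
extinction and κ = 1 for non-absorption. Numerator and denominator are both compared with γ^n. -/
lemma condLimit {E : (ℕ → Ω → ℕ∞) → ℕ → Set Ω} {g : ℝ → ℝ} {e : ℕ → ℝ} {κ X : ℝ} (hκ : 0 ≤ κ)
    (hκD : ∀ s ∈ Icc (0 : ℝ) 1, s * κ ∈ D) (he : ∀ n, 0 < e n) (hX : X ≠ 0)
    (heX : Tendsto (fun n => e n / γ ^ n) atTop (𝓝 X))
    (hE : ∀ Z, IsGaltonWatson P p 1 Z → ∀ n, P.real (E Z n) = e n)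
    (hEj : ∀ Z, IsGaltonWatson P p 1 Z → ∀ n (j : ℕ), 1 ≤ j →
      P.real (E Z n ∩ {ω | Z n ω = j}) = transProb p n 1 j * κ ^ j)
    (hg : ∀ s ∈ Icc (0 : ℝ) 1, g s = (Q (s * κ) - Q 0) / C / X) : CondLimit P p E g := by
  obtain ⟨b, hb0, hb00, hbs, hlim⟩ := h.exists_coeff
  have hγ : ∀ n, 0 < γ ^ n := fun n => pow_pos h.γ_mem.1 n
  have hX0 : 0 ≤ X := ge_of_tendsto' heX fun n => (div_pos (he n) (hγ n)).le
  refine ⟨fun j => b j * κ ^ j / X, by simp [hb00],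
    fun j => div_nonneg (mul_nonneg (hb0 j) (pow_nonneg hκ j)) hX0, fun s hs => ?_,
    fun Z hZ => ⟨fun n h0 => ?_, fun j hj => ?_⟩⟩
  · refine ((hbs _ (hκD s hs)).div_const X).of_eq (fun j => ?_) (hg s hs)
    rw [mul_pow]
    ring
  · have := hE Z hZ n
    rw [measureReal_def, h0, ENNReal.toReal_zero] at this
    exact (he n).ne this
  · have h1 := (((hlim 1 j hj).mul_const (κ ^ j)).div heX hX)
    simp only [Nat.cast_one, Nat.sub_self, pow_zero, one_mul] at h1
    refine h1.congr fun n => ?_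
    have := (hγ n).ne'
    have := (he n).ne'
    rw [cond_real_eq_div _ (measurableSet_eq hZ.measurable n j), hE Z hZ, hEj Z hZ n j hj]
    simp only [Pi.div_apply]
    field_simp

variable [IsProbabilityMeasure P]

theorem qLimit (hq : 0 < extRoot p) : QLimit P p := by
  have hq' : 0 < q := h.extRoot_eq ▸ hq
  have hγ : ∀ n, γ ^ n ≠ 0 := fun n => (pow_pos h.γ_mem.1 n).ne'
  have hδ : ∀ n, Tendsto (fun k => γ ^ (n + k) / γ ^ k) atTop (𝓝 (gam p ^ n)) := by
    intro n
    rw [h.gam_eq]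
    refine tendsto_const_nhds.congr fun k => ?_
    rw [pow_add, mul_div_cancel_right₀ _ (hγ k)]
  have h0 : Tendsto (fun k => iter p k 0) atTop (𝓝 (extRoot p)) := by
    rw [h.extRoot_eq]; exact h.tendsto_iter h.zero_mem
  have hγ0 : 0 < gam p := by rw [h.gam_eq]; exact h.γ_mem.1
  -- Without explosion f_k(1) = 1, and requiring T < ∞ turns the survival probability into q^j -
  -- f_k(0)^j, so y_k = q and r = 1. With explosion f_k(1) → q, absorption is almost sure and y_k =
  -- f_k(1).
  by_cases htop : p ⊤ = 0
  · refine ThetaBranching.qLimit hq hγ0 (r := 1) (y := fun _ => q) (δ := fun k => γ ^ k)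
      (X := (Q q - Q 0) / C) h0 ?_ ?_ ?_ ?_ (h.iter_zero_lt_q hq') ?_ hγ ?_ hδ
    · exact tendsto_const_nhds.congr fun n => (iter_one_of_top p htop n).symm
    · rintro (h1 | h1)
      exacts [h1.symm, absurd htop h1]
    · rw [h.extRoot_eq]; exact tendsto_const_nhds
    · intro k j
      rw [iter_one_of_top p htop, h.extRoot_eq, one_pow]
      ring
    · rw [h.Q_q, zero_sub]
      exact div_ne_zero (neg_ne_zero.2 (h.Q_zero_ne hq')) h.C_ne
    · refine (h.tendsto_iter_sub_iter_div h.q_mem_D h.zero_mem).congr fun n => ?_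
      rw [show iter p n q = q from Function.iterate_fixed h.pgf_q n]
  · have h1D := h.one_mem (Or.inr htop)
    have h1 : Tendsto (fun k => iter p k 1) atTop (𝓝 (extRoot p)) := by
      rw [h.extRoot_eq]; exact h.tendsto_iter h1D
    exact ThetaBranching.qLimit hq hγ0 (δ := fun k => γ ^ k) h0 h1 (fun _ => rfl) h1
      (fun k j => by ring) (h.iter_zero_lt_iter_one h1D)
      (div_ne_zero (h.Q_one_ne h1D) h.C_ne) hγ
      (h.tendsto_iter_sub_iter_div h1D h.zero_mem) hδ

/-- The limits of the process conditioned on non-extinction or non-absorption. -/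
theorem yaglomLimits : YaglomLimits P p Q := by
  have hC := h.C_ne
  have h0 := h.tendsto_iter h.zero_mem
  refine ⟨fun hq => ?_, fun hc => ?_, fun ⟨hq, htop⟩ => ?_⟩
  · rw [h.extRoot_eq] at hq ⊢
    have hQ0 := h.Q_zero_ne hq
    refine h.condLimit P (e := fun n => q - iter p n 0) (κ := q) (X := (Q q - Q 0) / C) hq.le
      (fun s hs => ?_) (fun n => sub_pos.2 (h.iter_zero_lt_q hq n)) ?_ ?_ ?_ ?_ ?_
    · exact h.Icc_subset q h.q_mem_D ⟨mul_nonneg hs.1 hq.le, mul_le_of_le_one_left hq.le hs.2⟩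
    · rw [h.Q_q, zero_sub]
      exact div_ne_zero (neg_ne_zero.2 hQ0) hC
    · refine (h.tendsto_iter_sub_iter_div h.q_mem_D h.zero_mem).congr fun n => ?_
      rw [show iter p n q = q from Function.iterate_fixed h.pgf_q n]
    · intro Z hZ n
      simpa using hZ.measureReal_extinct h0 n
    · exact fun Z hZ n j hj => hZ.measureReal_extinct_inter h0 n hj
    · intro s _
      rw [h.Q_q]
      field_simp
      ring
  · rw [h.extRoot_eq] at hc
    have h1 := h.one_mem hc
    have hne := h.Q_one_ne h1
    refine h.condLimit P (e := fun n => iter p n 1 - iter p n 0) (κ := 1)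
      (X := (Q 1 - Q 0) / C) zero_le_one (fun s hs => ?_)
      (fun n => sub_pos.2 (h.iter_zero_lt_iter_one h1 n)) (div_ne_zero hne hC)
      (h.tendsto_iter_sub_iter_div h1 h.zero_mem) ?_ ?_ ?_
    · rw [mul_one]
      exact h.Icc_subset 1 h1 hs
    · intro Z hZ n
      simpa using hZ.measureReal_survival n
    · intro Z hZ n j hj
      rw [one_pow, mul_one]
      exact hZ.measureReal_survival_inter n hj
    · intro s _
      rw [mul_one]
      field_simp
  -- Here P(T > n) tends to 1 - q > 0, whereas P_n(1,j) is of order γ^n.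
  · rw [h.extRoot_eq] at hq
    have hlt : ∀ n, iter p n 0 < 1 := fun n => by
      have := iter_mono p n le_rfl h.q_mem.1 h.q_mem.2
      rw [show iter p n q = q from Function.iterate_fixed h.pgf_q n] at this
      linarith
    refine ⟨fun _ => 0, rfl, fun _ => le_rfl, fun s _ => by simp [hasSum_zero],
      fun Z hZ => ?_⟩
    have hE : ∀ n : ℕ, P.real {ω | (n : ℕ∞) < absorptionTime Z ω} = 1 - iter p n 0 := fun n => by
      simpa [iter_one_of_top p htop] using hZ.measureReal_survival n
    refine ⟨fun n hn => ?_, fun j hj => ?_⟩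
    · have := hE n
      rw [measureReal_def, hn, ENNReal.toReal_zero] at this
      linarith [hlt n]
    · obtain ⟨b, -, -, -, hlim⟩ := h.exists_coeff
      have h1 := (hlim 1 j hj).mul (h.tendsto_pow_mul 1)
      rw [mul_zero] at h1
      have h2 : Tendsto (fun n => transProb p n 1 j / (1 - iter p n 0)) atTop (𝓝 0) := by
        have h3 : Tendsto (fun n => transProb p n 1 j / (1 - iter p n 0)) atTop
            (𝓝 (0 / (1 - q))) := ?_
        · rwa [zero_div] at h3
        refine Tendsto.div (h1.congr fun n => ?_) (h0.const_sub 1) (by linarith)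
        have := (pow_pos h.γ_mem.1 n).ne'
        field_simp
      refine h2.congr fun n => ?_
      rw [cond_real_eq_div _ (measurableSet_eq hZ.measurable n j), hE,
        hZ.measureReal_survival_inter n hj]

theorem nonCriticalFacts {D' : Set ℝ} (hD : D' ⊆ D) (hmap : ∀ s ∈ D', pgf p s ∈ D') :
    NonCriticalFacts P p q γ D' Q C :=
  ⟨h.extRoot_eq, h.gam_eq, h.solvesQ hD hmap, h.transLimit hD, h.yaglomLimits P⟩

end Linearizes

/-! ### The families of laws -/

variable {p : PMF ℕ∞}

/-- Since f(1) = 1 - p_∞, a lower bound for f tending to 1 excludes explosion. -/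
lemma top_eq_zero_of_tendsto {B : ℝ → ℝ} (hB : Tendsto B (𝓝[<] 1) (𝓝 1))
    (hle : ∀ s ∈ Ico (0 : ℝ) 1, B s ≤ pgf p s) : p ⊤ = 0 := by
  have h1 : 1 ≤ pgf p 1 := by
    refine le_of_tendsto hB ?_
    filter_upwards [Ico_mem_nhdsLT (zero_lt_one' ℝ)] with s hs
    exact (hle s hs).trans (pgf_mono p hs.1 hs.2.le le_rfl)
  rw [pgf_one] at h1
  have h2 : (p ⊤).toReal = 0 := le_antisymm (by linarith) ENNReal.toReal_nonneg
  exact ((ENNReal.toReal_eq_zero_iff _).1 h2).resolve_right (p.apply_ne_top _)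

lemma rpow_rpow_cancel {x θ : ℝ} (hx : 0 ≤ x) (hθ : θ ≠ 0) : (x ^ (-θ)) ^ (-1 / θ) = x := by
  rw [← Real.rpow_mul hx, show -θ * (-1 / θ) = 1 by field_simp, Real.rpow_one]

lemma rpow_rpow_cancel' {x θ : ℝ} (hx : 0 ≤ x) (hθ : θ ≠ 0) : (x ^ (-1 / θ)) ^ (-θ) = x := by
  rw [← Real.rpow_mul hx, show -1 / θ * -θ = 1 by field_simp, Real.rpow_one]

/-- The families with `A - f` given by a power, on any set where the formula for `f` holds. -/
lemma linearizes_power {θ A q a : ℝ} (hθ : θ ≠ 0) (ha : a ∈ Ioo (0 : ℝ) 1)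
    (hq : q ∈ Icc (0 : ℝ) 1) (hqA : q < A) {D : Set ℝ} (hqD : q ∈ D)
    (hD1 : Ico (0 : ℝ) 1 ⊆ D) (hD0 : ∀ s ∈ D, 0 ≤ s ∧ s ≤ A) (hDc : ∀ s ∈ D, Icc 0 s ⊆ D)
    (hDA : Ico 0 A ⊆ D) (hDθ : ∀ s ∈ D, s ≠ A ∨ θ < 0)
    (hgen : ∀ s ∈ D, HasSum (fun k : ℕ => offProb p k * s ^ k)
      (A - (a * (A - s) ^ (-θ) + (1 - a) * (A - q) ^ (-θ)) ^ (-1 / θ)))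
    (hone : q = 1 ∨ p ⊤ ≠ 0 → (1 : ℝ) ∈ D) :
    Linearizes p q a D (fun s => (A - s) ^ (-θ) - (A - q) ^ (-θ))
      (fun y => A - (y + (A - q) ^ (-θ)) ^ (-1 / θ)) (θ * (A - q) ^ (-θ - 1)) := by
  have hu : 0 < A - q := by linarith
  set K := (A - q) ^ (-θ) with hK
  have hK0 : 0 < K := Real.rpow_pos_of_pos hu _
  have hpgf : ∀ s ∈ D, pgf p s = A - (a * (A - s) ^ (-θ) + (1 - a) * K) ^ (-1 / θ) :=
    fun s hs => (hgen s hs).tsum_eq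
  have hbase : ∀ s ∈ D, 0 < a * (A - s) ^ (-θ) + (1 - a) * K := by
    intro s hs
    have h1 : 0 ≤ (A - s) ^ (-θ) := Real.rpow_nonneg (by linarith [(hD0 s hs).2]) _
    have h2 : 0 < 1 - a := by linarith [ha.2]
    have := ha.1
    positivity
  refine ⟨hq, hqD, ha, hD1, fun s hs => ⟨(hD0 s hs).1, (hgen s hs).summable, ?_⟩, hDc,
    fun s hs => ?_, by simp [hK], ?_, ?_, ?_, ?_, fun s hs => ?_, hone⟩
  · refine hDA ⟨pgf_nonneg p (hD0 s hs).1, ?_⟩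
    rw [hpgf s hs]
    linarith [Real.rpow_pos_of_pos (hbase s hs) (-1 / θ)]
  · rw [hpgf s hs, sub_sub_cancel, rpow_rpow_cancel' (hbase s hs).le hθ]
    ring
  · exact mul_ne_zero hθ (Real.rpow_pos_of_pos hu _).ne'
  · have h1 : HasDerivAt (fun s => A - s) (-1) q := by
      simpa using (hasDerivAt_id q).const_sub A
    have h2 := (h1.rpow_const (p := -θ) (Or.inl hu.ne')).sub_const K
    refine (h2.congr_deriv ?_).hasDerivWithinAt
    ring
  · refine ContinuousOn.sub (ContinuousOn.rpow_const (by fun_prop) fun s hs => ?_)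
      continuousOn_const
    -- The power is continuous away from base 0, and at s = A only because the exponent -θ is then
    -- positive.
    rcases hDθ s hs with h | h
    · exact Or.inl (sub_ne_zero.2 h.symm)
    · exact Or.inr (by linarith)
  · have h1 : HasDerivAt (fun y => y + K) 1 0 := (hasDerivAt_id (0 : ℝ)).add_const K
    have h2 := (h1.rpow_const (p := -1 / θ) (Or.inl (by simpa using hK0.ne'))).const_sub A
    refine h2.congr_deriv ?_
    rw [zero_add, hK, ← Real.rpow_mul hu.le, mul_inv, ← Real.rpow_neg hu.le,
      show -θ * (-1 / θ - 1) = -(-θ - 1) by field_simp; ring]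
    field_simp
  · rw [sub_add_cancel, rpow_rpow_cancel (by linarith [(hD0 s hs).2]) hθ]
    ring

lemma Admissible.q_mem {A q a : ℝ} (h : Admissible A q a) : q ∈ Icc (0 : ℝ) 1 := by
  rcases h.2 with h | h
  · exact ⟨h.2.1, h.2.2.le⟩
  · exact h.2

lemma Admissible.q_lt {A q a : ℝ} (h : Admissible A q a) : q < A := by
  rcases h.2 with h | h
  · rw [h.1]; exact h.2.2
  · exact h.2.2.trans_lt h.1

lemma Admissible.one_le {A q a : ℝ} (h : Admissible A q a) : 1 ≤ A := by
  rcases h.2 with h | h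
  · exact h.1.ge
  · exact h.1.le

lemma IsPower.theta_ne {θ A q a : ℝ} (h : IsPower p θ A q a) : θ ≠ 0 := by
  rcases h.theta_mem with h | h
  · exact h.2.ne
  · exact h.1.ne'

lemma Icc_subset_Ico_of_mem {A : ℝ} : ∀ s ∈ Ico (0 : ℝ) A, Icc 0 s ⊆ Ico 0 A :=
  fun _ hs _ ht => ⟨ht.1, ht.2.trans_lt hs.2⟩

/-- A power of `1 - s` times a constant bounds `1 - f` when `θ > 0`. -/
lemma rpow_add_le {a c θ u : ℝ} (ha : 0 < a) (hc : 0 ≤ c) (hθ : 0 < θ) (hu : 0 < u) :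
    (a * u ^ (-θ) + c) ^ (-1 / θ) ≤ a ^ (-1 / θ) * u := by
  have hw : 0 < u ^ (-θ) := Real.rpow_pos_of_pos hu _
  calc (a * u ^ (-θ) + c) ^ (-1 / θ) ≤ (a * u ^ (-θ)) ^ (-1 / θ) :=
        Real.rpow_le_rpow_of_nonpos (by positivity) (by linarith)
          (div_nonpos_of_nonpos_of_nonneg (by norm_num) hθ.le)
    _ = a ^ (-1 / θ) * u := by
        rw [Real.mul_rpow ha.le hw.le, rpow_rpow_cancel hu.le hθ.ne']

lemma top_eq_zero_of_gen {a c θ : ℝ} (ha : 0 < a) (hc : 0 ≤ c) (hθ : 0 < θ)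
    (hgen : ∀ s ∈ Ico (0 : ℝ) 1, HasSum (fun k : ℕ => offProb p k * s ^ k)
      (1 - (a * (1 - s) ^ (-θ) + c) ^ (-1 / θ))) : p ⊤ = 0 := by
  refine top_eq_zero_of_tendsto (B := fun s => 1 - a ^ (-1 / θ) * (1 - s)) ?_ fun s hs => ?_
  · have h1 : Continuous fun s : ℝ => 1 - a ^ (-1 / θ) * (1 - s) := by fun_prop
    have h2 := (h1.tendsto 1).mono_left (nhdsWithin_le_nhds (s := Iio 1))
    simpa using h2
  · rw [pgf, (hgen s hs).tsum_eq]
    linarith [rpow_add_le ha hc hθ (sub_pos.2 hs.2)]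

/-- For A = 1 and θ < 0 explosion occurs, so 1 must belong to the domain, which is [0,1]. Otherwise
[0,A) serves: it contains 1 if A > 1, and if A = 1 and θ > 0 then q < 1 and p_∞ = 0, so nothing is
required at 1. -/
theorem IsPower.linearizes {θ A q a : ℝ} (h : IsPower p θ A q a) :
    ∃ D, Ico 0 A ⊆ D ∧ Linearizes p q a D (fun s => (A - s) ^ (-θ) - (A - q) ^ (-θ))
      (fun y => A - (y + (A - q) ^ (-θ)) ^ (-1 / θ)) (θ * (A - q) ^ (-θ - 1)) := by
  have hq := h.adm.q_mem
  have hqA := h.adm.q_lt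
  have ha := h.adm.1
  by_cases hcase : A = 1 ∧ θ < 0
  · obtain ⟨rfl, hθ⟩ := hcase
    refine ⟨Icc 0 1, Ico_subset_Icc_self, linearizes_power h.theta_ne ha hq hqA hq
      Ico_subset_Icc_self (fun s hs => hs) (fun s hs => Icc_subset_Icc_right hs.2)
      Ico_subset_Icc_self (fun s _ => Or.inr hθ) (fun s hs => ?_) (fun _ => by simp)⟩
    rcases hs.2.lt_or_eq with hlt | rfl
    · exact h.gen s ⟨hs.1, hlt⟩
    -- The formula for f is given only for s < 1; Abel's theorem extends it to s = 1.
    · refine hasSum_of_tendsto_left (offProb_nonneg p) one_pos h.gen ?_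
      have hK : 0 < (1 - q) ^ (-θ) := Real.rpow_pos_of_pos (by linarith) _
      have h1 : Continuous fun s : ℝ =>
          1 - (a * (1 - s) ^ (-θ) + (1 - a) * (1 - q) ^ (-θ)) ^ (-1 / θ) := by
        have h2 : Continuous fun s : ℝ => (1 - s) ^ (-θ) :=
          Continuous.rpow_const (by fun_prop) fun _ => Or.inr (by linarith)
        refine continuous_const.sub (Continuous.rpow_const (by fun_prop) fun _ => Or.inr ?_)
        exact div_nonneg_of_nonpos (by norm_num) hθ.le
      exact (h1.tendsto 1).mono_left nhdsWithin_le_nhds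
  · refine ⟨Ico 0 A, subset_rfl, linearizes_power h.theta_ne ha hq hqA ⟨hq.1, hqA⟩
      (Ico_subset_Ico_right h.adm.one_le) (fun s hs => ⟨hs.1, hs.2.le⟩) Icc_subset_Ico_of_mem
      subset_rfl (fun s hs => Or.inl hs.2.ne) h.gen fun hc => ⟨zero_le_one, ?_⟩⟩
    refine lt_of_le_of_ne h.adm.one_le fun hA => ?_
    subst hA
    rcases hc with rfl | htop
    · exact lt_irrefl _ hqA
    · refine htop (top_eq_zero_of_gen ha.1 ?_ ?_ h.gen)
      · exact mul_nonneg (by linarith [ha.2]) (Real.rpow_nonneg (by linarith) _)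
      · exact lt_of_le_of_ne (not_lt.1 fun h' => hcase ⟨rfl, h'⟩) h.theta_ne.symm

/-- Taking logarithms, f multiplies log((A-s)/(A-q)) by a. If A = 1 then q < 1 and f(s) → 1 as s →
1, so neither condition demanding 1 in the domain can hold. -/
theorem IsLog.linearizes {A q a : ℝ} (h : IsLog p A q a) :
    Linearizes p q a (Ico 0 A) (fun s => Real.log ((A - s) / (A - q)))
      (fun y => A - (A - q) * Real.exp y) (-1 / (A - q)) := by
  have hq := h.adm.q_mem
  have hqA := h.adm.q_lt
  have ha := h.adm.1
  have hu : 0 < A - q := by linarith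
  have hpgf : ∀ s ∈ Ico 0 A, A - pgf p s = (A - q) ^ (1 - a) * (A - s) ^ a := fun s hs => by
    rw [pgf, (h.gen s hs).tsum_eq, sub_sub_cancel]
  have hpos : ∀ s ∈ Ico 0 A, 0 < A - s := fun s hs => by linarith [hs.2]
  refine ⟨hq, ⟨hq.1, hqA⟩, ha, Ico_subset_Ico_right h.adm.one_le,
    fun s hs => ⟨hs.1, (h.gen s hs).summable, pgf_nonneg p hs.1, ?_⟩, Icc_subset_Ico_of_mem,
    fun s hs => ?_, ?_, ?_, ?_, ?_, ?_, fun s hs => ?_, fun hc => ⟨zero_le_one, ?_⟩⟩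
  · have h1 := hpgf s hs
    have h2 : 0 < (A - q) ^ (1 - a) * (A - s) ^ a :=
      mul_pos (Real.rpow_pos_of_pos hu _) (Real.rpow_pos_of_pos (hpos s hs) _)
    linarith
  · rw [hpgf s hs, ← Real.log_rpow (div_pos (hpos s hs) hu), Real.div_rpow (hpos s hs).le hu.le,
      Real.rpow_sub hu, Real.rpow_one]
    congr 1
    field_simp
  · simp [hu.ne']
  · exact div_ne_zero (by norm_num) hu.ne'
  · have h1 : HasDerivAt (fun s => A - s) (-1) q := by
      simpa using (hasDerivAt_id q).const_sub A
    have h2 := (h1.div_const (A - q)).log (div_ne_zero hu.ne' hu.ne')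
    refine (h2.congr_deriv ?_).hasDerivWithinAt
    field_simp
  · refine ContinuousOn.log (by fun_prop) fun s hs => ?_
    exact (div_pos (hpos s hs) hu).ne'
  · have h2 := ((Real.hasDerivAt_exp 0).const_mul (A - q)).const_sub A
    refine h2.congr_deriv ?_
    rw [Real.exp_zero]
    field_simp
  · rw [Real.exp_log (div_pos (hpos s hs) hu)]
    field_simp
    ring
  · refine lt_of_le_of_ne h.adm.one_le fun hA => ?_
    subst hA
    rcases hc with rfl | htop
    · exact lt_irrefl _ hqA
    · refine htop (top_eq_zero_of_tendsto
        (B := fun s => 1 - (1 - q) ^ (1 - a) * (1 - s) ^ a) ?_ fun s hs => ?_)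
      · have h2 : Continuous fun s : ℝ => (1 - s) ^ a :=
          Continuous.rpow_const (by fun_prop) fun _ => Or.inr ha.1.le
        have h1 : Continuous fun s : ℝ => 1 - (1 - q) ^ (1 - a) * (1 - s) ^ a := by fun_prop
        have h3 := (h1.tendsto 1).mono_left (nhdsWithin_le_nhds (s := Iio 1))
        simpa [Real.zero_rpow ha.1.ne'] using h3
      · rw [pgf, (h.gen s hs).tsum_eq]

theorem IsLinear.linearizes {q a : ℝ} (h : IsLinear p q a) :
    Linearizes p q a (Ici 0) (fun s => q - s) (fun y => q - y) (-1) := by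
  have hpgf : ∀ s ∈ Ici (0 : ℝ), pgf p s = a * s + (1 - a) * q := fun s hs =>
    (h.gen s hs).tsum_eq
  have hd : ∀ x : ℝ, HasDerivAt (fun s => q - s) (-1) x := fun x => by
    simpa using (hasDerivAt_id x).const_sub q
  refine ⟨h.q_mem, h.q_mem.1, h.a_mem, fun s hs => hs.1,
    fun s hs => ⟨hs, (h.gen s hs).summable, pgf_nonneg p hs⟩, fun s _ t ht => ht.1,
    fun s hs => ?_, sub_self q, by norm_num, (hd q).hasDerivWithinAt, by fun_prop, ?_,
    fun s _ => sub_sub_cancel q s, fun _ => zero_le_one' ℝ⟩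
  · rw [hpgf s hs]
    ring
  · have h1 : (-1 : ℝ)⁻¹ = -1 := by norm_num
    rw [h1]
    exact hd 0

/-! ### The family with `A = q = 1` -/

/-- The difference quotient at 0 is h itself, so continuity of h is enough. This matters because u^θ
need not be differentiable at 0. -/
lemma hasDerivAt_mul_of_continuousAt {h : ℝ → ℝ} (hc : ContinuousAt h 0) :
    HasDerivAt (fun u => u * h u) (h 0) 0 := by
  rw [hasDerivAt_iff_tendsto_slope]
  refine (hc.tendsto.mono_left nhdsWithin_le_nhds).congr' ?_
  filter_upwards [self_mem_nhdsWithin] with u hu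
  have hu' : u ≠ 0 := hu
  rw [slope_def_field]
  field_simp
  ring

lemma continuousAt_rpow_aux {a c θ : ℝ} (ha : 0 < a) (hθ : 0 < θ) :
    ContinuousAt (fun u : ℝ => (a + c * u ^ θ) ^ (-1 / θ)) 0 := by
  have h1 : ContinuousAt (fun u : ℝ => u ^ θ) 0 :=
    Real.continuousAt_rpow_const _ _ (Or.inr hθ.le)
  refine ContinuousAt.rpow_const (by fun_prop) (Or.inl ?_)
  rw [Real.zero_rpow hθ.ne', mul_zero, add_zero]
  exact ha.ne'

/-- `s ↦ (1-s) (a + c (1-s)^θ)^{-1/θ}` at `1`. -/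
lemma hasDerivAt_rpow_aux {a c θ : ℝ} (ha : 0 < a) (hθ : 0 < θ) :
    HasDerivAt (fun s : ℝ => (1 - s) * (a + c * (1 - s) ^ θ) ^ (-1 / θ)) (-(a ^ (-1 / θ))) 1 := by
  have h1 := hasDerivAt_mul_of_continuousAt (continuousAt_rpow_aux (c := c) ha hθ)
  have h2 : HasDerivAt (fun s : ℝ => 1 - s) (-1) 1 := by
    simpa using (hasDerivAt_id (1 : ℝ)).const_sub 1
  rw [show (0 : ℝ) = 1 - 1 by ring] at h1
  have h3 := h1.comp (1 : ℝ) h2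
  rw [sub_self, Real.zero_rpow hθ.ne', mul_zero, add_zero, mul_neg_one] at h3
  exact h3

/-- Extracting the factor u removes the singularity of u^{-θ} at 0 and gives expressions that remain
meaningful up to s = 1. -/
lemma rpow_factor {a c θ u : ℝ} (ha : 0 < a) (hc : 0 ≤ c) (hθ : 0 < θ) (hu : 0 < u) :
    (a * u ^ (-θ) + c) ^ (-1 / θ) = u * (a + c * u ^ θ) ^ (-1 / θ) := by
  have hw : 0 < u ^ (-θ) := Real.rpow_pos_of_pos hu _
  have hv : 0 < u ^ θ := Real.rpow_pos_of_pos hu _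
  have h1 : a * u ^ (-θ) + c = u ^ (-θ) * (a + c * u ^ θ) := by
    rw [Real.rpow_neg hu.le]
    field_simp
  rw [h1, Real.mul_rpow hw.le (by positivity), rpow_rpow_cancel hu.le hθ.ne']

section Upper

variable {θ a c : ℝ} (h : IsUpper p θ a c)
include h

lemma IsUpper.a_pos : 0 < a := by linarith [h.one_le_a]

lemma IsUpper.top : p ⊤ = 0 :=
  top_eq_zero_of_gen h.a_pos h.c_pos.le h.theta_mem.1 h.gen

lemma IsUpper.pgf_one : pgf p 1 = 1 := iter_one_of_top p h.top 1

lemma IsUpper.one_sub_pgf {s : ℝ} (hs : s ∈ Ico (0 : ℝ) 1) :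
    1 - pgf p s = (a * (1 - s) ^ (-θ) + c) ^ (-1 / θ) := by
  rw [pgf, (h.gen s hs).tsum_eq, sub_sub_cancel]

lemma IsUpper.one_sub_pgf' {s : ℝ} (hs : s ∈ Icc (0 : ℝ) 1) :
    1 - pgf p s = (1 - s) * (a + c * (1 - s) ^ θ) ^ (-1 / θ) := by
  rcases hs.2.lt_or_eq with hlt | rfl
  · rw [h.one_sub_pgf ⟨hs.1, hlt⟩,
      rpow_factor h.a_pos h.c_pos.le h.theta_mem.1 (sub_pos.2 hlt)]
  · rw [h.pgf_one]
    ring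

lemma IsUpper.base_pos {s : ℝ} (hs : s ∈ Ico (0 : ℝ) 1) : 0 < a * (1 - s) ^ (-θ) + c := by
  have h1 : 0 < (1 - s) ^ (-θ) := Real.rpow_pos_of_pos (sub_pos.2 hs.2) _
  have := h.a_pos
  have := h.c_pos
  positivity

lemma IsUpper.pgf_lt_one {s : ℝ} (hs : s ∈ Ico (0 : ℝ) 1) : pgf p s < 1 := by
  have := h.one_sub_pgf hs
  linarith [Real.rpow_pos_of_pos (h.base_pos hs) (-1 / θ)]

lemma IsUpper.one_sub_pgf_rpow {s : ℝ} (hs : s ∈ Ico (0 : ℝ) 1) :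
    (1 - pgf p s) ^ (-θ) = a * (1 - s) ^ (-θ) + c := by
  rw [h.one_sub_pgf hs, rpow_rpow_cancel' (h.base_pos hs).le h.theta_mem.1.ne']

lemma IsUpper.hasDerivWithinAt : HasDerivWithinAt (pgf p) (a ^ (-1 / θ)) (Icc 0 1) 1 := by
  have h1 := (hasDerivAt_rpow_aux (c := c) h.a_pos h.theta_mem.1).const_sub 1
  rw [neg_neg] at h1
  have heq : ∀ s ∈ Icc (0 : ℝ) 1, pgf p s =
      1 - (1 - s) * (a + c * (1 - s) ^ θ) ^ (-1 / θ) := fun s hs => by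
    rw [← h.one_sub_pgf' hs, sub_sub_cancel]
  exact h1.hasDerivWithinAt.congr heq (heq 1 (by simp))

end Upper

/-- In the coordinate x = (1-s)^{-θ} the map is x ↦ ax + (a-1)d, with fixed point -d. Hence x + d is
multiplied by a and its power -1/θ by γ. The left inverse 1 - (y^{-θ} - d)^{-1/θ} is written with
the factor y extracted, so that it is differentiable at y = 0. -/
theorem IsUpper.linearizes {θ a d : ℝ} (h : IsUpper p θ a ((a - 1) * d)) (ha : 1 < a) :
    Linearizes p 1 (a ^ (-1 / θ)) (Icc 0 1)
      (fun s => if s = 1 then 0 else ((1 - s) ^ (-θ) + d) ^ (-1 / θ))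
      (fun y => 1 - y * (1 + -d * y ^ θ) ^ (-1 / θ)) (-1) := by
  have hθ := h.theta_mem.1
  have hd : 0 < d := pos_of_mul_pos_right h.c_pos (by linarith)
  have ha0 := h.a_pos
  have hw : ∀ s ∈ Ico (0 : ℝ) 1, 0 < (1 - s) ^ (-θ) := fun s hs =>
    Real.rpow_pos_of_pos (sub_pos.2 hs.2) _
  have hQ : ∀ s ∈ Icc (0 : ℝ) 1, (if s = 1 then 0 else ((1 - s) ^ (-θ) + d) ^ (-1 / θ)) =
      (1 - s) * (1 + d * (1 - s) ^ θ) ^ (-1 / θ) := by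
    intro s hs
    rcases hs.2.lt_or_eq with hlt | rfl
    · have := rpow_factor one_pos hd.le hθ (sub_pos.2 hlt)
      rw [one_mul] at this
      rw [if_neg hlt.ne, this]
    · simp
  refine ⟨by simp, by simp, ⟨Real.rpow_pos_of_pos ha0 _, ?_⟩, Ico_subset_Icc_self,
    invariant_Icc p, fun s hs => Icc_subset_Icc_right hs.2, fun s hs => ?_, by simp,
    by norm_num, ?_, ?_, ?_, fun s hs => ?_, fun _ => by simp⟩
  · exact Real.rpow_lt_one_of_one_lt_of_neg ha (div_neg_of_neg_of_pos (by norm_num) hθ)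
  · rcases hs.2.lt_or_eq with hlt | rfl
    · have hs' : s ∈ Ico (0 : ℝ) 1 := ⟨hs.1, hlt⟩
      have hws := hw s hs'
      rw [if_neg (h.pgf_lt_one hs').ne, if_neg hlt.ne, h.one_sub_pgf_rpow hs',
        ← Real.mul_rpow ha0.le (by positivity)]
      congr 1
      ring
    · simp [h.pgf_one]
  · have h1 := hasDerivAt_rpow_aux (c := d) one_pos hθ
    rw [Real.one_rpow] at h1
    exact h1.hasDerivWithinAt.congr hQ (hQ 1 (by simp))
  · refine ContinuousOn.congr ?_ hQ
    have h2 : Continuous fun s : ℝ => (1 - s) ^ θ :=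
      Continuous.rpow_const (by fun_prop) fun _ => Or.inr hθ.le
    have h3 : Continuous fun s : ℝ => 1 + d * (1 - s) ^ θ := by fun_prop
    refine ContinuousOn.mul (by fun_prop) (h3.continuousOn.rpow_const fun s hs => ?_)
    have : 0 ≤ (1 - s) ^ θ := Real.rpow_nonneg (sub_nonneg.2 hs.2) _
    exact Or.inl (by positivity)
  · have h1 := (hasDerivAt_mul_of_continuousAt
      (continuousAt_rpow_aux (c := -d) one_pos hθ)).const_sub 1
    rw [Real.zero_rpow hθ.ne', mul_zero, add_zero, Real.one_rpow] at h1
    have h2 : (-1 : ℝ)⁻¹ = -1 := by norm_num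
    rw [h2]
    exact h1
  · rcases hs.2.lt_or_eq with hlt | rfl
    · have hws := hw s ⟨hs.1, hlt⟩
      have hpos : 0 < (1 - s) ^ (-θ) + d := by positivity
      rw [if_neg hlt.ne, ← Real.rpow_mul hpos.le, show -1 / θ * θ = -1 by field_simp,
        Real.rpow_neg_one, show 1 + -d * ((1 - s) ^ (-θ) + d)⁻¹ =
          (1 - s) ^ (-θ) / ((1 - s) ^ (-θ) + d) by field_simp; ring,
        ← Real.mul_rpow hpos.le (by positivity), mul_div_cancel₀ _ hpos.ne',
        rpow_rpow_cancel (sub_nonneg.2 hs.2) hθ.ne', sub_sub_cancel]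
    · simp

/-! ### The critical family -/

section Critical

variable {p : PMF ℕ∞} {θ c : ℝ} (h : IsUpper p θ 1 c)
include h

lemma IsUpper.iter_mem_Ico (n : ℕ) {s : ℝ} (hs : s ∈ Ico (0 : ℝ) 1) :
    iter p n s ∈ Ico (0 : ℝ) 1 := by
  induction n with
  | zero => exact hs
  | succ n ih =>
    rw [iter_succ']
    exact ⟨pgf_nonneg p ih.1, h.pgf_lt_one ih⟩

/-- In the coordinate (1-s)^{-θ} a critical step is translation by c. -/
lemma IsUpper.one_sub_iter_rpow (n : ℕ) {s : ℝ} (hs : s ∈ Ico (0 : ℝ) 1) :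
    (1 - iter p n s) ^ (-θ) = (1 - s) ^ (-θ) + n * c := by
  induction n with
  | zero => simp [iter_zero]
  | succ n ih =>
    rw [iter_succ', h.one_sub_pgf_rpow (h.iter_mem_Ico n hs), ih]
    push_cast
    ring

lemma IsUpper.one_sub_iter (n : ℕ) {s : ℝ} (hs : s ∈ Ico (0 : ℝ) 1) :
    1 - iter p n s = ((1 - s) ^ (-θ) + n * c) ^ (-1 / θ) := by
  rw [← h.one_sub_iter_rpow n hs,
    rpow_rpow_cancel (sub_nonneg.2 (h.iter_mem_Ico n hs).2.le) h.theta_mem.1.ne']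

lemma IsUpper.tendsto_iter {s : ℝ} (hs : s ∈ Ico (0 : ℝ) 1) :
    Tendsto (fun n => iter p n s) atTop (𝓝 1) := by
  have h1 : Tendsto (fun n : ℕ => (1 - s) ^ (-θ) + n * c) atTop atTop :=
    tendsto_atTop_add_const_left _ _ (tendsto_natCast_atTop_atTop.atTop_mul_const h.c_pos)
  have h2 := (tendsto_rpow_neg_atTop (one_div_pos.2 h.theta_mem.1)).comp h1
  have h3 := h2.const_sub 1
  rw [sub_zero] at h3
  refine h3.congr fun n => ?_
  rw [Function.comp_apply, ← neg_div, ← h.one_sub_iter n hs, sub_sub_cancel]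

lemma IsUpper.extRoot_eq_one : extRoot p = 1 := by
  refine le_antisymm (csInf_le ⟨0, fun x hx => hx.1.1⟩ ⟨by simp, h.pgf_one⟩) ?_
  refine le_csInf ⟨1, by simp, h.pgf_one⟩ fun x hx => ?_
  by_contra! hlt
  have h1 := h.one_sub_pgf_rpow ⟨hx.1.1, hlt⟩
  rw [hx.2, one_mul] at h1
  linarith [h.c_pos]

lemma IsUpper.hasDerivWithinAt_one : HasDerivWithinAt (pgf p) 1 (Icc 0 1) 1 := by
  simpa using h.hasDerivWithinAt

lemma IsUpper.gam_eq_one : gam p = 1 := by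
  rw [gam, h.extRoot_eq_one]
  exact h.hasDerivWithinAt_one.derivWithin (uniqueDiffOn_Icc one_pos 1 (by simp))

/-- R is constant along each orbit, and the orbits tend to 1, where R is continuous and vanishes. -/
lemma IsUpper.eq_zero_of_invariant {R : ℝ → ℝ} (hR : ∀ s ∈ Ico (0 : ℝ) 1, R (pgf p s) = R s)
    (hR1 : R 1 = 0) (hRc : ContinuousWithinAt R (Icc 0 1) 1) :
    ∀ s ∈ Icc (0 : ℝ) 1, R s = 0 := by
  intro s hs
  rcases hs.2.lt_or_eq with hlt | rfl
  · have hs' : s ∈ Ico (0 : ℝ) 1 := ⟨hs.1, hlt⟩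
    have hn : ∀ n, R (iter p n s) = R s := by
      intro n
      induction n with
      | zero => rfl
      | succ n ih => rw [iter_succ', hR _ (h.iter_mem_Ico n hs'), ih]
    have h1 : Tendsto (fun n => iter p n s) atTop (𝓝[Icc 0 1] 1) :=
      tendsto_nhdsWithin_iff.2 ⟨h.tendsto_iter hs', Eventually.of_forall fun n =>
        Ico_subset_Icc_self (h.iter_mem_Ico n hs')⟩
    have h2 := hRc.tendsto.comp h1
    rw [hR1] at h2
    exact tendsto_nhds_unique (tendsto_const_nhds.congr fun n => (hn n).symm) h2
  · exact hR1

/-- P_n(i,j) 2^{-j} is one term of the nonnegative series for f_n(1/2)^i - f_n(0)^i, which tends to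
1 - 1 = 0. -/
lemma IsUpper.tendsto_transProb (i : ℕ) {j : ℕ} (hj : 1 ≤ j) :
    Tendsto (fun n => transProb p n i j) atTop (𝓝 0) := by
  have hhalf : (1 / 2 : ℝ) ∈ Ico (0 : ℝ) 1 := by norm_num
  have h1 : Tendsto (fun n => (iter p n (1 / 2) ^ i - iter p n 0 ^ i) / (1 / 2 : ℝ) ^ j) atTop
      (𝓝 0) := by
    have := (((h.tendsto_iter hhalf).pow i).sub
      ((h.tendsto_iter (s := 0) (by simp)).pow i)).div_const ((1 / 2 : ℝ) ^ j)
    simpa using this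
  refine squeeze_zero (fun n => transProb_nonneg p n i j) (fun n => ?_) h1
  rw [le_div_iff₀ (by positivity)]
  have h2 := le_hasSum (transProb_tail_hasSum (invariant_Icc p) n i
    (Ico_subset_Icc_self hhalf)) j fun k _ => ?_
  · rwa [if_neg (by omega)] at h2
  · have := transProb_nonneg p n i k
    split_ifs <;> positivity

/-- Put N = nc. Then (v + N)^{-1/θ} = N^{-1/θ}(1 + v/N)^{-1/θ}, and the difference between v = 1 and
v = w is of first order in 1/N, with coefficient (w - 1)/θ. -/
lemma IsUpper.tendsto_iter_sub {s : ℝ} (hs : s ∈ Ico (0 : ℝ) 1) :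
    Tendsto (fun n : ℕ => (iter p n s - iter p n 0) / (((n : ℝ) * c) ^ (-1 / θ) * (n * c)⁻¹))
      atTop (𝓝 (((1 - s) ^ (-θ) - 1) / θ)) := by
  have hθ := h.theta_mem.1
  have hc := h.c_pos
  set w := (1 - s) ^ (-θ) with hw
  have hw0 : 0 < w := Real.rpow_pos_of_pos (sub_pos.2 hs.2) _
  have hder : ∀ v : ℝ, HasDerivAt (fun ε : ℝ => (1 + v * ε) ^ (-1 / θ)) (v * (-1 / θ)) 0 := by
    intro v
    have h1 : HasDerivAt (fun ε : ℝ => 1 + v * ε) v 0 := by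
      simpa using ((hasDerivAt_id (0 : ℝ)).const_mul v).const_add 1
    have h2 := h1.rpow_const (p := -1 / θ) (Or.inl (by simp))
    simpa using h2
  have h1 := hasDerivAt_iff_tendsto_slope.1 ((hder 1).sub (hder w))
  have hx : Tendsto (fun n : ℕ => (n : ℝ) * c) atTop atTop :=
    tendsto_natCast_atTop_atTop.atTop_mul_const hc
  have h2 : Tendsto (fun n : ℕ => ((n : ℝ) * c)⁻¹) atTop (𝓝[≠] 0) := by
    refine tendsto_nhdsWithin_iff.2 ⟨tendsto_inv_atTop_zero.comp hx, ?_⟩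
    filter_upwards [eventually_gt_atTop 0] with n hn
    have : (0 : ℝ) < n := by exact_mod_cast hn
    exact inv_ne_zero (by positivity)
  have h3 := h1.comp h2
  rw [show 1 * (-1 / θ) - w * (-1 / θ) = (w - 1) / θ by field_simp; ring] at h3
  refine h3.congr' ?_
  filter_upwards [eventually_gt_atTop 0] with n hn
  have hn0 : (0 : ℝ) < n := by exact_mod_cast hn
  have hN : 0 < (n : ℝ) * c := by positivity
  have e : ∀ v : ℝ, 0 < v → (v + n * c) ^ (-1 / θ) =
      (n * c) ^ (-1 / θ) * (1 + v * (n * c)⁻¹) ^ (-1 / θ) := by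
    intro v hv
    rw [← Real.mul_rpow hN.le (by positivity)]
    congr 1
    field_simp
    ring
  have e1 := h.one_sub_iter n hs
  have e2 := h.one_sub_iter n (s := 0) (by simp)
  rw [sub_zero, Real.one_rpow, e 1 one_pos] at e2
  rw [← hw, e w hw0] at e1
  have hpos : 0 < ((n : ℝ) * c) ^ (-1 / θ) := Real.rpow_pos_of_pos hN _
  rw [Function.comp_apply, slope_def_field,
    show iter p n s - iter p n 0 = (1 - iter p n 0) - (1 - iter p n s) by ring, e1, e2]
  simp only [Pi.sub_apply, mul_zero, add_zero, sub_self, sub_zero]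
  field_simp

lemma IsUpper.one_sub_offProb : 1 - offProb p 0 = (1 + c) ^ (-1 / θ) := by
  have := h.one_sub_pgf (s := 0) (by simp)
  rwa [pgf_zero, sub_zero, Real.one_rpow, mul_one] at this

lemma IsUpper.offProb_mem : offProb p 0 ∈ Ioo (0 : ℝ) 1 := by
  have h1 := h.one_sub_offProb
  have hc := h.c_pos
  have h2 : (1 + c) ^ (-1 / θ) < 1 := Real.rpow_lt_one_of_one_lt_of_neg (by linarith)
    (div_neg_of_neg_of_pos (by norm_num) h.theta_mem.1)
  have h3 : 0 < (1 + c) ^ (-1 / θ) := Real.rpow_pos_of_pos (by linarith) _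
  exact ⟨by linarith, by linarith⟩

lemma IsUpper.mul_offProb_mem {s : ℝ} (hs : s ∈ Icc (0 : ℝ) 1) :
    s * offProb p 0 ∈ Ico (0 : ℝ) 1 := by
  have h0 := h.offProb_mem
  exact ⟨mul_nonneg hs.1 h0.1.le, (mul_le_of_le_one_left h0.1.le hs.2).trans_lt h0.2⟩

/-- The normalization and the factor 1/θ cancel; the denominator becomes c because (1 - p_0)^{-θ} =
1 + c. -/
lemma IsUpper.tendsto_ratio {s : ℝ} (hs : s ∈ Icc (0 : ℝ) 1) :
    Tendsto (fun n => (iter p n (s * offProb p 0) - iter p n 0) /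
      (iter p n (offProb p 0) - iter p n 0)) atTop
      (𝓝 (((1 - s * (1 - (1 + c) ^ (-1 / θ))) ^ (-θ) - 1) / c)) := by
  have hθ := h.theta_mem.1
  have hc := h.c_pos
  have h0 := h.offProb_mem
  have hp : 1 - (1 + c) ^ (-1 / θ) = offProb p 0 := by linarith [h.one_sub_offProb]
  have hden : (1 - offProb p 0) ^ (-θ) - 1 = c := by
    rw [h.one_sub_offProb, rpow_rpow_cancel' (by linarith) hθ.ne', add_sub_cancel_left]
  have h1 := h.tendsto_iter_sub (Ioo_subset_Ico_self h0)
  rw [hden] at h1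
  have h2 := (h.tendsto_iter_sub (h.mul_offProb_mem hs)).div h1 (by positivity)
  rw [div_div_div_cancel_right₀ hθ.ne'] at h2
  rw [hp]
  refine h2.congr' ?_
  filter_upwards [eventually_gt_atTop 0] with n hn
  have hn0 : (0 : ℝ) < n := by exact_mod_cast hn
  have hN : 0 < (n : ℝ) * c := by positivity
  simp only [Pi.div_apply]
  rw [div_div_div_cancel_right₀]
  exact mul_ne_zero (Real.rpow_pos_of_pos hN _).ne' (inv_ne_zero hN.ne')

lemma IsUpper.iter_zero_lt (n : ℕ) : iter p n 0 < iter p n (offProb p 0) := by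
  have h0 := h.offProb_mem
  refine lt_of_le_of_ne (iter_mono p n le_rfl h0.1.le h0.2.le) fun heq => ?_
  have h1 := h.one_sub_iter_rpow n (s := 0) (by simp)
  rw [heq, h.one_sub_iter_rpow n (Ioo_subset_Ico_self h0), h.one_sub_offProb,
    rpow_rpow_cancel' (by linarith [h.c_pos]) h.theta_mem.1.ne', sub_zero, Real.one_rpow] at h1
  linarith [h.c_pos]

lemma IsUpper.qChain_of_critical : QChain p := by
  have hq := h.extRoot_eq_one
  refine qChain ?_ ?_ ?_ ?_ ?_
  · rw [hq]; exact one_pos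
  · rw [hq]
  · rw [hq, h.pgf_one]
  · rw [h.gam_eq_one]; exact one_pos
  · rw [hq, h.gam_eq_one]; exact h.hasDerivWithinAt_one

/-! ### Conditional limit laws in the critical case. -/

variable {Ω : Type*} [MeasurableSpace Ω] (P : Measure Ω) [IsProbabilityMeasure P]

/-- Here γ^k gives no useful scale, and δ_k = 1 - f_k(0) replaces it. The quotient δ_{n+k}/δ_k is
the slope of f_n between f_k(0) and 1, which tends to f_n'(1) = 1. -/
lemma IsUpper.qLimit_of_critical : QLimit P p := by
  have hq := h.extRoot_eq_one
  have hγ := h.gam_eq_one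
  have h0I : (0 : ℝ) ∈ Ico (0 : ℝ) 1 := by simp
  have h1 := iter_one_of_top p h.top
  have h0 := h.tendsto_iter h0I
  have hpos : ∀ k, 0 < 1 - iter p k 0 := fun k => sub_pos.2 (h.iter_mem_Ico k h0I).2
  refine qLimit (r := 1) (X := 1) (y := fun _ => 1) (δ := fun k => 1 - iter p k 0)
    (by rw [hq]; exact one_pos) (by rw [hγ]; exact one_pos) (by rwa [hq])
    (tendsto_const_nhds.congr fun n => (h1 n).symm) (fun _ => hq.symm)
    (by rw [hq]; exact tendsto_const_nhds) (fun k j => by rw [h1, hq]; simp)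
    (fun k => (h.iter_mem_Ico k h0I).2) one_ne_zero (fun k => (hpos k).ne')
    (tendsto_const_nhds.congr fun k => (div_self (hpos k).ne').symm) fun n => ?_
  rw [hγ]
  have h2 := hasDerivWithinAt_iff_tendsto_slope.1
    (hasDerivWithinAt_iter (n := n) (by rw [hq, h.pgf_one])
      (by rw [hq, hγ]; exact h.hasDerivWithinAt_one))
  rw [hq, hγ] at h2
  have h3 : Tendsto (fun k => iter p k 0) atTop (𝓝[Icc 0 1 \ {1}] 1) :=
    tendsto_nhdsWithin_iff.2 ⟨h0, Eventually.of_forall fun k =>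
      ⟨Ico_subset_Icc_self (h.iter_mem_Ico k h0I), (h.iter_mem_Ico k h0I).2.ne⟩⟩
  refine (h2.comp h3).congr fun k => ?_
  rw [Function.comp_apply, slope_def_field, h1, ← iter_add, ← neg_div_neg_eq, neg_sub, neg_sub]

/-- The limit of the critical process given the exact time of extinction. -/
lemma IsUpper.condLimit_of_critical :
    CondLimit P p (fun Z n => {ω | extinctionTime Z ω = ((n + 1 : ℕ) : ℕ∞)})
      (fun s => ((1 - s * (1 - (1 + c) ^ (-1 / θ))) ^ (-θ) - 1) / c) := by
  have h0 := h.offProb_mem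
  have hp : 1 - (1 + c) ^ (-1 / θ) = offProb p 0 := by linarith [h.one_sub_offProb]
  -- Since p_0 = f(0), this is f_{n+1}(0) - f_n(0), the probability of extinction exactly at time n
  -- + 1. From Z_n = j the next generation is empty with probability p_0^j, whence the argument s
  -- p_0 below.
  set e : ℕ → ℝ := fun n => iter p n (offProb p 0) - iter p n 0 with he
  have hepos : ∀ n, 0 < e n := fun n => sub_pos.2 (h.iter_zero_lt n)
  have ha : ∀ n j, 0 ≤ (if j = 0 then 0 else transProb p n 1 j) * offProb p 0 ^ j / e n := by
    intro n j
    have := transProb_nonneg p n 1 j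
    have := h0.1
    have := hepos n
    split_ifs <;> positivity
  have hF : ∀ n, ∀ s ∈ Icc (0 : ℝ) 1,
      HasSum (fun j => (if j = 0 then 0 else transProb p n 1 j) * offProb p 0 ^ j / e n * s ^ j)
        ((iter p n (s * offProb p 0) - iter p n 0) / e n) := by
    intro n s hs
    have h1 := transProb_tail_hasSum (invariant_Icc p) n 1
      (Ico_subset_Icc_self (h.mul_offProb_mem hs))
    refine (h1.div_const (e n)).of_eq (fun j => ?_) (by simp)
    rw [mul_pow]
    ring
  have hG : ContinuousOn (fun s => ((1 - s * (1 - (1 + c) ^ (-1 / θ))) ^ (-θ) - 1) / c)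
      (Icc 0 1) := by
    rw [hp]
    refine ContinuousOn.div_const (ContinuousOn.sub (ContinuousOn.rpow_const (by fun_prop)
      fun s hs => Or.inl ?_) continuousOn_const) c
    exact (sub_pos.2 (h.mul_offProb_mem hs).2).ne'
  obtain ⟨b, hb0, hb, hbs⟩ := exists_limit_coeff Ico_subset_Icc_self (fun s hs => hs.1)
    (fun s hs => Icc_subset_Icc_right hs.2) ha hF (fun s hs => h.tendsto_ratio hs) hG
  refine ⟨b, tendsto_nhds_unique (hb 0) (by simp), hb0, hbs,
    fun Z hZ => ⟨fun n hn => ?_, fun j hj => ?_⟩⟩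
  · have h1 := hZ.measureReal_extinctionTime_eq n
    rw [measureReal_def, hn, ENNReal.toReal_zero, iter_succ, pgf_zero, pow_one, pow_one] at h1
    exact (hepos n).ne h1
  · refine (hb j).congr fun n => ?_
    rw [cond_real_eq_div _ (measurableSet_eq hZ.measurable n j),
      hZ.measureReal_extinctionTime_eq, hZ.measureReal_extinctionTime_eq_inter n hj,
      if_neg (by omega), iter_succ, pgf_zero, pow_one, pow_one]

end Critical

/-! ### The `x log x` condition -/

variable {p : PMF ℕ∞}

lemma log_le_natLog (k : ℕ) : Real.log k ≤ ((Nat.log 2 k : ℝ) + 1) * Real.log 2 := by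
  rcases Nat.eq_zero_or_pos k with rfl | hk
  · simp [Real.log_nonneg]
  · have h1 : (k : ℝ) ≤ 2 ^ (Nat.log 2 k + 1) := by
      exact_mod_cast (Nat.lt_pow_succ_log_self one_lt_two k).le
    have h2 := Real.log_le_log (by exact_mod_cast hk) h1
    rw [Real.log_pow] at h2
    exact_mod_cast h2

lemma summable_xlogx_of_summable {r : ℝ} (hr : 1 < r)
    (h : Summable fun k : ℕ => offProb p k * r ^ k) :
    Summable fun k : ℕ => offProb p k * (k : ℝ) * Real.log (k : ℝ) := by
  refine summable_of_isBigO_nat h ?_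
  have h1 : (fun k : ℕ => (k : ℝ) * Real.log k) =O[atTop] fun k : ℕ => r ^ k := by
    have h2 := (isLittleO_pow_const_const_pow_of_one_lt (R := ℝ) 2 hr).isBigO
    refine (Asymptotics.IsBigO.of_bound 1 (Eventually.of_forall fun k => ?_)).trans h2
    have h3 : Real.log k ≤ k := Real.log_le_self (Nat.cast_nonneg k)
    have h4 : 0 ≤ Real.log k := Real.log_natCast_nonneg k
    rw [one_mul, Real.norm_of_nonneg (by positivity), Real.norm_of_nonneg (by positivity), pow_two]
    gcongr
  have := (Asymptotics.isBigO_refl (fun k => offProb p k) atTop).mul h1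
  simpa only [mul_assoc] using this

/-- After the factor a^{-1/θ} is taken out, the claim is (1+y)^{-1/θ} ≥ 1 - y/θ, which follows from
e^t ≥ 1 + t and log(1+y) ≤ y. -/
lemma rpow_sub_le {a c θ x : ℝ} (ha : 0 < a) (hc : 0 ≤ c) (hθ : 0 < θ) (hx : 0 ≤ x) :
    a ^ (-1 / θ) - (a + c * x) ^ (-1 / θ) ≤ a ^ (-1 / θ) * (c / (a * θ)) * x := by
  have hy : 0 ≤ c / a * x := by positivity
  have h1 : a + c * x = a * (1 + c / a * x) := by field_simp
  rw [h1, Real.mul_rpow ha.le (by positivity)]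
  have h2 : 1 - c / a * x / θ ≤ (1 + c / a * x) ^ (-1 / θ) := by
    rw [Real.rpow_def_of_pos (by positivity)]
    have h3 := Real.add_one_le_exp (Real.log (1 + c / a * x) * (-1 / θ))
    have h4 : Real.log (1 + c / a * x) ≤ c / a * x := by
      have := Real.log_le_sub_one_of_pos (show 0 < 1 + c / a * x by positivity)
      linarith
    have h5 : Real.log (1 + c / a * x) / θ ≤ c / a * x / θ := by gcongr
    have h6 : Real.log (1 + c / a * x) * (-1 / θ) = -(Real.log (1 + c / a * x) / θ) := by ring
    linarith
  have h7 : 0 < a ^ (-1 / θ) := Real.rpow_pos_of_pos ha _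
  have h8 : a ^ (-1 / θ) * (c / (a * θ)) * x = a ^ (-1 / θ) * (c / a * x / θ) := by
    field_simp
  rw [h8]
  nlinarith

/-- The mean of g_n is f'(1) - 2^n(1 - f(1 - 2^{-n})), which is O(2^{-θn}) and hence summable over
n. On the other hand g_n(k) ≥ k/2 for every n < log₂ k, so the sum over n dominates (k log₂ k)/2. -/
lemma IsUpper.summable_xlogx {θ a c : ℝ} (h : IsUpper p θ a c) :
    Summable fun k : ℕ => offProb p k * (k : ℝ) * Real.log (k : ℝ) := by
  have hθ := h.theta_mem.1
  have ha := h.a_pos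
  set m := a ^ (-1 / θ) with hm
  have hm0 : 0 < m := Real.rpow_pos_of_pos ha _
  have hmean : HasSum (fun k => offProb p k * (k : ℝ)) m :=
    hasSum_deriv_one (offProb_nonneg p) (fun x hx => hasSum_pgf p hx) h.hasDerivWithinAt
  -- The defect between k and the difference quotient of x^k over [1 - 2^{-n}, 1]; it is nonnegative
  -- by Bernoulli's inequality.
  set g : ℕ → ℕ → ℝ := fun n k => k - (1 - (1 - (2⁻¹ : ℝ) ^ n) ^ k) * 2 ^ n with hg
  have hu : ∀ n : ℕ, 0 < (2⁻¹ : ℝ) ^ n ∧ (2⁻¹ : ℝ) ^ n ≤ 1 := fun n =>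
    ⟨by positivity, pow_le_one₀ (by norm_num) (by norm_num)⟩
  have hinv : ∀ n : ℕ, (2⁻¹ : ℝ) ^ n * 2 ^ n = 1 := fun n => by
    rw [← mul_pow]; norm_num
  have hg0 : ∀ n k, 0 ≤ g n k := by
    intro n k
    have h1 := one_add_mul_le_pow (a := -(2⁻¹ : ℝ) ^ n) (by linarith [(hu n).2]) k
    have h2 : (1 - (1 - (2⁻¹ : ℝ) ^ n) ^ k) * 2 ^ n ≤ (k * (2⁻¹ : ℝ) ^ n) * 2 ^ n := by
      refine mul_le_mul_of_nonneg_right ?_ (by positivity)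
      rw [← sub_eq_add_neg] at h1
      linarith
    rw [mul_assoc, hinv, mul_one] at h2
    exact sub_nonneg.2 h2
  have hglarge : ∀ n k, n < Nat.log 2 k → (k : ℝ) / 2 ≤ g n k := by
    intro n k hnk
    have hk : k ≠ 0 := by rintro rfl; simp at hnk
    have h1 : (2 : ℝ) ^ n * 2 ≤ k := by
      rw [← pow_succ]
      exact_mod_cast Nat.pow_le_of_le_log hk hnk
    have h2 : (1 - (1 - (2⁻¹ : ℝ) ^ n) ^ k) * 2 ^ n ≤ 1 * 2 ^ n := by
      refine mul_le_mul_of_nonneg_right ?_ (by positivity)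
      linarith [pow_nonneg (sub_nonneg.2 (hu n).2) k]
    simp only [hg]
    linarith
  set M := m * (c / (a * θ)) with hM
  set ρ := (2⁻¹ : ℝ) ^ θ with hρ
  have hρ0 : 0 ≤ ρ := by positivity
  have hρ1 : ρ < 1 := Real.rpow_lt_one (by norm_num) (by norm_num) hθ
  have hM0 : 0 ≤ M := by have := h.c_pos; positivity
  have hgsum : ∀ n, HasSum (fun k => offProb p k * g n k)
      (m - (a + c * ρ ^ n) ^ (-1 / θ)) := by
    intro n
    have hs : 1 - (2⁻¹ : ℝ) ^ n ∈ Icc (0 : ℝ) 1 :=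
      ⟨by linarith [(hu n).2], by linarith [(hu n).1]⟩
    have h1 := ((hasSum_pgf p (s := 1) (by simp)).sub (hasSum_pgf p hs)).mul_right ((2 : ℝ) ^ n)
    have h2 := h.one_sub_pgf' hs
    rw [sub_sub_cancel] at h2
    have h3 : ((2⁻¹ : ℝ) ^ n) ^ θ = ρ ^ n := by
      rw [hρ, ← Real.rpow_natCast, ← Real.rpow_natCast, ← Real.rpow_mul (by norm_num),
        ← Real.rpow_mul (by norm_num), mul_comm]
    refine (hmean.sub h1).of_eq (fun k => ?_) ?_
    · simp only [hg, one_pow]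
      ring
    · rw [h.pgf_one, h2, h3, mul_right_comm, hinv, one_mul]
  have hbound : ∀ n, m - (a + c * ρ ^ n) ^ (-1 / θ) ≤ M * ρ ^ n := fun n =>
    rpow_sub_le ha h.c_pos.le hθ (pow_nonneg hρ0 n)
  have hmain : ∀ N, ∑ k ∈ Finset.range N, offProb p k * (k : ℝ) * Nat.log 2 k ≤
      2 * (M * (1 - ρ)⁻¹) := by
    intro N
    have h1 : ∀ k ∈ Finset.range N, offProb p k * (k : ℝ) * Nat.log 2 k ≤
        2 * ∑ n ∈ Finset.range N, offProb p k * g n k := by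
      intro k hk
      have hkN := Finset.mem_range.1 hk
      -- The same cut-off N serves for n and k because log₂ k ≤ k < N.
      have hsub : Finset.range (Nat.log 2 k) ⊆ Finset.range N :=
        Finset.range_subset_range.2 ((Nat.log_le_self 2 k).trans hkN.le)
      have h2 : (Nat.log 2 k : ℝ) * (k / 2) ≤ ∑ n ∈ Finset.range N, g n k := by
        calc (Nat.log 2 k : ℝ) * (k / 2) = ∑ n ∈ Finset.range (Nat.log 2 k), (k : ℝ) / 2 := by
              simp
          _ ≤ ∑ n ∈ Finset.range (Nat.log 2 k), g n k :=
              Finset.sum_le_sum fun n hn => hglarge n k (Finset.mem_range.1 hn)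
          _ ≤ _ := Finset.sum_le_sum_of_subset_of_nonneg hsub fun n _ _ => hg0 n k
      rw [← Finset.mul_sum]
      have h3 := mul_le_mul_of_nonneg_left h2 (offProb_nonneg p k)
      linarith
    calc ∑ k ∈ Finset.range N, offProb p k * (k : ℝ) * Nat.log 2 k
        ≤ ∑ k ∈ Finset.range N, 2 * ∑ n ∈ Finset.range N, offProb p k * g n k :=
          Finset.sum_le_sum h1
      _ = 2 * ∑ n ∈ Finset.range N, ∑ k ∈ Finset.range N, offProb p k * g n k := by
          rw [← Finset.mul_sum, Finset.sum_comm]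
      _ ≤ 2 * ∑ n ∈ Finset.range N, M * ρ ^ n := by
          gcongr with n
          exact (sum_le_hasSum _ (fun k _ => mul_nonneg (offProb_nonneg p k) (hg0 n k))
            (hgsum n)).trans (hbound n)
      _ ≤ 2 * (M * (1 - ρ)⁻¹) := by
          rw [← Finset.mul_sum]
          gcongr
          exact sum_le_hasSum _ (fun n _ => pow_nonneg hρ0 n) (hasSum_geometric_of_lt_one hρ0 hρ1)
  have hlog : Summable fun k : ℕ => offProb p k * (k : ℝ) * Nat.log 2 k :=
    summable_of_sum_range_le (fun k => by have := offProb_nonneg p k; positivity) hmain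
  refine Summable.of_nonneg_of_le (fun k => ?_) (fun k => ?_)
    ((hlog.add hmean.summable).mul_right (Real.log 2))
  · have := offProb_nonneg p k
    have := Real.log_natCast_nonneg k
    positivity
  · have h1 := mul_le_mul_of_nonneg_left (log_le_natLog k)
      (mul_nonneg (offProb_nonneg p k) (Nat.cast_nonneg (α := ℝ) k))
    linarith

/-- A law of mean less than `1` has no fixed point of `f` in `[0,1)`. -/
lemma not_fixed_of_mean_lt (hm : meanOffspring p < 1) {q : ℝ} (hq : q ∈ Ico (0 : ℝ) 1) :
    pgf p q ≠ q := by
  intro hfix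
  have hqI : q ∈ Icc (0 : ℝ) 1 := ⟨hq.1, hq.2.le⟩
  have hm' := hm
  rw [meanOffspring, tsum_enat_add_top] at hm'
  have htop : p ⊤ = 0 := by
    by_contra hne
    simp [ENNReal.top_mul hne] at hm'
  simp only [htop, mul_zero, zero_add] at hm'
  have hsum : Summable fun k : ℕ => (k : ℝ) * offProb p k := by
    have := ENNReal.summable_toReal hm'.ne_top
    simpa [offProb] using this
  have hlt : ∑' k : ℕ, (k : ℝ) * offProb p k < 1 := by
    have h1 := (ENNReal.toReal_lt_toReal hm'.ne_top ENNReal.one_ne_top).2 hm'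
    rw [ENNReal.tsum_toReal_eq fun k => ENNReal.ne_top_of_tsum_ne_top hm'.ne_top k] at h1
    simpa [offProb] using h1
  have h1 := (hasSum_pgf p (s := 1) (by simp)).sub (hasSum_pgf p hqI)
  rw [show pgf p 1 = 1 from iter_one_of_top p htop 1, hfix] at h1
  have h2 : 1 - q ≤ (1 - q) * ∑' k : ℕ, (k : ℝ) * offProb p k := by
    refine hasSum_le (fun k => ?_) h1 (hsum.hasSum.mul_left (1 - q))
    have h3 := one_add_mul_le_pow (a := q - 1) (by linarith [hq.1]) k
    rw [add_sub_cancel] at h3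
    have h4 := mul_le_mul_of_nonneg_left h3 (offProb_nonneg p k)
    rw [one_pow]
    linarith
  have h3 : 0 < 1 - q := sub_pos.2 hq.2
  nlinarith

/-- If A = 1 there is a fixed point q < 1, which a mean below 1 forbids; if A > 1 the series for f
converges beyond 1. -/
lemma Linearizes.summable_xlogx {A q a : ℝ} {D : Set ℝ} {Q G : ℝ → ℝ} {C : ℝ}
    (h : Linearizes p q a D Q G C) (hA : (A = 1 ∧ q ∈ Ico (0 : ℝ) 1) ∨ (1 < A ∧ q ∈ Icc (0 : ℝ) 1))
    (hD : Ico 0 A ⊆ D) (hm : meanOffspring p < 1) :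
    Summable fun k : ℕ => offProb p k * (k : ℝ) * Real.log (k : ℝ) := by
  rcases hA with hA | hA
  · exact absurd h.pgf_q (not_fixed_of_mean_lt hm hA.2)
  · obtain ⟨r, hr1, hrA⟩ := exists_between hA.1
    exact summable_xlogx_of_summable hr1 (h.inv r (hD ⟨by linarith, hrA⟩)).2.1

lemma InG.summable_xlogx {θ : ℝ} (h : InG p θ) (hm : meanOffspring p < 1) :
    Summable fun k : ℕ => offProb p k * (k : ℝ) * Real.log (k : ℝ) := by
  rcases h with ⟨a, c, h⟩ | ⟨A, q, a, h⟩ | ⟨-, A, q, a, h⟩ | ⟨-, q, a, h⟩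
  · exact h.summable_xlogx
  · obtain ⟨D, hD, hl⟩ := h.linearizes
    exact hl.summable_xlogx h.adm.2 hD hm
  · exact h.linearizes.summable_xlogx h.adm.2 subset_rfl hm
  · exact summable_xlogx_of_summable one_lt_two (h.gen 2 (mem_Ici.2 zero_le_two)).summable

/-! ### All families -/

lemma InG.qChain_and_qLimit {θ : ℝ} (h : InG p θ) (hq : 0 < extRoot p) {Ω : Type*} [MeasurableSpace Ω]
    (P : Measure Ω) [IsProbabilityMeasure P] : QChain p ∧ QLimit P p := by
  rcases h with ⟨a, c, h⟩ | ⟨A, q, a, h⟩ | ⟨-, A, q, a, h⟩ | ⟨-, q, a, h⟩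
  · rcases h.one_le_a.eq_or_lt with rfl | ha
    · exact ⟨h.qChain_of_critical, h.qLimit_of_critical P⟩
    · have ha' : a - 1 ≠ 0 := by linarith
      -- This is the choice d = c/(a-1).
      have h' : IsUpper p θ a ((a - 1) * (c / (a - 1))) := by rwa [mul_div_cancel₀ _ ha']
      exact ⟨(h'.linearizes ha).qChain hq, (h'.linearizes ha).qLimit P hq⟩
  · obtain ⟨D, -, hl⟩ := h.linearizes
    exact ⟨hl.qChain hq, hl.qLimit P hq⟩
  · exact ⟨h.linearizes.qChain hq, h.linearizes.qLimit P hq⟩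
  · exact ⟨h.linearizes.qChain hq, h.linearizes.qLimit P hq⟩

/-- The domain supplied by `IsPower.linearizes` may be larger than [0,A), so invariance of [0,A)
needs its own proof. -/
lemma IsPower.mapsTo {θ A q a : ℝ} (h : IsPower p θ A q a) :
    ∀ s ∈ Ico (0 : ℝ) A, pgf p s ∈ Ico (0 : ℝ) A := by
  intro s hs
  refine ⟨pgf_nonneg p hs.1, ?_⟩
  rw [pgf, (h.gen s hs).tsum_eq, sub_lt_self_iff]
  have h1 : 0 < (A - s) ^ (-θ) := Real.rpow_pos_of_pos (sub_pos.2 hs.2) _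
  have h2 : 0 < (A - q) ^ (-θ) := Real.rpow_pos_of_pos (sub_pos.2 h.adm.q_lt) _
  have h3 := h.adm.1.1
  have h4 : 0 < 1 - a := sub_pos.2 h.adm.1.2
  exact Real.rpow_pos_of_pos (by positivity) _

end ThetaBranching

/-! ### Assembly of the statements for all families. -/

theorem mainTheorem5 {Ω : Type*} [MeasurableSpace Ω] (P : Measure Ω) [IsProbabilityMeasure P]
    (p : PMF ℕ∞) :
    -- the `Q`-process of a theta-branching process
    (∀ θ : ℝ, ThetaBranching.InG p θ →
      (∀ (i : ℕ) (Z : ℕ → Ω → ℕ∞), 1 ≤ i → ThetaBranching.IsGaltonWatson P p i Z → ∀ n : ℕ,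
        P.real {ω | (n : ℕ∞) < ThetaBranching.absorptionTime Z ω} =
          ThetaBranching.iter p n 1 ^ i - ThetaBranching.iter p n 0 ^ i) ∧
      (0 < ThetaBranching.extRoot p →
        ThetaBranching.QChain p ∧ ThetaBranching.QLimit P p)) ∧
    -- `θ ∈ (-1,0) ∪ (0,1]`, `A > q`
    (∀ θ A q a : ℝ, ThetaBranching.IsPower p θ A q a →
      ThetaBranching.NonCriticalFacts P p q a (Ico 0 A)
        (fun s => (A - s) ^ (-θ) - (A - q) ^ (-θ)) (θ * (A - q) ^ (-θ - 1))) ∧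
    -- `θ = 0`
    (∀ A q a : ℝ, ThetaBranching.IsLog p A q a →
      ThetaBranching.NonCriticalFacts P p q a (Ico 0 A)
        (fun s => Real.log ((A - s) / (A - q))) (-1 / (A - q))) ∧
    -- `θ = -1`, where `(A - s) - (A - q) = q - s`
    (∀ q a : ℝ, ThetaBranching.IsLinear p q a →
      ThetaBranching.NonCriticalFacts P p q a (Ici 0) (fun s => q - s) (-1)) ∧
    -- `A = q = 1`, subcritical; the value at `s = 1` is the left limit
    (∀ θ a d : ℝ, ThetaBranching.IsUpper p θ a ((a - 1) * d) → 1 < a →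
      ThetaBranching.NonCriticalFacts P p 1 (a ^ (-1 / θ)) (Icc 0 1)
        (fun s => if s = 1 then 0 else ((1 - s) ^ (-θ) + d) ^ (-1 / θ)) (-1)) ∧
    -- `A = q = 1`, critical
    (∀ θ c : ℝ, ThetaBranching.IsUpper p θ 1 c →
      ThetaBranching.extRoot p = 1 ∧ ThetaBranching.gam p = 1 ∧
      (∀ R : ℝ → ℝ, (∀ s ∈ Ico (0 : ℝ) 1, R (ThetaBranching.pgf p s) = R s) → R 1 = 0 →
        ContinuousWithinAt R (Icc 0 1) 1 → ∀ s ∈ Icc (0 : ℝ) 1, R s = 0) ∧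
      (∀ i j : ℕ, 1 ≤ i → 1 ≤ j →
        Tendsto (fun n => ThetaBranching.transProb p n i j) atTop (𝓝 0)) ∧
      (∀ s ∈ Icc (0 : ℝ) 1,
        Tendsto (fun n =>
            (ThetaBranching.iter p n (s * ThetaBranching.offProb p 0) -
                ThetaBranching.iter p n 0) /
              (ThetaBranching.iter p n (ThetaBranching.offProb p 0) -
                ThetaBranching.iter p n 0))
          atTop (𝓝 (((1 - s * (1 - (1 + c) ^ (-1 / θ))) ^ (-θ) - 1) / c))) ∧
      ThetaBranching.CondLimit P p
        (fun Z n => {ω | ThetaBranching.extinctionTime Z ω = ((n + 1 : ℕ) : ℕ∞)})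
        (fun s => ((1 - s * (1 - (1 + c) ^ (-1 / θ))) ^ (-θ) - 1) / c)) ∧
    -- the `x log x` condition for every subcritical theta-branching process
    (∀ θ : ℝ, ThetaBranching.InG p θ → ThetaBranching.meanOffspring p < 1 →
      Summable fun k : ℕ => ThetaBranching.offProb p k * (k : ℝ) * Real.log (k : ℝ)) := by
  refine ⟨fun θ h => ⟨fun i Z _ hZ n => hZ.measureReal_survival n, fun hq => h.qChain_and_qLimit hq P⟩,
    fun θ A q a h => ?_, fun A q a h => ?_, fun q a h => ?_, fun θ a d h ha => ?_,
    fun θ c h => ⟨h.extRoot_eq_one, h.gam_eq_one,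
      fun R hR hR1 hRc => h.eq_zero_of_invariant hR hR1 hRc,
      fun i j _ hj => h.tendsto_transProb i hj, fun s hs => h.tendsto_ratio hs,
      h.condLimit_of_critical P⟩, fun θ h hm => h.summable_xlogx hm⟩
  · obtain ⟨D, hD, hl⟩ := h.linearizes
    exact hl.nonCriticalFacts P hD h.mapsTo
  · exact h.linearizes.nonCriticalFacts P subset_rfl fun s hs => (h.linearizes.inv s hs).2.2
  · exact h.linearizes.nonCriticalFacts P subset_rfl fun s hs => (h.linearizes.inv s hs).2.2
  · exact (h.linearizes ha).nonCriticalFacts P subset_rfl fun s hs =>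
      ((h.linearizes ha).inv s hs).2.2
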